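/- Definitions. An entire function $E$ is in the Hermite–Biehler class $\mathcal{HB}$ if $|E(\bar z)|<|E(z)|$ for all $z$ with $\operatorname{Im} z>0$. Write $f^*(z)=\overline{f(\bar z)}$. For $E\in\mathcal{HB}$, the de Branges space $\mathcal H(E)$ consists of all entire functions $f$ with $\|f\|_E^2=\int_{\mathbb R}|f(t)/E(t)|^2\,dt<\infty$ such that $f/E$ and $f^*/E$ are of bounded type (quotients of bounded analytic functions) and of nonpositive mean type $\limsup_{y\to+\infty} y^{-1}\log|\cdot(iy)|$ in the upper half-plane. Its reproducing kernel is $$K_E(w,z)=\frac{\overline{E(w)}E(z)-E(\bar w)E^*(z)}{2\pi i(\bar w-z)},$$ extended continuously to $z=\bar w$. We write $\mathcal H(E_0)=\mathcal H(E)$ if the two spaces coincide as sets and have equivalent norms. If $E\in\mathcal{HB}$ has no real zeros, a phase function $\varphi_E$ of $E$ is a continuous, strictly increasing function $\varphi_E:\mathbb R\to\mathbb R$ with $E(x)=|E(x)|e^{-i\varphi_E(x)}$ for all real $x$; it exists, is differentiable, and is unique up to an additive multiple of $2\pi$. Theorem. Let $E_0,E,F\in\mathcal{HB}$ have no real zeros,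 let $\mathcal H(E_0)=\mathcal H(E)$, let $\varphi_E,\varphi_F,\varphi_{EF}$ be phase functions of $E$, $F$ and $EF$, and suppose that there is a constant $C$ with $\varphi_F'(x)\le C\varphi_E'(x)$ for all real $x$. Then there are constants $A,B>0$ such that for every $\alpha\in[0,\pi)$ the following holds. Let $\{\lambda_n\}$ be the sequence of real solutions of $\varphi_{EF}(\lambda_n)=n\pi+\alpha$, where $n$ runs over all integers for which a solution exists. Then $\{\lambda_n\}$ is a normalized sampling sequence for $\mathcal H(E_0)$ with bounds $A,B$, that is, $$A\|f\|_{E_0}^2\le\sum_n\frac{|f(\lambda_n)|^2}{K_{E_0}(\lambda_n,\lambda_n)}\le B\|f\|_{E_0}^2\qquad\text{for all } f\in\mathcal H(E_0).$$ -/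

import Mathlib

namespace DeBranges

open scoped ComplexConjugate

noncomputable section

/-- The open upper half-plane, as a subset of `ℂ`. -/
def upper : Set ℂ := {z | 0 < z.im}

/-- The Hermite–Biehler class: entire functions with `|E (conj z)| < |E z|` on the
open upper half-plane. -/
structure HermiteBiehler (E : ℂ → ℂ) : Prop where
  entire : Differentiable ℂ E
  lt : ∀ z ∈ upper, ‖E (conj z)‖ < ‖E z‖

/-- `f` has no zeros on the real line. -/
def NoRealZeros (f : ℂ → ℂ) : Prop := ∀ x : ℝ, f x ≠ 0

/-- `f^*(z) = conj (f (conj z))`. -/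
def star (f : ℂ → ℂ) : ℂ → ℂ := fun z => conj (f (conj z))

/-- An analytic function on the upper half-plane is of bounded type if it is a quotient `g / h`
of two bounded analytic functions there, the denominator not being identically zero. -/
def BoundedType (f : ℂ → ℂ) : Prop :=
  DifferentiableOn ℂ f upper ∧
  ∃ g h : ℂ → ℂ,
    DifferentiableOn ℂ g upper ∧ DifferentiableOn ℂ h upper ∧
    (∃ M : ℝ, ∀ z ∈ upper, ‖g z‖ ≤ M) ∧ (∃ M : ℝ, ∀ z ∈ upper, ‖h z‖ ≤ M) ∧
    (∃ z ∈ upper, h z ≠ 0) ∧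
    ∀ z ∈ upper, f z * h z = g z

/-- Mean type in the upper half-plane: `limsup_{y → +∞} log |f (i y)| / y`, as an extended real,
with `log 0 = -∞`. -/
def meanType (f : ℂ → ℂ) : EReal :=
  Filter.limsup (fun y : ℝ => ENNReal.log ‖f (y * Complex.I)‖ₑ / (y : EReal)) Filter.atTop

/-- The de Branges space `H(E)`, as a set of entire functions. -/
structure MemSpace (E f : ℂ → ℂ) : Prop where
  entire : Differentiable ℂ f
  integrable : MeasureTheory.Integrable (fun t : ℝ => ‖f t / E t‖ ^ 2)
  boundedType : BoundedType (fun z => f z / E z)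
  boundedType_star : BoundedType (fun z => star f z / E z)
  meanType_le : meanType (fun z => f z / E z) ≤ 0
  meanType_star_le : meanType (fun z => star f z / E z) ≤ 0

/-- The de Branges space `H(E)`. -/
def space (E : ℂ → ℂ) : Set (ℂ → ℂ) := {f | MemSpace E f}

/-- The squared norm `∫ |f / E|²` over the real line. -/
def normSq (E f : ℂ → ℂ) : ℝ := ∫ t : ℝ, ‖f t / E t‖ ^ 2

/-- The norm of `H(E)`. -/
def norm (E f : ℂ → ℂ) : ℝ := Real.sqrt (normSq E f)

/-- `H(E₁) = H(E₂)`: the two spaces coincide as sets and their norms are equivalent. -/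
def SameSpace (E₁ E₂ : ℂ → ℂ) : Prop :=
  space E₁ = space E₂ ∧
  ∃ c C : ℝ, 0 < c ∧ 0 < C ∧
    ∀ f ∈ space E₁, c * norm E₁ f ≤ norm E₂ f ∧ norm E₂ f ≤ C * norm E₁ f

/-- The numerator of the reproducing kernel, as a function of `z`. It vanishes at `z = conj w`. -/
def kernelNum (E : ℂ → ℂ) (w z : ℂ) : ℂ := conj (E w) * E z - E (conj w) * star E z

/-- The reproducing kernel of `H(E)`: the quotient
`(conj (E w) E z - E (conj w) E^* z) / (2 π i (conj w - z))`, extended continuously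
to `z = conj w`. -/
def kernel (E : ℂ → ℂ) (w z : ℂ) : ℂ :=
  if z = conj w then -deriv (kernelNum E w) z / (2 * Real.pi * Complex.I)
  else kernelNum E w z / (2 * Real.pi * Complex.I * (conj w - z))

/-- `φ` is a phase function of `E`. -/
structure IsPhase (E : ℂ → ℂ) (φ : ℝ → ℝ) : Prop where
  continuous : Continuous φ
  strictMono : StrictMono φ
  eq : ∀ x : ℝ, E x = ‖E x‖ * Complex.exp (-(Complex.I * φ x))

/-- The family `lam` of real points is a normalized sampling sequence for `H(E)`
with bounds `A` and `B`. For real `x` the number `kernel E x x` is real. -/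
def NormalizedSamplingWith (E : ℂ → ℂ) {ι : Type} (lam : ι → ℝ) (A B : ℝ) : Prop :=
  0 < A ∧ 0 < B ∧ ∀ f ∈ space E,
    Summable (fun n => ‖f (lam n)‖ ^ 2 / (kernel E (lam n) (lam n)).re) ∧
    A * norm E f ^ 2 ≤ ∑' n, ‖f (lam n)‖ ^ 2 / (kernel E (lam n) (lam n)).re ∧
    ∑' n, ‖f (lam n)‖ ^ 2 / (kernel E (lam n) (lam n)).re ≤ B * norm E f ^ 2

end

end DeBranges

/-!
Multiplication by `F` embeds `H(E)` isometrically into `H(E F)`, where the normalized reproducing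
kernels at the zeros `λ_n` of a companion function `S_α` of `E F` are orthonormal, with orthogonal
complement at most the line spanned by `S_α`. Bessel's inequality gives the upper sampling bound.
For the lower one, `S_α` lies in `H(E F)` for at most one `α` modulo `π`, and it is never of the
form `g F` with `g` in `H(E)`; as `H(E) F` is closed, it makes a positive angle with the exceptional
line, and this angle gives a bound independent of `α`. Finally
`K_{EF}(x, x) = |F x|² K_E(x, x) + |E x|² K_F(x, x)` and `φ_E' = π K_E / |E|²`, so `φ_F' ≤ C φ_E'`
makes `K_{EF}(x, x)` comparable to `|F x|² K_E(x, x)`, hence to `|F x|² K_{E₀}(x, x)`.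

The analytic input is the reproducing property: a function of bounded type and nonpositive mean type
whose boundary values are square integrable satisfies `|u w| ≤ ‖u‖₂ / √(π Im w)` in the upper
half-plane, which makes the Cauchy integral formula available there.
-/

namespace DeBranges

open scoped ComplexConjugate
open Complex MeasureTheory Filter Topology Set

/-! ### Cauchy's theorem in the upper half-plane -/

/-- The closed upper half-plane, as a subset of `ℂ`. -/
def closedUpper : Set ℂ := {z | 0 ≤ z.im}

theorem upper_subset_closedUpper : upper ⊆ closedUpper := fun _ hz => le_of_lt (a := (0 : ℝ)) hz

theorem isClosed_closedUpper : IsClosed closedUpper := isClosed_le continuous_const continuous_im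

theorem ofReal_mem_closedUpper (t : ℝ) : (t : ℂ) ∈ closedUpper := by simp [closedUpper]

/-- The rate of growth `(1 + |z|²) / im z`, which is twice the hyperbolic cosine of the distance
from `i` to `z`: by Harnack's inequality, every positive harmonic function on the upper half-plane
is at most a multiple of it. -/
noncomputable def harnackWeight (z : ℂ) : ℝ := (1 + ‖z‖ ^ 2) / z.im

/-- The growth bound `u = O(exp (K (1 + |z|²) / im z))` on the upper half-plane, which by Harnack's
inequality holds for some `K` if `u` is of bounded type. -/
def HarnackGrowth (K : ℝ) (u : ℂ → ℂ) : Prop :=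
  ∃ M, ∀ z ∈ upper, ‖u z‖ ≤ M * Real.exp (K * harnackWeight z)

theorem harnackWeight_nonneg {z : ℂ} (hz : z ∈ upper) : 0 ≤ harnackWeight z :=
  div_nonneg (by positivity) (le_of_lt hz)

theorem norm_le_harnackWeight {z : ℂ} (hz : z ∈ upper) : ‖z‖ ≤ harnackWeight z := by
  rw [harnackWeight, le_div_iff₀ hz]
  nlinarith [norm_nonneg z, (le_abs_self _).trans (abs_im_le_norm z)]

theorem one_le_harnackWeight {z : ℂ} (hz : z ∈ upper) : 1 ≤ harnackWeight z := by
  rw [harnackWeight, le_div_iff₀ hz]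
  nlinarith [sq_nonneg (‖z‖ - 1), (le_abs_self _).trans (abs_im_le_norm z)]

theorem one_le_exp_mul_harnackWeight {K : ℝ} (hK : 0 ≤ K) {z : ℂ} (hz : z ∈ upper) :
    1 ≤ Real.exp (K * harnackWeight z) :=
  Real.one_le_exp (mul_nonneg hK (harnackWeight_nonneg hz))

theorem HarnackGrowth.exists_nonneg {K : ℝ} {u : ℂ → ℂ} (hu : HarnackGrowth K u) :
    ∃ M, 0 ≤ M ∧ ∀ z ∈ upper, ‖u z‖ ≤ M * Real.exp (K * harnackWeight z) := by
  obtain ⟨M, hM⟩ := hu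
  have hI : I ∈ upper := by simp [upper]
  exact ⟨M, nonneg_of_mul_nonneg_left ((norm_nonneg _).trans (hM I hI)) (Real.exp_pos _), hM⟩

theorem integral_neg_self_eq_of_rect {f : ℂ → ℂ} {R : ℝ} (hR : 0 ≤ R)
    (hc : ContinuousOn f closedUpper) (hd : DifferentiableOn ℂ f upper) :
    ∫ t in -R..R, f t = (∫ x in -R..R, f (x + R * I)) -
      I * (∫ y in (0 : ℝ)..R, f (R + y * I)) + I * ∫ y in (0 : ℝ)..R, f ((-R : ℝ) + y * I) := by
  have him : (R + R * I : ℂ).im = R := by simp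
  have hcauchy := integral_boundary_rect_eq_zero_of_continuousOn_of_differentiableOn
    f (-R : ℝ) (R + R * I)
    (hc.mono fun z hz => by
      have hz := (mem_reProdIm.1 hz).2
      rw [ofReal_im, him, uIcc_of_le hR] at hz
      exact hz.1)
    (hd.mono fun z hz => by
      have hz := (mem_reProdIm.1 hz).2
      rw [ofReal_im, him, min_eq_left hR] at hz
      exact hz.1)
  simp only [ofReal_re, ofReal_im, add_re, mul_re, I_re, mul_zero, I_im, add_zero, add_im, mul_im,
    zero_add, mul_one, smul_eq_mul, ofReal_zero, zero_mul, sub_self] at hcauchy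
  linear_combination hcauchy

/-- The exponent of a function which is unimodular on the real line and so small on the rest of the
boundary of the rectangle `[-R, R] × [0, R]` that it compensates Harnack growth there. -/
noncomputable def dampingExponent (K R : ℝ) (z : ℂ) : ℂ :=
  2 * I * K * (1 + R ^ 2) * z / (R ^ 2 - z ^ 2)

theorem re_dampingExponent (K R : ℝ) (z : ℂ) :
    (dampingExponent K R z).re =
      -(2 * K * (1 + R ^ 2) * (z.im * (R ^ 2 + ‖z‖ ^ 2)) /
        Complex.normSq ((R : ℂ) ^ 2 - z ^ 2)) := by
  have h : dampingExponent K R z =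
      (2 * K * (1 + R ^ 2) / Complex.normSq ((R : ℂ) ^ 2 - z ^ 2) : ℝ) *
        (I * (z * conj ((R : ℂ) ^ 2 - z ^ 2))) := by
    rw [dampingExponent, div_eq_mul_inv, inv_def]
    push_cast
    ring
  rw [h, re_ofReal_mul, I_mul_re, ← Complex.normSq_eq_norm_sq, normSq_apply z]
  simp only [mul_im, map_sub, sub_re, sub_im, pow_two, mul_re, conj_re, conj_im, ofReal_re,
    ofReal_im]
  ring

theorem norm_exp_dampingExponent_le_one {K : ℝ} (hK : 0 ≤ K) (R : ℝ) {z : ℂ}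
    (hz : z ∈ closedUpper) : ‖exp (dampingExponent K R z)‖ ≤ 1 := by
  rw [norm_exp, re_dampingExponent, Real.exp_le_one_iff, neg_nonpos]
  have h₁ : 0 ≤ z.im := hz
  have h₂ := normSq_nonneg ((R : ℂ) ^ 2 - z ^ 2)
  positivity

theorem sq_sub_sq_ne_zero_of_mem_upper (R : ℝ) {z : ℂ} (hz : z ∈ upper) :
    (R : ℂ) ^ 2 - z ^ 2 ≠ 0 := by
  intro h
  rcases sq_eq_sq_iff_eq_or_eq_neg.1 (sub_eq_zero.1 h) with h | h <;>
  · have := congrArg im h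
    simp only [ofReal_im, neg_im] at this
    have : 0 < z.im := hz
    linarith

theorem norm_exp_dampingExponent_le_of_side {K R : ℝ} (hK : 0 ≤ K) {z : ℂ} (hz : z ∈ upper)
    (hre : |z.re| ≤ R) (him : z.im ≤ R) (hside : |z.re| = R ∨ z.im = R) :
    ‖exp (dampingExponent K R z)‖ ≤ Real.exp (-(K / 4 * harnackWeight z)) := by
  have hy : 0 < z.im := hz
  have hN : 0 < Complex.normSq ((R : ℂ) ^ 2 - z ^ 2) :=
    normSq_pos.2 (sq_sub_sq_ne_zero_of_mem_upper R hz)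
  have hnorm : ‖z‖ ^ 2 = z.re ^ 2 + z.im ^ 2 := by rw [Complex.sq_norm, normSq_apply]; ring
  have hx2 : z.re ^ 2 ≤ R ^ 2 := sq_le_sq.2 (hre.trans (le_abs_self R))
  have hy2 : z.im ^ 2 ≤ R ^ 2 := by gcongr
  have hdist : Complex.normSq ((R : ℂ) ^ 2 - z ^ 2) ≤ 4 * z.im ^ 2 * (R ^ 2 + ‖z‖ ^ 2) := by
    have : Complex.normSq ((R : ℂ) ^ 2 - z ^ 2) =
        (R ^ 2 - z.re ^ 2 + z.im ^ 2) ^ 2 + 4 * z.re ^ 2 * z.im ^ 2 := by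
      rw [normSq_apply]
      simp only [sub_re, sub_im, pow_two, mul_re, mul_im, ofReal_re, ofReal_im]
      ring
    rw [this, hnorm]
    rcases hside with h | h
    · rw [← h, sq_abs]
      nlinarith [sq_nonneg (z.re * z.im), sq_nonneg (z.im ^ 2)]
    · rw [h]
      nlinarith [sq_nonneg (z.re * R), sq_nonneg (R ^ 2), mul_le_mul hx2 hx2 (sq_nonneg z.re)
        (sq_nonneg R)]
  rw [norm_exp, re_dampingExponent, Real.exp_le_exp, neg_le_neg_iff, harnackWeight]
  calc K / 4 * ((1 + ‖z‖ ^ 2) / z.im)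
      ≤ K / 4 * ((2 * (1 + R ^ 2)) / z.im) := by gcongr; linarith
    _ = 2 * K * (1 + R ^ 2) * (1 / (4 * z.im)) := by field_simp
    _ ≤ 2 * K * (1 + R ^ 2) *
        (z.im * (R ^ 2 + ‖z‖ ^ 2) / Complex.normSq ((R : ℂ) ^ 2 - z ^ 2)) := by
        refine mul_le_mul_of_nonneg_left ?_ (by positivity)
        rw [div_le_div_iff₀ (by positivity) hN]
        linarith
    _ = _ := by ring

theorem tendsto_dampingExponent (K : ℝ) (z : ℂ) :
    Tendsto (fun R : ℝ => dampingExponent K R z) atTop (𝓝 (2 * I * K * z)) := by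
  have hinv : Tendsto (fun R : ℝ => ((R : ℂ) ^ 2)⁻¹) atTop (𝓝 0) := by
    simpa [Function.comp_def] using (continuous_ofReal.tendsto 0).comp
      (tendsto_inv_atTop_zero.comp (tendsto_pow_atTop (α := ℝ) two_ne_zero))
  have hlim : Tendsto (fun R : ℝ => 2 * I * K * z * (((R : ℂ) ^ 2)⁻¹ + 1) /
      (1 - z ^ 2 * ((R : ℂ) ^ 2)⁻¹)) atTop (𝓝 (2 * I * K * z * (0 + 1) / (1 - z ^ 2 * 0))) :=
    ((hinv.add_const 1).const_mul _).div ((hinv.const_mul (z ^ 2)).const_sub 1) (by simp)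
  simp only [zero_add, mul_one, mul_zero, sub_zero, div_one] at hlim
  refine hlim.congr' ?_
  filter_upwards [eventually_gt_atTop 0] with R hR
  have hR2 : (R : ℂ) ^ 2 ≠ 0 := pow_ne_zero 2 (ofReal_ne_zero.2 hR.ne')
  rw [dampingExponent, ← mul_div_mul_left _ ((R : ℂ) ^ 2 - z ^ 2) (inv_ne_zero hR2)]
  congr 1 <;> field_simp [hR.ne']

/-- `v` times the damping factor; the polynomial makes the product continuous at the poles `± R` of
the damping exponent. -/
noncomputable def damped (v : ℂ → ℂ) (K R : ℝ) (z : ℂ) : ℂ :=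
  v z * exp (dampingExponent K R z) * (1 - z ^ 2 / R ^ 2)

section Damped

variable {v : ℂ → ℂ} {K R : ℝ}

theorem norm_damped_le (hK : 0 ≤ K) {z : ℂ} (hz : z ∈ closedUpper) :
    ‖damped v K R z‖ ≤ ‖v z‖ * ‖1 - z ^ 2 / (R : ℂ) ^ 2‖ := by
  rw [damped, norm_mul, norm_mul]
  gcongr
  exact mul_le_of_le_one_right (norm_nonneg _) (norm_exp_dampingExponent_le_one hK R hz)

theorem differentiableOn_damped (hv : DifferentiableOn ℂ v upper) :
    DifferentiableOn ℂ (damped v K R) upper := by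
  intro z hz
  have hexp : DifferentiableAt ℂ (dampingExponent K R) z := by
    have := sq_sub_sq_ne_zero_of_mem_upper R hz
    unfold dampingExponent
    fun_prop (disch := assumption)
  exact ((hv z hz).mul hexp.cexp.differentiableWithinAt).mul (by fun_prop)

theorem continuousOn_damped (hK : 0 ≤ K) (hR : R ≠ 0) (hv : ContinuousOn v closedUpper) :
    ContinuousOn (damped v K R) closedUpper := by
  intro z hz
  by_cases hne : (R : ℂ) ^ 2 - z ^ 2 = 0
  · have hcut : 1 - z ^ 2 / (R : ℂ) ^ 2 = 0 := by
      rw [← sub_eq_zero.1 hne, div_self (pow_ne_zero 2 (ofReal_ne_zero.2 hR)), sub_self]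
    have hlim : Tendsto (fun w => ‖v w‖ * ‖1 - w ^ 2 / (R : ℂ) ^ 2‖) (𝓝[closedUpper] z) (𝓝 0) := by
      have hcont : ContinuousWithinAt (fun w => ‖v w‖ * ‖1 - w ^ 2 / (R : ℂ) ^ 2‖) closedUpper z :=
        (hv z hz).norm.mul (by fun_prop)
      simpa only [hcut, norm_zero, mul_zero] using hcont.tendsto
    rw [ContinuousWithinAt, show damped v K R z = 0 by rw [damped, hcut, mul_zero]]
    refine squeeze_zero_norm' ?_ hlim
    filter_upwards [self_mem_nhdsWithin] with w hw using norm_damped_le hK hw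
  · have hexp : ContinuousAt (dampingExponent K R) z := by
      unfold dampingExponent
      fun_prop (disch := assumption)
    exact ((hv z hz).mul hexp.cexp.continuousWithinAt).mul (by fun_prop)

theorem norm_damped_real_le {t : ℝ} (ht : |t| ≤ R) : ‖damped v K R t‖ ≤ ‖v t‖ := by
  have hunit : ‖exp (dampingExponent K R t)‖ = 1 := by
    rw [norm_exp, re_dampingExponent]
    simp
  have hcut : 1 - (t : ℂ) ^ 2 / (R : ℂ) ^ 2 = ((1 - t ^ 2 / R ^ 2 : ℝ) : ℂ) := by push_cast; ring
  have hle : t ^ 2 / R ^ 2 ≤ 1 := div_le_one_of_le₀ (sq_le_sq.2 (ht.trans (le_abs_self R)))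
    (sq_nonneg R)
  rw [damped, norm_mul, norm_mul, hunit, mul_one, hcut, norm_real,
    Real.norm_of_nonneg (by linarith)]
  refine mul_le_of_le_one_right (norm_nonneg _) ?_
  linarith [div_nonneg (sq_nonneg t) (sq_nonneg R)]

theorem norm_damped_le_of_side {K₀ M : ℝ} (hK : 0 ≤ K) (hKK : 4 * K₀ ≤ K) (hM : 0 ≤ M) {z : ℂ}
    (hz : z ∈ upper) (hv : ‖v z‖ ≤ M * Real.exp (K₀ * harnackWeight z))
    (hre : |z.re| ≤ R) (him : z.im ≤ R) (hside : |z.re| = R ∨ z.im = R) :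
    ‖damped v K R z‖ ≤ 3 * M * Real.exp (-((K / 4 - K₀) * R)) := by
  have hR : 0 < R := lt_of_lt_of_le hz him
  have hRz : R ≤ ‖z‖ := by
    rcases hside with h | h
    · exact h ▸ abs_re_le_norm z
    · exact h ▸ (le_abs_self _).trans (abs_im_le_norm z)
  have hcut : ‖1 - z ^ 2 / (R : ℂ) ^ 2‖ ≤ 3 := by
    have hz2 : ‖z‖ ^ 2 ≤ 2 * R ^ 2 := by
      have : ‖z‖ ^ 2 = z.re ^ 2 + z.im ^ 2 := by rw [Complex.sq_norm, normSq_apply]; ring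
      have := sq_le_sq.2 (hre.trans (le_abs_self R))
      have := pow_le_pow_left₀ (le_of_lt hz) him 2
      linarith
    refine (norm_sub_le _ _).trans ?_
    rw [norm_one, norm_div, norm_pow, norm_pow, norm_real, Real.norm_of_nonneg hR.le]
    have : ‖z‖ ^ 2 / R ^ 2 ≤ 2 := div_le_of_le_mul₀ (by positivity) zero_le_two hz2
    linarith
  have hdamp : ‖v z‖ * ‖exp (dampingExponent K R z)‖ ≤ M * Real.exp (-((K / 4 - K₀) * R)) := by
    calc _ ≤ M * Real.exp (K₀ * harnackWeight z) * Real.exp (-(K / 4 * harnackWeight z)) := by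
          gcongr
          exact norm_exp_dampingExponent_le_of_side hK hz hre him hside
      _ = M * Real.exp (-((K / 4 - K₀) * harnackWeight z)) := by
          rw [mul_assoc, ← Real.exp_add]; ring_nf
      _ ≤ _ := by
          gcongr
          · linarith
          · exact hRz.trans (norm_le_harnackWeight hz)
  rw [damped, norm_mul, norm_mul]
  calc _ ≤ M * Real.exp (-((K / 4 - K₀) * R)) * 3 := by gcongr
    _ = _ := by ring

theorem norm_integral_damped_le {K₀ M : ℝ} (hR : 0 < R) (hK : 0 ≤ K) (hKK : 4 * K₀ ≤ K)
    (hM : 0 ≤ M) (hvc : ContinuousOn v closedUpper) (hvd : DifferentiableOn ℂ v upper)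
    (hv : ∀ z ∈ upper, ‖v z‖ ≤ M * Real.exp (K₀ * harnackWeight z)) :
    ‖∫ t in -R..R, damped v K R t‖ ≤ 12 * M * (R * Real.exp (-((K / 4 - K₀) * R))) := by
  set C := 3 * M * Real.exp (-((K / 4 - K₀) * R)) with hC
  have hside : ∀ z ∈ upper, |z.re| ≤ R → z.im ≤ R → |z.re| = R ∨ z.im = R →
      ‖damped v K R z‖ ≤ C := fun z hz =>
    norm_damped_le_of_side hK hKK hM hz (hv z hz)
  have htop : ‖∫ x in -R..R, damped v K R (x + R * I)‖ ≤ C * |R - -R| := by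
    refine intervalIntegral.norm_integral_le_of_norm_le_const fun x hx => ?_
    rw [uIoc_of_le (by linarith)] at hx
    refine hside _ ?_ ?_ ?_ ?_ <;> simp [upper, hR, abs_le, hx.1.le, hx.2]
  have hvert : ∀ a : ℝ, |a| = R → ‖∫ y in (0 : ℝ)..R, damped v K R (a + y * I)‖ ≤ C * |R - 0| := by
    refine fun a ha => intervalIntegral.norm_integral_le_of_norm_le_const fun y hy => ?_
    rw [uIoc_of_le hR.le] at hy
    refine hside _ ?_ ?_ ?_ ?_ <;> simp [upper, ha, hy.1, hy.2]
  have hright := hvert R (abs_of_pos hR)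
  have hleft := hvert (-R) (by rw [abs_neg, abs_of_pos hR])
  rw [sub_neg_eq_add, abs_of_pos (by linarith)] at htop
  rw [sub_zero, abs_of_pos hR] at hright hleft
  rw [integral_neg_self_eq_of_rect hR.le (continuousOn_damped hK hR.ne' hvc)
    (differentiableOn_damped hvd)]
  refine (norm_add_le _ _).trans ((add_le_add_left (norm_sub_le _ _) _).trans ?_)
  rw [norm_mul, norm_mul, norm_I, one_mul, one_mul]
  calc _ ≤ C * (R + R) + C * R + C * R := by gcongr
    _ = _ := by rw [hC]; ring

theorem tendsto_integral_damped (hK : 0 ≤ K) (hvc : ContinuousOn v closedUpper)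
    (hvi : Integrable fun t : ℝ => v t) :
    Tendsto (fun R : ℝ => ∫ t in -R..R, damped v K R t) atTop
      (𝓝 (∫ t : ℝ, v t * exp (2 * I * K * t))) := by
  have hlim : ∀ t : ℝ, Tendsto (fun R : ℝ => damped v K R t) atTop
      (𝓝 (v t * exp (2 * I * K * t))) := by
    intro t
    have hcut : Tendsto (fun R : ℝ => 1 - (t : ℂ) ^ 2 / (R : ℂ) ^ 2) atTop (𝓝 1) := by
      have : Tendsto (fun R : ℝ => 1 - t ^ 2 / R ^ 2) atTop (𝓝 (1 - 0)) :=
        (Tendsto.const_div_atTop (tendsto_pow_atTop two_ne_zero) _).const_sub 1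
      simpa [Function.comp_def] using (continuous_ofReal.tendsto _).comp this
    simpa only [mul_one, damped] using!
      (((continuous_exp.tendsto _).comp (tendsto_dampingExponent K t)).const_mul (v t)).mul hcut
  have hdom : Tendsto (fun R : ℝ => ∫ t : ℝ, (Ioc (-R) R).indicator (fun t : ℝ => damped v K R t) t)
      atTop (𝓝 (∫ t : ℝ, v t * exp (2 * I * K * t))) := by
    refine tendsto_integral_filter_of_dominated_convergence (fun t => ‖v t‖) ?_ ?_ hvi.norm ?_
    · filter_upwards [eventually_gt_atTop 0] with R hR
      refine AEStronglyMeasurable.indicator ?_ measurableSet_Ioc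
      exact ((continuousOn_damped hK hR.ne' hvc).comp_continuous continuous_ofReal
        ofReal_mem_closedUpper).aestronglyMeasurable
    · refine Eventually.of_forall fun R => Eventually.of_forall fun t => ?_
      by_cases ht : t ∈ Ioc (-R) R
      · rw [indicator_of_mem ht]
        exact norm_damped_real_le (abs_le.2 ⟨ht.1.le, ht.2⟩)
      · rw [indicator_of_notMem ht, norm_zero]
        exact norm_nonneg _
    · refine Eventually.of_forall fun t => (hlim t).congr' ?_
      filter_upwards [eventually_gt_atTop |t|] with R hR
      rw [indicator_of_mem (mem_Ioc.2 ⟨(abs_lt.1 hR).1, (abs_lt.1 hR).2.le⟩)]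
  refine hdom.congr' ?_
  filter_upwards [eventually_gt_atTop 0] with R hR
  rw [integral_indicator measurableSet_Ioc, intervalIntegral.integral_of_le (by linarith)]

end Damped

section Cauchy

variable {v : ℂ → ℂ} (hvc : ContinuousOn v closedUpper) (hvd : DifferentiableOn ℂ v upper)
  (hvi : Integrable fun t : ℝ => v t)

include hvc hvd hvi

theorem integral_mul_exp_eq_zero {K K' : ℝ} (hv : HarnackGrowth K v) (hK' : 0 ≤ K')
    (hKK : 4 * K < K') : ∫ t : ℝ, v t * exp (2 * I * K' * t) = 0 := by
  obtain ⟨M, hM, hv⟩ := hv.exists_nonneg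
  have hc : 0 < K' / 4 - K := by linarith
  refine tendsto_nhds_unique (tendsto_integral_damped hK' hvc hvi) ?_
  have hdecay : Tendsto (fun R : ℝ => 12 * M * (R * Real.exp (-((K' / 4 - K) * R)))) atTop
      (𝓝 0) := by
    have := ((Real.tendsto_pow_mul_exp_neg_atTop_nhds_zero 1).comp
      (tendsto_id.const_mul_atTop hc)).const_mul (12 * M * (K' / 4 - K)⁻¹)
    rw [mul_zero] at this
    refine this.congr fun R => ?_
    simp only [Function.comp_apply, id, pow_one]
    generalize K' / 4 - K = c at hc
    field_simp
  refine squeeze_zero_norm' ?_ hdecay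
  filter_upwards [eventually_gt_atTop 0] with R hR
  exact norm_integral_damped_le hR hK' hKK.le hM hvc hvd hv

theorem integral_eq_zero_of_forall_harnackGrowth (hv : ∀ K > 0, HarnackGrowth K v) :
    ∫ t : ℝ, v t = 0 := by
  have hdamped : ∀ K : ℝ, 0 < K → ∫ t : ℝ, v t * exp (2 * I * K * t) = 0 := fun K hK =>
    integral_mul_exp_eq_zero hvc hvd hvi (hv (K / 8) (by linarith)) hK.le (by linarith)
  have hlim : Tendsto (fun K : ℝ => ∫ t : ℝ, v t * exp (2 * I * K * t)) (𝓝[>] 0)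
      (𝓝 (∫ t : ℝ, v t)) := by
    refine tendsto_integral_filter_of_dominated_convergence (fun t => ‖v t‖) ?_ ?_ hvi.norm ?_
    · exact Eventually.of_forall fun K => hvi.aestronglyMeasurable.mul
        (Continuous.aestronglyMeasurable (by fun_prop))
    · refine Eventually.of_forall fun K => Eventually.of_forall fun t => ?_
      rw [norm_mul, norm_exp]
      simp
    · refine Eventually.of_forall fun t => Tendsto.mono_left ?_ nhdsWithin_le_nhds
      have : Continuous fun K : ℝ => v t * exp (2 * I * K * t) := by fun_prop
      simpa using this.tendsto 0
  refine tendsto_nhds_unique hlim (tendsto_const_nhds.congr' ?_)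
  filter_upwards [self_mem_nhdsWithin] with K hK using (hdamped K hK).symm

end Cauchy

theorem harnackGrowth_of_norm_le {K C : ℝ} {u : ℂ → ℂ} (hK : 0 ≤ K)
    (hu : ∀ z ∈ upper, ‖u z‖ ≤ C) : HarnackGrowth K u :=
  ⟨|C|, fun z hz => ((hu z hz).trans (le_abs_self C)).trans
    (le_mul_of_one_le_right (abs_nonneg C) (one_le_exp_mul_harnackWeight hK hz))⟩

theorem HarnackGrowth.sub {K : ℝ} {u v : ℂ → ℂ} (hu : HarnackGrowth K u) (hv : HarnackGrowth K v) :
    HarnackGrowth K (fun z => u z - v z) := by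
  obtain ⟨M, hM⟩ := hu
  obtain ⟨N, hN⟩ := hv
  refine ⟨M + N, fun z hz => (norm_sub_le _ _).trans ?_⟩
  rw [add_mul]
  exact add_le_add (hM z hz) (hN z hz)

theorem HarnackGrowth.of_norm_le_add {K C D : ℝ} {u v : ℂ → ℂ} (hK : 0 ≤ K) (hD : 0 ≤ D)
    (hu : HarnackGrowth K u) (hv : ∀ z ∈ upper, ‖v z‖ ≤ C + D * ‖u z‖) : HarnackGrowth K v := by
  obtain ⟨M, hM⟩ := hu
  refine ⟨|C| + D * M, fun z hz => (hv z hz).trans ?_⟩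
  rw [add_mul, mul_assoc]
  gcongr
  · exact (le_abs_self C).trans
      (le_mul_of_one_le_right (abs_nonneg C) (one_le_exp_mul_harnackWeight hK hz))
  · exact hM z hz

section Dslope

variable {u : ℂ → ℂ} {w : ℂ}

theorem differentiableAt_dslope {z : ℂ} (hw : AnalyticAt ℂ u w) (hz : AnalyticAt ℂ u z) :
    DifferentiableAt ℂ (dslope u w) z := by
  rcases eq_or_ne z w with rfl | hne
  · obtain ⟨s, hs, hd⟩ := hw.exists_mem_nhds_analyticOnNhd
    exact ((differentiableOn_dslope hs).2 hd.differentiableOn).differentiableAt hs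
  · exact (differentiableAt_dslope_of_ne hne).2 hz.differentiableAt

theorem exists_norm_dslope_le (hu : AnalyticOnNhd ℂ u closedUpper) (hw : w ∈ closedUpper) :
    ∃ B, ∀ z ∈ closedUpper, ‖dslope u w z‖ ≤ B + ‖u z - u w‖ := by
  obtain ⟨B, hB⟩ := ((isCompact_closedBall w 1).inter_right
    isClosed_closedUpper).exists_bound_of_continuousOn (f := dslope u w) fun z hz =>
      (differentiableAt_dslope (hu w hw) (hu z hz.2)).continuousAt.continuousWithinAt
  have hB0 : 0 ≤ B := (norm_nonneg _).trans (hB w ⟨by simp, hw⟩)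
  refine ⟨B, fun z hz => ?_⟩
  by_cases hzw : z ∈ Metric.closedBall w 1
  · exact (hB z ⟨hzw, hz⟩).trans (le_add_of_nonneg_right (norm_nonneg _))
  · rw [Metric.mem_closedBall, not_le, dist_eq] at hzw
    refine le_trans ?_ (le_add_of_nonneg_left hB0)
    rw [← sub_smul_dslope, norm_smul]
    exact le_mul_of_one_le_left (norm_nonneg _) hzw.le

theorem HarnackGrowth.dslope {K : ℝ} (hK : 0 ≤ K) (hu : AnalyticOnNhd ℂ u closedUpper)
    (hw : w ∈ closedUpper) (h : HarnackGrowth K u) : HarnackGrowth K (dslope u w) := by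
  obtain ⟨B, hB⟩ := exists_norm_dslope_le hu hw
  refine (h.sub (harnackGrowth_of_norm_le hK fun _ _ => le_rfl (a := ‖u w‖))).of_norm_le_add hK
    zero_le_one (C := B) fun z hz => ?_
  rw [one_mul]
  exact hB z (upper_subset_closedUpper hz)

end Dslope

/-! ### The Poisson formula -/

/-- The Poisson kernel of the upper half-plane. -/
noncomputable def poissonUpper (w : ℂ) (t : ℝ) : ℝ := w.im / (Real.pi * Complex.normSq (t - w))

section PoissonKernel

variable {w : ℂ} (hw : w ∈ upper)

include hw

theorem poissonUpper_eq_cauchyPDFReal :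
    poissonUpper w = ProbabilityTheory.cauchyPDFReal w.re w.im.toNNReal := by
  have hw : 0 < w.im := hw
  ext t
  have : Complex.normSq (t - w) = (t - w.re) ^ 2 + w.im ^ 2 := by
    rw [normSq_apply]
    simp only [sub_re, ofReal_re, sub_im, ofReal_im]
    ring
  rw [poissonUpper, ProbabilityTheory.cauchyPDFReal_def, Real.coe_toNNReal _ hw.le, this,
    div_eq_mul_inv, mul_inv]
  ring

theorem poissonUpper_nonneg (t : ℝ) : 0 ≤ poissonUpper w t :=
  div_nonneg (le_of_lt hw) (mul_nonneg Real.pi_pos.le (normSq_nonneg _))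

theorem poissonUpper_le (t : ℝ) : poissonUpper w t ≤ 1 / (Real.pi * w.im) := by
  have hw : 0 < w.im := hw
  have hsq : w.im ^ 2 ≤ Complex.normSq (t - w) := by
    rw [normSq_apply]
    simp only [sub_re, ofReal_re, sub_im, ofReal_im]
    nlinarith [sq_nonneg (t - w.re)]
  have hpos : 0 < Complex.normSq (t - w) := (pow_pos hw 2).trans_le hsq
  rw [poissonUpper, div_le_div_iff₀ (by positivity) (by positivity)]
  nlinarith [Real.pi_pos]

theorem integrable_poissonUpper : Integrable (poissonUpper w) := by
  rw [poissonUpper_eq_cauchyPDFReal hw]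
  exact ProbabilityTheory.integrable_cauchyPDFReal _

theorem integrable_ofReal_poissonUpper : Integrable (fun t => (poissonUpper w t : ℂ)) :=
  (integrable_poissonUpper hw).ofReal

theorem integral_poissonUpper : ∫ t, poissonUpper w t = 1 := by
  rw [poissonUpper_eq_cauchyPDFReal hw]
  exact ProbabilityTheory.integral_cauchyPDFReal_eq_one _ (Real.toNNReal_pos.2 hw).ne'

theorem sq_poissonUpper_le (t : ℝ) :
    poissonUpper w t ^ 2 ≤ 1 / (Real.pi * w.im) * poissonUpper w t := by
  rw [pow_two]
  exact mul_le_mul_of_nonneg_right (poissonUpper_le hw t) (poissonUpper_nonneg hw t)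

theorem memLp_poissonUpper : MemLp (poissonUpper w) 2 := by
  have hmeas := (integrable_poissonUpper hw).aestronglyMeasurable
  rw [memLp_two_iff_integrable_sq hmeas]
  refine ((integrable_poissonUpper hw).const_mul (1 / (Real.pi * w.im))).mono' (hmeas.pow 2)
    (Eventually.of_forall fun t => ?_)
  rw [Real.norm_of_nonneg (sq_nonneg _)]
  exact sq_poissonUpper_le hw t

theorem integral_sq_poissonUpper_le : ∫ t, poissonUpper w t ^ 2 ≤ 1 / (Real.pi * w.im) := by
  calc _ ≤ ∫ t, 1 / (Real.pi * w.im) * poissonUpper w t :=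
        integral_mono (memLp_poissonUpper hw).integrable_sq
          ((integrable_poissonUpper hw).const_mul _) (sq_poissonUpper_le hw)
    _ = _ := by rw [integral_const_mul, integral_poissonUpper hw, mul_one]

theorem integral_norm_mul_poissonUpper_le {g : ℝ → ℂ} (hg : MemLp g 2) :
    ∫ t : ℝ, ‖g t‖ * poissonUpper w t ≤ √(∫ t : ℝ, ‖g t‖ ^ 2) / √(Real.pi * w.im) := by
  have hholder := integral_mul_le_Lp_mul_Lq_of_nonneg (μ := volume) Real.HolderConjugate.two_two
    (f := fun t => ‖g t‖) (Eventually.of_forall fun t => norm_nonneg _)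
    (Eventually.of_forall (poissonUpper_nonneg hw)) (by simpa using hg.norm)
    (by simpa using memLp_poissonUpper hw)
  simp only [Real.rpow_two, ← Real.sqrt_eq_rpow] at hholder
  refine hholder.trans ?_
  rw [div_eq_mul_one_div, ← Real.sqrt_one, ← Real.sqrt_div zero_le_one]
  gcongr
  exact integral_sq_poissonUpper_le hw

theorem norm_integral_mul_poissonUpper_le {g : ℝ → ℂ} (hg : MemLp g 2) :
    ‖∫ t : ℝ, g t * poissonUpper w t‖ ≤ √(∫ t : ℝ, ‖g t‖ ^ 2) / √(Real.pi * w.im) := by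
  refine (norm_integral_le_integral_norm _).trans
    (le_trans (le_of_eq ?_) (integral_norm_mul_poissonUpper_le hw hg))
  congr 1 with t
  rw [norm_mul, norm_real, Real.norm_of_nonneg (poissonUpper_nonneg hw t)]

theorem integrable_mul_poissonUpper {g : ℝ → ℂ} (hg : MemLp g 2) :
    Integrable (fun t : ℝ => g t * poissonUpper w t) :=
  hg.integrable_mul (memLp_poissonUpper hw).ofReal

end PoissonKernel

/-- The analytic function whose boundary values are `u t - u w` times the Poisson kernel, so that
Cauchy's theorem for it is the Poisson formula for `u`. -/
noncomputable def poissonQuotient (u : ℂ → ℂ) (w z : ℂ) : ℂ :=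
  (w.im / Real.pi : ℝ) * (dslope u w z / (z - conj w))

theorem im_le_norm_sub_conj (w : ℂ) {z : ℂ} (hz : z ∈ closedUpper) : w.im ≤ ‖z - conj w‖ := by
  have hz : 0 ≤ z.im := hz
  refine le_trans ?_ ((le_abs_self _).trans (abs_im_le_norm _))
  simpa using hz

section Poisson

variable {u : ℂ → ℂ} {w : ℂ}

theorem poissonQuotient_ofReal (hw : w ∈ upper) (t : ℝ) :
    poissonQuotient u w t = u t * poissonUpper w t - u w * poissonUpper w t := by
  have hne : (t : ℂ) ≠ w := by
    rintro rfl
    simp [upper] at hw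
  have h1 : (t : ℂ) - w ≠ 0 := sub_ne_zero.2 hne
  have h2 : (t : ℂ) - conj w ≠ 0 := fun h => h1 (by simpa using congrArg conj h)
  have hn : (Complex.normSq ((t : ℂ) - w) : ℂ) = (t - w) * (t - conj w) := by
    rw [normSq_eq_conj_mul_self]
    simp [mul_comm]
  have hpi : (Real.pi : ℂ) ≠ 0 := by exact_mod_cast Real.pi_ne_zero
  rw [poissonQuotient, dslope_of_ne _ hne, slope_def_field, poissonUpper]
  push_cast
  rw [hn]
  field_simp

theorem differentiableAt_poissonQuotient (hu : AnalyticOnNhd ℂ u closedUpper) (hw : w ∈ upper)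
    {z : ℂ} (hz : z ∈ closedUpper) : DifferentiableAt ℂ (poissonQuotient u w) z := by
  have hne : z - conj w ≠ 0 :=
    norm_pos_iff.1 (lt_of_lt_of_le (b := w.im) hw (im_le_norm_sub_conj w hz))
  have := differentiableAt_dslope (hu w (upper_subset_closedUpper hw)) (hu z hz)
  exact (this.div (by fun_prop) hne).const_mul _

theorem HarnackGrowth.poissonQuotient {K : ℝ} (hK : 0 ≤ K) (hu : AnalyticOnNhd ℂ u closedUpper)
    (hw : w ∈ upper) (h : HarnackGrowth K u) : HarnackGrowth K (poissonQuotient u w) := by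
  have hw' : 0 < w.im := hw
  refine (h.dslope hK hu (upper_subset_closedUpper hw)).of_norm_le_add hK (C := 0)
    (D := w.im / Real.pi / w.im) (by positivity) fun z hz => ?_
  rw [DeBranges.poissonQuotient, norm_mul, norm_div, norm_real,
    Real.norm_of_nonneg (div_nonneg hw'.le Real.pi_pos.le), zero_add,
    div_mul_eq_mul_div (w.im / Real.pi) w.im, ← mul_div_assoc]
  exact div_le_div_of_nonneg_left (by positivity) hw'
    (im_le_norm_sub_conj w (upper_subset_closedUpper hz))

theorem integrable_poissonQuotient (hw : w ∈ upper)
    (hi : Integrable (fun t : ℝ => u t * poissonUpper w t)) :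
    Integrable (fun t : ℝ => poissonQuotient u w t) := by
  simp only [poissonQuotient_ofReal hw]
  exact hi.sub ((integrable_ofReal_poissonUpper hw).const_mul _)

theorem integral_mul_poissonUpper (hu : AnalyticOnNhd ℂ u closedUpper) (hw : w ∈ upper)
    (hb : ∀ K > 0, HarnackGrowth K u) (hi : Integrable (fun t : ℝ => u t * poissonUpper w t)) :
    ∫ t : ℝ, u t * poissonUpper w t = u w := by
  have hquot : DifferentiableOn ℂ (poissonQuotient u w) closedUpper := fun z hz =>
    (differentiableAt_poissonQuotient hu hw hz).differentiableWithinAt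
  have h := integral_eq_zero_of_forall_harnackGrowth hquot.continuousOn
    (hquot.mono upper_subset_closedUpper) (integrable_poissonQuotient hw hi)
    fun K hK => (hb K hK).poissonQuotient hK.le hu hw
  simp only [poissonQuotient_ofReal hw] at h
  rwa [integral_sub hi ((integrable_ofReal_poissonUpper hw).const_mul (u w)), integral_const_mul,
    integral_complex_ofReal, integral_poissonUpper hw, ofReal_one, mul_one, sub_eq_zero] at h

theorem norm_exp_two_I_mul (K : ℝ) (z : ℂ) :
    ‖exp (2 * I * K * z)‖ = Real.exp (-(2 * K * z.im)) := by
  rw [norm_exp]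
  congr 1
  simp

theorem norm_exp_two_I_mul_ofReal (K t : ℝ) : ‖exp (2 * I * K * t)‖ = 1 := by
  simp [norm_exp_two_I_mul]

theorem integrable_mul_exp {g : ℝ → ℂ} (hg : Integrable g) (K : ℝ) :
    Integrable (fun t : ℝ => g t * exp (2 * I * K * t)) :=
  hg.mul_bdd (c := 1) (Continuous.aestronglyMeasurable (by fun_prop))
    (Eventually.of_forall fun t => (norm_exp_two_I_mul_ofReal K t).le)

theorem integral_poissonUpper_mul_exp {K : ℝ} (hK : 0 ≤ K) (hw : w ∈ upper) :
    ∫ t : ℝ, poissonUpper w t * exp (2 * I * K * t) = exp (2 * I * K * w) := by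
  simp only [mul_comm (poissonUpper w _ : ℂ)]
  refine integral_mul_poissonUpper (u := fun z => exp (2 * I * K * z)) (fun z _ => by fun_prop) hw
    (fun k hk => harnackGrowth_of_norm_le (C := 1) hk.le fun z hz => ?_) ?_
  · rw [norm_exp_two_I_mul, Real.exp_le_one_iff, neg_nonpos]
    exact mul_nonneg (by positivity) (le_of_lt hz)
  · exact (integrable_mul_exp (integrable_ofReal_poissonUpper hw) K).congr
      (Eventually.of_forall fun t => mul_comm _ _)

theorem integral_mul_poissonUpper_mul_exp (hu : AnalyticOnNhd ℂ u closedUpper) (hw : w ∈ upper)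
    {K K' : ℝ} (hK : 0 ≤ K) (hKK : 4 * K < K') (hb : HarnackGrowth K u)
    (hi : Integrable (fun t : ℝ => u t * poissonUpper w t)) :
    ∫ t : ℝ, u t * poissonUpper w t * exp (2 * I * K' * t) = u w * exp (2 * I * K' * w) := by
  have hK' : 0 ≤ K' := by linarith
  have hquot : DifferentiableOn ℂ (poissonQuotient u w) closedUpper := fun z hz =>
    (differentiableAt_poissonQuotient hu hw hz).differentiableWithinAt
  have h := integral_mul_exp_eq_zero hquot.continuousOn (hquot.mono upper_subset_closedUpper)
    (integrable_poissonQuotient hw hi) (hb.poissonQuotient hK hu hw) hK' hKK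
  simp only [poissonQuotient_ofReal hw, sub_mul] at h
  rw [integral_sub (integrable_mul_exp hi K')
    (integrable_mul_exp ((integrable_ofReal_poissonUpper hw).const_mul (u w)) K')] at h
  simp only [mul_assoc (u w)] at h
  rwa [integral_const_mul, integral_poissonUpper_mul_exp hK' hw, sub_eq_zero] at h

theorem norm_le_exp_mul_of_harnackGrowth (hu : AnalyticOnNhd ℂ u closedUpper) (hw : w ∈ upper)
    {K K' : ℝ} (hK : 0 ≤ K) (hKK : 4 * K < K') (hb : HarnackGrowth K u)
    (h2 : MemLp (fun t : ℝ => u t) 2) :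
    ‖u w‖ ≤ √(∫ t : ℝ, ‖u t‖ ^ 2) / √(Real.pi * w.im) * Real.exp (2 * K' * w.im) := by
  have hexp : ‖u w * exp (2 * I * K' * w)‖ ≤ √(∫ t : ℝ, ‖u t‖ ^ 2) / √(Real.pi * w.im) := by
    rw [← integral_mul_poissonUpper_mul_exp hu hw hK hKK hb (integrable_mul_poissonUpper hw h2)]
    refine (norm_integral_le_integral_norm _).trans
      (le_trans (le_of_eq ?_) (integral_norm_mul_poissonUpper_le hw h2))
    congr 1 with t
    rw [norm_mul, norm_mul, norm_real, Real.norm_of_nonneg (poissonUpper_nonneg hw t),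
      norm_exp_two_I_mul_ofReal, mul_one]
  rwa [norm_mul, norm_exp_two_I_mul, Real.exp_neg, ← div_eq_mul_inv,
    div_le_iff₀ (Real.exp_pos _)] at hexp

theorem norm_le_of_forall_harnackGrowth (hu : AnalyticOnNhd ℂ u closedUpper) (hw : w ∈ upper)
    (hb : ∀ K > 0, HarnackGrowth K u) (h2 : MemLp (fun t : ℝ => u t) 2) :
    ‖u w‖ ≤ √(∫ t : ℝ, ‖u t‖ ^ 2) / √(Real.pi * w.im) := by
  rw [← integral_mul_poissonUpper hu hw hb (integrable_mul_poissonUpper hw h2)]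
  exact norm_integral_mul_poissonUpper_le hw h2

end Poisson

/-! ### Quotients of bounded analytic functions -/

section Disc

theorem exists_entire_add_conj_of_mem_span_fourier {g : C(AddCircle (2 * Real.pi), ℂ)}
    (hg : g ∈ Submodule.span ℂ (range (fourier (T := 2 * Real.pi)))) :
    ∃ A B : ℂ → ℂ, Differentiable ℂ A ∧ Differentiable ℂ B ∧
      ∀ x, g x = A (AddCircle.toCircle x) + conj (B (AddCircle.toCircle x)) := by
  induction hg using Submodule.span_induction with
  | mem g hg =>
    obtain ⟨n, rfl⟩ := hg
    obtain ⟨m, rfl | rfl⟩ := n.eq_nat_or_neg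
    · exact ⟨fun z => z ^ m, fun _ => 0, by fun_prop, by fun_prop, fun x => by
        simp [fourier_apply, AddCircle.toCircle_nsmul]⟩
    · exact ⟨fun _ => 0, fun z => z ^ m, by fun_prop, by fun_prop, fun x => by
        rw [fourier_neg]
        simp [fourier_apply, AddCircle.toCircle_nsmul]⟩
  | zero => exact ⟨fun _ => 0, fun _ => 0, by fun_prop, by fun_prop, fun x => by simp⟩
  | add g₁ g₂ _ _ h₁ h₂ =>
    obtain ⟨A₁, B₁, hA₁, hB₁, h₁⟩ := h₁
    obtain ⟨A₂, B₂, hA₂, hB₂, h₂⟩ := h₂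
    refine ⟨A₁ + A₂, B₁ + B₂, hA₁.add hA₂, hB₁.add hB₂, fun x => ?_⟩
    simp only [ContinuousMap.add_apply, h₁, h₂, Pi.add_apply, map_add]
    ring
  | smul c g _ h =>
    obtain ⟨A, B, hA, hB, h⟩ := h
    refine ⟨fun z => c * A z, fun z => conj c * B z, hA.const_mul c, hB.const_mul _, fun x => ?_⟩
    simp only [ContinuousMap.smul_apply, h, smul_eq_mul, map_mul, conj_conj]
    ring

theorem exists_toCircle_eq {z : ℂ} (hz : ‖z‖ = 1) :
    ∃ x : AddCircle (2 * Real.pi), (AddCircle.toCircle x : ℂ) = z := by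
  refine ⟨(z.arg : ℝ), ?_⟩
  rw [AddCircle.toCircle_apply_mk, div_self Real.two_pi_pos.ne', one_mul, Circle.coe_exp]
  simpa [hz] using norm_mul_exp_arg_mul_I z

theorem exists_entire_re_approx {p : ℂ → ℝ} (hp : ContinuousOn p (Metric.sphere 0 1)) {ε : ℝ}
    (hε : 0 < ε) :
    ∃ P : ℂ → ℂ, Differentiable ℂ P ∧ ∀ z ∈ Metric.sphere (0 : ℂ) 1, |p z - (P z).re| ≤ ε := by
  have : Fact (0 < 2 * Real.pi) := ⟨Real.two_pi_pos⟩
  let q : C(AddCircle (2 * Real.pi), ℂ) := ⟨fun x => (p (AddCircle.toCircle x : ℂ) : ℂ),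
    continuous_ofReal.comp (hp.comp_continuous
      (continuous_subtype_val.comp AddCircle.continuous_toCircle) fun x =>
        mem_sphere_zero_iff_norm.2 (Circle.norm_coe _))⟩
  have hq : q ∈ (Submodule.span ℂ (range (@fourier (2 * Real.pi)))).topologicalClosure := by
    rw [span_fourier_closure_eq_top]
    trivial
  obtain ⟨g, hg, hgq⟩ := Metric.mem_closure_iff.1 hq ε hε
  obtain ⟨A, B, hA, hB, hAB⟩ := exists_entire_add_conj_of_mem_span_fourier hg
  refine ⟨A + B, hA.add hB, fun z hz => ?_⟩
  obtain ⟨x, rfl⟩ := exists_toCircle_eq (mem_sphere_zero_iff_norm.1 hz)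
  calc |p (AddCircle.toCircle x) - ((A + B) (AddCircle.toCircle x)).re| = |(q x - g x).re| := by
        simp [q, hAB]
    _ ≤ dist (q x) (g x) := by
        rw [dist_eq]
        exact abs_re_le_norm _
    _ ≤ ε := ((ContinuousMap.dist_apply_le_dist x).trans_lt hgq).le

theorem norm_le_of_forall_sphere_norm_le {V : ℂ → ℂ} {C : ℝ}
    (hV : ∀ z ∈ Metric.closedBall (0 : ℂ) 1, DifferentiableAt ℂ V z)
    (hC : ∀ z ∈ Metric.sphere (0 : ℂ) 1, ‖V z‖ ≤ C) {z : ℂ} (hz : z ∈ Metric.closedBall (0 : ℂ) 1) :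
    ‖V z‖ ≤ C := by
  rw [← closure_ball (0 : ℂ) one_ne_zero] at hV hz
  rw [← frontier_ball (0 : ℂ) one_ne_zero] at hC
  exact norm_le_of_forall_mem_frontier_norm_le Metric.isBounded_ball
    (DifferentiableOn.diffContOnCl fun w hw => (hV w hw).differentiableWithinAt) hC hz

variable {U H : ℂ → ℂ}

-- `Re P` approximates `log⁺ ‖U‖` on the circle, so it plays the role of the harmonic majorant.
theorem exists_entire_log_majorant
    (hU : ∀ z ∈ Metric.closedBall (0 : ℂ) 1, DifferentiableAt ℂ U z)
    (hH : ∀ z ∈ Metric.closedBall (0 : ℂ) 1, DifferentiableAt ℂ H z)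
    (hH1 : ∀ z ∈ Metric.sphere (0 : ℂ) 1, ‖H z‖ ≤ 1)
    (hUH : ∀ z ∈ Metric.sphere (0 : ℂ) 1, ‖U z * H z‖ ≤ 1) :
    ∃ P : ℂ → ℂ, Differentiable ℂ P ∧ ∀ z ∈ Metric.closedBall (0 : ℂ) 1,
      -1 ≤ (P z).re ∧ ‖U z * exp (-P z)‖ ≤ Real.exp 1 ∧ ‖H z * exp (P z)‖ ≤ Real.exp 1 := by
  have hmax (z : ℂ) : 0 < max 1 ‖U z‖ := lt_max_of_lt_left one_pos
  have hp : ContinuousOn (fun z : ℂ => Real.log (max 1 ‖U z‖)) (Metric.sphere 0 1) :=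
    ContinuousOn.log (continuousOn_const.sup (ContinuousOn.norm fun z hz =>
      (hU z (Metric.sphere_subset_closedBall hz)).continuousAt.continuousWithinAt))
      fun z _ => (hmax z).ne'
  obtain ⟨P, hP, hPp⟩ := exists_entire_re_approx hp one_pos
  have hlower : ∀ z ∈ Metric.sphere (0 : ℂ) 1, max 1 ‖U z‖ ≤ Real.exp (1 + (P z).re) :=
    fun z hz => (Real.log_le_iff_le_exp (hmax z)).1 (by linarith [(abs_le.1 (hPp z hz)).2])
  have hupper : ∀ z ∈ Metric.sphere (0 : ℂ) 1, Real.exp ((P z).re - 1) ≤ max 1 ‖U z‖ :=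
    fun z hz => (Real.le_log_iff_exp_le (hmax z)).1 (by linarith [(abs_le.1 (hPp z hz)).1])
  refine ⟨P, hP, fun z hz => ⟨?_, ?_, ?_⟩⟩
  · have hinv : ‖exp (-P z)‖ ≤ Real.exp 1 := by
      refine norm_le_of_forall_sphere_norm_le (V := fun z => exp (-P z))
        (fun z _ => (hP z).neg.cexp) (fun z hz => ?_) hz
      rw [norm_exp, neg_re, Real.exp_le_exp]
      linarith [Real.exp_le_exp.1 (Real.exp_zero.trans_le
        ((le_max_left _ _).trans (hlower z hz)))]
    rw [norm_exp, neg_re, Real.exp_le_exp] at hinv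
    linarith
  · refine norm_le_of_forall_sphere_norm_le (V := fun z => U z * exp (-P z))
      (fun z hz => (hU z hz).mul (hP z).neg.cexp) (fun z hz => ?_) hz
    rw [norm_mul, norm_exp, neg_re, Real.exp_neg, ← div_eq_mul_inv, div_le_iff₀ (Real.exp_pos _),
      ← Real.exp_add]
    exact (le_max_right _ _).trans (hlower z hz)
  · refine norm_le_of_forall_sphere_norm_le (V := fun z => H z * exp (P z))
      (fun z hz => (hH z hz).mul (hP z).cexp) (fun z hz => ?_) hz
    have hHmax : ‖H z‖ * max 1 ‖U z‖ ≤ 1 := by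
      rw [mul_max_of_nonneg _ _ (norm_nonneg _), mul_one, mul_comm, ← norm_mul]
      exact max_le (hH1 z hz) (hUH z hz)
    have := (mul_le_mul_of_nonneg_left (hupper z hz) (norm_nonneg (H z))).trans hHmax
    rwa [Real.exp_sub, ← mul_div_assoc, div_le_one (Real.exp_pos _), ← norm_exp, ← norm_mul] at this

theorem re_le_of_neg_one_le_re {P : ℂ → ℂ} (hP : Differentiable ℂ P)
    (hre : ∀ z ∈ Metric.closedBall (0 : ℂ) 1, -1 ≤ (P z).re) {C : ℝ} (h0 : (P 0).re ≤ C)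
    (hC : 1 ≤ C) {w : ℂ} (hw : w ∈ Metric.ball (0 : ℂ) 1) :
    (P w).re ≤ 2 * (1 + C) / (1 - ‖w‖) := by
  have hw1 : 0 < 1 - ‖w‖ := sub_pos.2 (mem_ball_zero_iff.1 hw)
  have hbc := borelCaratheodory (f := fun z => (P 0).im * I - P z) (M := 1) one_pos
    (by fun_prop) (fun z hz => by
      simpa using neg_le.1 (hre z (Metric.ball_subset_closedBall hz))) one_pos hw
  have hnorm0 : ‖((P 0).im : ℂ) * I - P 0‖ ≤ C := by
    have : ((P 0).im : ℂ) * I - P 0 = ((-(P 0).re : ℝ) : ℂ) := by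
      apply Complex.ext <;> simp
    rw [this, norm_real, Real.norm_eq_abs, abs_neg]
    exact abs_le.2 ⟨by linarith [hre 0 (by simp)], h0⟩
  calc (P w).re ≤ ‖((P 0).im : ℂ) * I - P w‖ := by
        have := neg_le_of_abs_le (abs_re_le_norm (((P 0).im : ℂ) * I - P w))
        simp only [sub_re, mul_re, I_re, I_im, ofReal_re, ofReal_im] at this
        linarith
    _ ≤ (2 * ‖w‖ + ‖((P 0).im : ℂ) * I - P 0‖ * (1 + ‖w‖)) / (1 - ‖w‖) := by
        rwa [mul_one, ← add_div] at hbc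
    _ ≤ _ := by
        gcongr
        nlinarith [norm_nonneg w, norm_nonneg (((P 0).im : ℂ) * I - P 0)]

theorem norm_le_of_closedBall_quotient
    (hU : ∀ z ∈ Metric.closedBall (0 : ℂ) 1, DifferentiableAt ℂ U z)
    (hH : ∀ z ∈ Metric.closedBall (0 : ℂ) 1, DifferentiableAt ℂ H z)
    (hH1 : ∀ z ∈ Metric.closedBall (0 : ℂ) 1, ‖H z‖ ≤ 1)
    (hUH : ∀ z ∈ Metric.closedBall (0 : ℂ) 1, ‖U z * H z‖ ≤ 1) (h0 : H 0 ≠ 0) {w : ℂ}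
    (hw : w ∈ Metric.ball (0 : ℂ) 1) :
    ‖U w‖ ≤ Real.exp (2 * (3 - Real.log ‖H 0‖) / (1 - ‖w‖)) := by
  obtain ⟨P, hP, hPUH⟩ := exists_entire_log_majorant hU hH
    (fun z hz => hH1 z (Metric.sphere_subset_closedBall hz))
    fun z hz => hUH z (Metric.sphere_subset_closedBall hz)
  have h0mem : (0 : ℂ) ∈ Metric.closedBall (0 : ℂ) 1 := by simp
  have hP0 : (P 0).re ≤ 1 - Real.log ‖H 0‖ := by
    have := (hPUH 0 h0mem).2.2
    rw [norm_mul, norm_exp, ← Real.exp_log (norm_pos_iff.2 h0), ← Real.exp_add,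
      Real.exp_le_exp] at this
    linarith
  have hlog : Real.log ‖H 0‖ ≤ 0 := Real.log_nonpos (norm_nonneg _) (hH1 0 h0mem)
  have hPw := re_le_of_neg_one_le_re hP (fun z hz => (hPUH z hz).1) hP0 (by linarith) hw
  have hUw := (hPUH w (Metric.ball_subset_closedBall hw)).2.1
  rw [norm_mul, norm_exp, neg_re, Real.exp_neg, ← div_eq_mul_inv, div_le_iff₀ (Real.exp_pos _),
    ← Real.exp_add] at hUw
  refine hUw.trans (Real.exp_le_exp.2 ?_)
  have hw1 : 0 < 1 - ‖w‖ := sub_pos.2 (mem_ball_zero_iff.1 hw)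
  rw [le_div_iff₀ hw1] at hPw ⊢
  linarith [norm_nonneg w]

theorem norm_le_of_ball_quotient (hU : DifferentiableOn ℂ U (Metric.ball 0 1))
    (hH : DifferentiableOn ℂ H (Metric.ball 0 1)) (hH1 : ∀ z ∈ Metric.ball (0 : ℂ) 1, ‖H z‖ ≤ 1)
    (hUH : ∀ z ∈ Metric.ball (0 : ℂ) 1, ‖U z * H z‖ ≤ 1) (h0 : H 0 ≠ 0) {w : ℂ}
    (hw : w ∈ Metric.ball (0 : ℂ) 1) :
    ‖U w‖ ≤ Real.exp (4 * (3 - Real.log ‖H 0‖) / (1 - ‖w‖)) := by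
  rw [mem_ball_zero_iff] at hw
  have hw0 := norm_nonneg w
  obtain ⟨r, hr⟩ : ∃ r : ℝ, r = (1 + ‖w‖) / 2 := ⟨_, rfl⟩
  have hr0 : 0 < r := by linarith
  have hball : ∀ z ∈ Metric.closedBall (0 : ℂ) 1, (r : ℂ) * z ∈ Metric.ball (0 : ℂ) 1 :=
    fun z hz => by
      rw [mem_closedBall_zero_iff] at hz
      rw [mem_ball_zero_iff, norm_mul, norm_real, Real.norm_of_nonneg hr0.le]
      nlinarith [norm_nonneg z]
  have hdiff {V : ℂ → ℂ} (hV : DifferentiableOn ℂ V (Metric.ball 0 1)) :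
      ∀ z ∈ Metric.closedBall (0 : ℂ) 1, DifferentiableAt ℂ (fun z => V (r * z)) z := fun z hz =>
    (hV.differentiableAt (Metric.isOpen_ball.mem_nhds (hball z hz))).comp z (by fun_prop)
  have hnorm : ‖w / r‖ = ‖w‖ / r := by rw [norm_div, norm_real, Real.norm_of_nonneg hr0.le]
  have hlt : ‖w / r‖ < 1 := by rw [hnorm, div_lt_one hr0]; linarith
  have hmain := norm_le_of_closedBall_quotient (hdiff hU) (hdiff hH)
    (fun z hz => hH1 _ (hball z hz)) (fun z hz => hUH _ (hball z hz)) (by simpa using h0)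
    (mem_ball_zero_iff.2 hlt)
  rw [mul_zero, mul_div_cancel₀ _ (ofReal_ne_zero.2 hr0.ne'), hnorm] at hmain
  refine hmain.trans (Real.exp_le_exp.2 ?_)
  have hlog : Real.log ‖H 0‖ ≤ 0 := Real.log_nonpos (norm_nonneg _) (hH1 0 (by simp))
  have hgap : (1 - ‖w‖) / 2 ≤ 1 - ‖w‖ / r := by
    rw [le_sub_comm, div_le_iff₀ hr0]
    nlinarith
  calc _ ≤ 2 * (3 - Real.log ‖H 0‖) / ((1 - ‖w‖) / 2) := by
        gcongr
        all_goals linarith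
    _ = _ := by
        rw [div_div_eq_mul_div]
        ring

end Disc

/-- The inverse Cayley transform, mapping the unit disc to the upper half-plane and `0` to `a`. -/
noncomputable def invCayley (a ζ : ℂ) : ℂ := (a - conj a * ζ) / (1 - ζ)

/-- The Cayley transform, mapping the upper half-plane to the unit disc and `a` to `0`. -/
noncomputable def cayley (a z : ℂ) : ℂ := (z - a) / (z - conj a)

theorem invCayley_zero (a : ℂ) : invCayley a 0 = a := by simp [invCayley]

theorem one_sub_ne_zero_of_mem_ball {ζ : ℂ} (hζ : ζ ∈ Metric.ball (0 : ℂ) 1) : 1 - ζ ≠ 0 :=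
  fun h => by simp [← sub_eq_zero.1 h] at hζ

theorem differentiableOn_invCayley (a : ℂ) :
    DifferentiableOn ℂ (invCayley a) (Metric.ball 0 1) := fun ζ hζ => by
  have hne := one_sub_ne_zero_of_mem_ball hζ
  unfold invCayley
  fun_prop (disch := assumption)

section Cayley

variable {a z : ℂ}

theorem mapsTo_invCayley (ha : a ∈ upper) : MapsTo (invCayley a) (Metric.ball 0 1) upper := by
  intro ζ hζ
  have ha : 0 < a.im := ha
  have hpos : 0 < Complex.normSq (1 - ζ) := normSq_pos.2 (one_sub_ne_zero_of_mem_ball hζ)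
  have hζ1 : 0 < 1 - (ζ.re * ζ.re + ζ.im * ζ.im) := by
    rw [← normSq_apply, normSq_eq_norm_sq]
    nlinarith [norm_nonneg ζ, mem_ball_zero_iff.1 hζ]
  have him : (invCayley a ζ).im =
      a.im * (1 - (ζ.re * ζ.re + ζ.im * ζ.im)) / Complex.normSq (1 - ζ) := by
    rw [invCayley, div_im]
    simp only [sub_im, mul_im, conj_re, conj_im, sub_re, one_re, mul_re, one_im]
    ring
  change 0 < (invCayley a ζ).im
  rw [him]
  positivity

theorem sub_conj_ne_zero (ha : a ∈ upper) (hz : z ∈ upper) : z - conj a ≠ 0 :=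
  norm_pos_iff.1 (lt_of_lt_of_le (b := a.im) ha
    (im_le_norm_sub_conj a (upper_subset_closedUpper hz)))

theorem invCayley_cayley (ha : a ∈ upper) (hz : z ∈ upper) : invCayley a (cayley a z) = z := by
  have hza := sub_conj_ne_zero ha hz
  have haa := sub_conj_ne_zero ha ha
  have hone : 1 - cayley a z = (a - conj a) / (z - conj a) := by
    rw [cayley]
    field_simp
    ring
  rw [invCayley, hone, cayley]
  field_simp
  ring

theorem one_sub_sq_norm_cayley (ha : a ∈ upper) (hz : z ∈ upper) :
    1 - ‖cayley a z‖ ^ 2 = 4 * z.im * a.im / ‖z - conj a‖ ^ 2 := by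
  have hza := sub_conj_ne_zero ha hz
  have hpos : 0 < ‖z - conj a‖ ^ 2 := by positivity
  rw [cayley, norm_div, div_pow, eq_div_iff hpos.ne', sub_mul, div_mul_cancel₀ _ hpos.ne', one_mul,
    ← normSq_eq_norm_sq, ← normSq_eq_norm_sq, normSq_apply, normSq_apply]
  simp only [sub_re, sub_im, conj_re, conj_im]
  ring

theorem cayley_mem_ball (ha : a ∈ upper) (hz : z ∈ upper) : cayley a z ∈ Metric.ball (0 : ℂ) 1 := by
  have ha' : 0 < a.im := ha
  have hz' : 0 < z.im := hz
  have hza := sub_conj_ne_zero ha hz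
  have hpos : 0 < 1 - ‖cayley a z‖ ^ 2 := by
    rw [one_sub_sq_norm_cayley ha hz]
    positivity
  rw [mem_ball_zero_iff]
  nlinarith [norm_nonneg (cayley a z)]

theorem inv_one_sub_norm_cayley_le (ha : a ∈ upper) (hz : z ∈ upper) :
    1 / (1 - ‖cayley a z‖) ≤ (1 + ‖a‖ ^ 2) / (2 * a.im) * harnackWeight z := by
  have ha' : 0 < a.im := ha
  have hz' : 0 < z.im := hz
  have hza := sub_conj_ne_zero ha hz
  have hlt := mem_ball_zero_iff.1 (cayley_mem_ball ha hz)
  have hnorm : ‖z - conj a‖ ^ 2 ≤ (1 + ‖z‖ ^ 2) * (1 + ‖a‖ ^ 2) := by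
    have : ‖z - conj a‖ ≤ ‖z‖ + ‖a‖ := (norm_sub_le _ _).trans_eq (by rw [RCLike.norm_conj])
    nlinarith [sq_nonneg (1 - ‖z‖ * ‖a‖), norm_nonneg (z - conj a), norm_nonneg z, norm_nonneg a]
  have hgap : 2 * z.im * a.im / ‖z - conj a‖ ^ 2 ≤ 1 - ‖cayley a z‖ := by
    have hsq := one_sub_sq_norm_cayley ha hz
    have : 4 * z.im * a.im / ‖z - conj a‖ ^ 2 = 2 * (2 * z.im * a.im / ‖z - conj a‖ ^ 2) := by ring
    nlinarith [norm_nonneg (cayley a z)]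
  calc _ ≤ 1 / (2 * z.im * a.im / ‖z - conj a‖ ^ 2) :=
        one_div_le_one_div_of_le (by positivity) hgap
    _ = ‖z - conj a‖ ^ 2 / (2 * z.im * a.im) := one_div_div _ _
    _ ≤ (1 + ‖z‖ ^ 2) * (1 + ‖a‖ ^ 2) / (2 * z.im * a.im) := by gcongr
    _ = _ := by
      rw [harnackWeight]
      field_simp

end Cayley

theorem BoundedType.exists_norm_le_one {u : ℂ → ℂ} (hu : BoundedType u) :
    ∃ h : ℂ → ℂ, DifferentiableOn ℂ h upper ∧ (∀ z ∈ upper, ‖h z‖ ≤ 1) ∧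
      (∀ z ∈ upper, ‖u z * h z‖ ≤ 1) ∧ ∃ a ∈ upper, h a ≠ 0 := by
  obtain ⟨-, g, h, -, hh, ⟨Mg, hMg⟩, ⟨Mh, hMh⟩, ⟨a, ha, hha⟩, heq⟩ := hu
  obtain ⟨M, hM⟩ : ∃ M : ℝ, M = max 1 (max Mg Mh) := ⟨_, rfl⟩
  have hM0 : 0 < M := hM ▸ lt_max_of_lt_left one_pos
  have hMgM : Mg ≤ M := hM ▸ (le_max_left _ _).trans (le_max_right _ _)
  have hMhM : Mh ≤ M := hM ▸ (le_max_right _ _).trans (le_max_right _ _)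
  refine ⟨fun z => h z / M, hh.div_const _, fun z hz => ?_, fun z hz => ?_, a, ha,
    div_ne_zero hha (ofReal_ne_zero.2 hM0.ne')⟩
  · rw [norm_div, norm_real, Real.norm_of_nonneg hM0.le, div_le_one hM0]
    exact (hMh z hz).trans hMhM
  · rw [← mul_div_assoc, heq z hz, norm_div, norm_real, Real.norm_of_nonneg hM0.le, div_le_one hM0]
    exact (hMg z hz).trans hMgM

theorem BoundedType.exists_harnackGrowth {u : ℂ → ℂ} (hu : BoundedType u) :
    ∃ K, 0 ≤ K ∧ HarnackGrowth K u := by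
  obtain ⟨h, hh, hh1, huh, a, ha, hha⟩ := hu.exists_norm_le_one
  have ha' : 0 < a.im := ha
  have hmaps := mapsTo_invCayley ha
  have hbound : ∀ z ∈ upper,
      ‖u z‖ ≤ Real.exp (4 * (3 - Real.log ‖h a‖) / (1 - ‖cayley a z‖)) := fun z hz => by
    have := norm_le_of_ball_quotient (hu.1.comp (differentiableOn_invCayley a) hmaps)
      (hh.comp (differentiableOn_invCayley a) hmaps) (fun ζ hζ => hh1 _ (hmaps hζ))
      (fun ζ hζ => huh _ (hmaps hζ)) (by simpa [invCayley_zero] using hha) (cayley_mem_ball ha hz)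
    simpa only [Function.comp_apply, invCayley_cayley ha hz, invCayley_zero] using this
  have hlog : Real.log ‖h a‖ ≤ 0 := Real.log_nonpos (norm_nonneg _) (hh1 a ha)
  have hL : 0 ≤ 4 * (3 - Real.log ‖h a‖) := by linarith
  refine ⟨4 * (3 - Real.log ‖h a‖) * ((1 + ‖a‖ ^ 2) / (2 * a.im)), by positivity, 1,
    fun z hz => ?_⟩
  rw [one_mul]
  refine (hbound z hz).trans (Real.exp_le_exp.2 ?_)
  rw [div_eq_mul_one_div]
  exact (mul_le_mul_of_nonneg_left (inv_one_sub_norm_cayley_le ha hz) hL).trans_eq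
    (mul_assoc _ _ _).symm

theorem exists_norm_le_harnackWeight_of_re_nonneg {W : ℂ → ℂ} (hd : DifferentiableOn ℂ W upper)
    (hre : ∀ z ∈ upper, 0 ≤ (W z).re) : ∃ C, ∀ z ∈ upper, ‖W z‖ ≤ C * harnackWeight z := by
  have hI : I ∈ upper := by simp [upper]
  have hmaps := mapsTo_invCayley hI
  refine ⟨2 + 2 * ‖W I‖, fun z hz => ?_⟩
  have hcayley := cayley_mem_ball hI hz
  have hbc := borelCaratheodory (f := fun ζ => - W (invCayley I ζ)) (M := 1)
    one_pos (hd.comp (differentiableOn_invCayley I) hmaps).neg (fun ζ hζ => by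
      simpa using neg_le.1 (neg_one_lt_zero.le.trans (hre _ (hmaps hζ)))) one_pos hcayley
  rw [norm_neg, norm_neg, invCayley_cayley hI hz, invCayley_zero] at hbc
  have hweight : 1 / (1 - ‖cayley I z‖) ≤ harnackWeight z := by
    simpa [one_add_one_eq_two] using inv_one_sub_norm_cayley_le hI hz
  have hlt := sub_pos.2 (mem_ball_zero_iff.1 hcayley)
  calc _ ≤ (2 * ‖cayley I z‖ + ‖W I‖ * (1 + ‖cayley I z‖)) * (1 / (1 - ‖cayley I z‖)) := by
        rwa [mul_one_div, add_div, ← mul_one (2 : ℝ)]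
    _ ≤ (2 + 2 * ‖W I‖) * harnackWeight z := by
        refine mul_le_mul ?_ hweight (by positivity) (by positivity)
        nlinarith [norm_nonneg (W I)]

/-! ### A Smirnov type theorem -/

theorem eventually_norm_le_of_meanType_le {u : ℂ → ℂ} (hu : meanType u ≤ 0) {ε : ℝ} (hε : 0 < ε) :
    ∀ᶠ y : ℝ in atTop, ‖u (y * I)‖ ≤ Real.exp (ε * y) := by
  have hlt : meanType u < (ε : EReal) := hu.trans_lt (by exact_mod_cast hε)
  filter_upwards [eventually_lt_of_limsup_lt hlt, eventually_gt_atTop 0] with y hy hy0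
  have hlog : ((ε * y : ℝ) : EReal) = ENNReal.log (ENNReal.ofReal (Real.exp (ε * y))) := by
    rw [ENNReal.log_ofReal_of_pos (Real.exp_pos _), Real.log_exp]
  rw [EReal.div_lt_iff (by exact_mod_cast hy0) (EReal.coe_ne_top y), ← EReal.coe_mul, hlog,
    ENNReal.log_lt_log_iff, ← ofReal_norm] at hy
  exact ((ENNReal.ofReal_lt_ofReal_iff (Real.exp_pos _)).1 hy).le

section PhragmenLindelof

variable {v : ℂ → ℂ} {C k : ℝ}

theorem norm_mul_exp_le_of_isBigO (hv : DifferentiableOn ℂ v closedUpper)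
    (hb : ∀ z ∈ closedUpper, ‖v z‖ ≤ C * Real.exp (k * z.im)) {ε : ℝ} (hε : 0 ≤ ε)
    (hm : (fun y : ℝ => v (y * I)) =O[atTop] fun y => Real.exp (ε * y)) {z : ℂ}
    (hz : z ∈ closedUpper) : ‖v z‖ * Real.exp (-(ε * z.im)) ≤ C := by
  have hnorm (ζ : ℂ) : ‖v (ζ * I) * exp (-(ε * ζ))‖ = ‖v (ζ * I)‖ * Real.exp (-(ε * ζ.re)) := by
    rw [norm_mul, norm_exp]
    simp
  have hmem {ζ : ℂ} (hζ : 0 ≤ ζ.re) : ζ * I ∈ closedUpper := by simpa [closedUpper] using hζ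
  have hPL := PhragmenLindelof.right_half_plane_of_bounded_on_real
    (f := fun ζ => v (ζ * I) * exp (-(ε * ζ))) (C := C) (z := -I * z)
    (DifferentiableOn.diffContOnCl (by
      rw [closure_setOfPred_lt_re]
      exact (hv.comp (by fun_prop) fun ζ hζ => hmem hζ).mul (by fun_prop)))
    ⟨1, one_lt_two, |k|, Asymptotics.IsBigO.of_bound |C| (eventually_inf_principal.2
      (Eventually.of_forall fun ζ hζ => by
        have hζ : 0 < ζ.re := hζ
        rw [hnorm, Real.norm_of_nonneg (Real.exp_pos _).le, Real.rpow_one]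
        calc _ ≤ ‖v (ζ * I)‖ := mul_le_of_le_one_right (norm_nonneg _)
                (Real.exp_le_one_iff.2 (neg_nonpos.2 (by positivity)))
          _ ≤ C * Real.exp (k * ζ.re) := by simpa using hb _ (hmem hζ.le)
          _ ≤ |C| * Real.exp (|k| * ‖ζ‖) := by
              gcongr
              exacts [le_abs_self C, le_abs_self k, re_le_norm ζ]))⟩
    (by
      obtain ⟨D, hD⟩ := hm.bound
      refine isBoundedUnder_of_eventually_le (a := D) (hD.mono fun y hy => ?_)
      rwa [hnorm, ofReal_re, Real.exp_neg, ← div_eq_mul_inv, div_le_iff₀ (Real.exp_pos _),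
        ← Real.norm_of_nonneg (Real.exp_pos (ε * y)).le])
    (fun x => by simpa [mul_assoc, norm_exp] using hb (x * I * I) (hmem (by simp)))
    (by simpa [closedUpper] using hz)
  rw [hnorm] at hPL
  have hrot : -I * z * I = z := by linear_combination (-z) * I_mul_I
  have hre : (-I * z).re = z.im := by simp
  rwa [hrot, hre] at hPL

theorem norm_le_of_forall_isBigO (hv : DifferentiableOn ℂ v closedUpper)
    (hb : ∀ z ∈ closedUpper, ‖v z‖ ≤ C * Real.exp (k * z.im))
    (hm : ∀ ε > 0, (fun y : ℝ => v (y * I)) =O[atTop] fun y => Real.exp (ε * y)) {z : ℂ}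
    (hz : z ∈ closedUpper) : ‖v z‖ ≤ C := by
  have hcont : Continuous fun ε : ℝ => ‖v z‖ * Real.exp (-(ε * z.im)) := by fun_prop
  have hlim : Tendsto (fun ε : ℝ => ‖v z‖ * Real.exp (-(ε * z.im))) (𝓝[>] 0) (𝓝 ‖v z‖) := by
    simpa using (hcont.tendsto 0).mono_left nhdsWithin_le_nhds
  refine le_of_tendsto hlim (eventually_mem_nhdsWithin.mono fun ε hε => ?_)
  have hε : 0 < ε := hε
  exact norm_mul_exp_le_of_isBigO hv hb hε.le (hm ε hε) hz

end PhragmenLindelof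

section Smirnov

variable {u : ℂ → ℂ}

theorem norm_le_of_meanType_le (hu : DifferentiableOn ℂ u closedUpper) {C k : ℝ}
    (hb : ∀ z : ℂ, 1 ≤ z.im → ‖u z‖ ≤ C * Real.exp (k * z.im))
    (hm : meanType u ≤ 0) {z : ℂ} (hz : 1 ≤ z.im) : ‖u z‖ ≤ C * Real.exp k := by
  have him (z : ℂ) : (z + I).im = z.im + 1 := by simp
  have hshift := norm_le_of_forall_isBigO (v := fun z => u (z + I)) (C := C * Real.exp k) (k := k)
    (z := z - I) (hu.comp (by fun_prop) fun z hz => ?_) (fun z hz => ?_) (fun ε hε => ?_)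
    (by simpa [closedUpper] using hz)
  · simpa using hshift
  · have hz : 0 ≤ z.im := hz
    change 0 ≤ (z + I).im
    linarith [him z]
  · have hz : 0 ≤ z.im := hz
    refine (hb (z + I) (by rw [him]; linarith)).trans_eq ?_
    rw [him, mul_assoc, ← Real.exp_add]
    ring_nf
  · refine Asymptotics.IsBigO.of_bound (Real.exp ε) ?_
    filter_upwards [(tendsto_atTop_add_const_right atTop (1 : ℝ) tendsto_id).eventually
      (eventually_norm_le_of_meanType_le hm hε)] with y hy
    rw [Real.norm_of_nonneg (Real.exp_pos _).le, ← Real.exp_add]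
    convert hy using 2
    · simp only [id, ofReal_add, ofReal_one]
      ring_nf
    · simp only [id]
      ring

theorem one_add_inv_sqrt_le {K : ℝ} (hK : 0 < K) {z : ℂ} (hz : z ∈ upper) :
    1 + 1 / √z.im ≤ (2 + 1 / K) * Real.exp (K * harnackWeight z) := by
  have hz' : 0 < z.im := hz
  have hsq : 1 / √z.im ≤ 1 + 1 / z.im := by
    have : 1 / z.im = (1 / √z.im) ^ 2 := by rw [div_pow, Real.sq_sqrt hz'.le, one_pow]
    rw [this]
    nlinarith [sq_nonneg (1 / √z.im - 1)]
  have hweight : 1 / z.im ≤ harnackWeight z := by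
    rw [harnackWeight]
    gcongr
    exact le_add_of_nonneg_right (sq_nonneg _)
  have hexp : harnackWeight z ≤ 1 / K * Real.exp (K * harnackWeight z) := by
    rw [one_div_mul_eq_div, le_div_iff₀' hK]
    linarith [Real.add_one_le_exp (K * harnackWeight z)]
  linarith [one_le_exp_mul_harnackWeight hK.le hz]

theorem harnackGrowth_of_norm_le_inv_sqrt {C : ℝ} (hC : 0 ≤ C)
    (hb : ∀ z ∈ upper, ‖u z‖ ≤ C * (1 + 1 / √z.im)) {K : ℝ} (hK : 0 < K) : HarnackGrowth K u :=
  ⟨C * (2 + 1 / K), fun z hz => by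
    rw [mul_assoc]
    exact (hb z hz).trans (mul_le_mul_of_nonneg_left (one_add_inv_sqrt_le hK hz) hC)⟩

-- Bounded type alone gives the Hardy bound up to a factor `exp (k * im z)`; Phragmén–Lindelöf and
-- the mean type hypothesis then remove that factor away from the real line.
theorem exists_norm_le_inv_sqrt_of_boundedType (hu : AnalyticOnNhd ℂ u closedUpper)
    (hbt : BoundedType u) (hm : meanType u ≤ 0) (h2 : MemLp (fun t : ℝ => u t) 2) :
    ∃ C, 0 ≤ C ∧ ∀ z ∈ upper, ‖u z‖ ≤ C * (1 + 1 / √z.im) := by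
  obtain ⟨K, hK, hg⟩ := hbt.exists_harnackGrowth
  obtain ⟨N, hN⟩ : ∃ N : ℝ, N = √(∫ t : ℝ, ‖u t‖ ^ 2) / √Real.pi := ⟨_, rfl⟩
  obtain ⟨k, hk⟩ : ∃ k : ℝ, k = 2 * (4 * K + 1) := ⟨_, rfl⟩
  have hN0 : 0 ≤ N := hN ▸ by positivity
  have hk0 : 0 ≤ k := by linarith
  have hexp : ∀ z ∈ upper, ‖u z‖ ≤ N * (1 / √z.im) * Real.exp (k * z.im) := fun z hz => by
    have := norm_le_exp_mul_of_harnackGrowth hu hz hK (lt_add_one (4 * K)) hg h2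
    rwa [Real.sqrt_mul Real.pi_pos.le, ← div_div, ← hN, ← hk, div_eq_mul_one_div] at this
  have hfar : ∀ z : ℂ, 1 ≤ z.im → ‖u z‖ ≤ N * Real.exp k := fun z hz =>
    norm_le_of_meanType_le hu.differentiableOn (fun z hz => by
      refine (hexp z (one_pos.trans_le hz)).trans ?_
      gcongr
      refine mul_le_of_le_one_right hN0 ?_
      rw [div_le_one (Real.sqrt_pos.2 (one_pos.trans_le hz))]
      exact Real.one_le_sqrt.2 hz) hm hz
  refine ⟨N * Real.exp k, by positivity, fun z hz => ?_⟩
  have hz' : 0 < z.im := hz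
  rcases le_total 1 z.im with hz1 | hz1
  · exact (hfar z hz1).trans (le_mul_of_one_le_right (by positivity)
      (le_add_of_nonneg_right (by positivity)))
  · calc _ ≤ N * (1 / √z.im) * Real.exp (k * z.im) := hexp z hz
      _ ≤ N * (1 / √z.im) * Real.exp (k * 1) := by gcongr
      _ = N * Real.exp k * (1 / √z.im) := by ring_nf
      _ ≤ _ := by
        gcongr
        exact le_add_of_nonneg_left zero_le_one

theorem norm_le_of_boundedType (hu : AnalyticOnNhd ℂ u closedUpper) (hbt : BoundedType u)
    (hm : meanType u ≤ 0) (h2 : MemLp (fun t : ℝ => u t) 2) {w : ℂ} (hw : w ∈ upper) :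
    ‖u w‖ ≤ √(∫ t : ℝ, ‖u t‖ ^ 2) / √(Real.pi * w.im) := by
  obtain ⟨C, hC, hb⟩ := exists_norm_le_inv_sqrt_of_boundedType hu hbt hm h2
  exact norm_le_of_forall_harnackGrowth hu hw
    (fun K hK => harnackGrowth_of_norm_le_inv_sqrt hC hb hK) h2

end Smirnov

/-! ### Functions satisfying the Hardy space bound relative to `E` -/

section Star

variable {f : ℂ → ℂ}

theorem differentiable_star (hf : Differentiable ℂ f) : Differentiable ℂ (star f) := fun z => by
  have h := (hf (conj z)).conj_conj
  rwa [conj_conj] at h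

theorem star_star_apply (f : ℂ → ℂ) : star (star f) = f := by
  ext z
  simp [star]

theorem star_ofReal (f : ℂ → ℂ) (t : ℝ) : star f t = conj (f t) := by simp [star]

theorem norm_star (f : ℂ → ℂ) (z : ℂ) : ‖star f z‖ = ‖f (conj z)‖ := by
  rw [star, RCLike.norm_conj]

end Star

section HermiteBiehler

variable {E f : ℂ → ℂ}

theorem exists_ofReal_eq_or_mem_upper {z : ℂ} (hz : z ∈ closedUpper) :
    (∃ t : ℝ, (t : ℂ) = z) ∨ z ∈ upper := by
  rcases (show 0 ≤ z.im from hz).eq_or_lt with h | h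
  · exact Or.inl ⟨z.re, Complex.ext rfl h⟩
  · exact Or.inr h

theorem HermiteBiehler.ne_zero (hE : HermiteBiehler E) (hr : NoRealZeros E) {z : ℂ}
    (hz : z ∈ closedUpper) : E z ≠ 0 := by
  rcases exists_ofReal_eq_or_mem_upper hz with ⟨t, rfl⟩ | h
  · exact hr t
  · exact norm_pos_iff.1 ((norm_nonneg _).trans_lt (hE.lt z h))

theorem HermiteBiehler.norm_star_div_lt (hE : HermiteBiehler E) {z : ℂ} (hz : z ∈ upper) :
    ‖star E z / E z‖ < 1 := by
  have h := hE.lt z hz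
  rwa [norm_div, norm_star, div_lt_one ((norm_nonneg _).trans_lt h)]

theorem norm_star_div_ofReal (f E : ℂ → ℂ) (t : ℝ) : ‖star f t / E t‖ = ‖f t / E t‖ := by
  rw [norm_div, norm_star, conj_ofReal, norm_div]

theorem HermiteBiehler.norm_star_div_le (hE : HermiteBiehler E) {z : ℂ} (hz : z ∈ closedUpper) :
    ‖star E z / E z‖ ≤ 1 := by
  rcases exists_ofReal_eq_or_mem_upper hz with ⟨t, rfl⟩ | h
  · rw [norm_star_div_ofReal, norm_div]
    exact div_self_le_one _
  · exact (hE.norm_star_div_lt h).le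

theorem HermiteBiehler.analyticOnNhd_div (hE : HermiteBiehler E) (hr : NoRealZeros E)
    (hf : Differentiable ℂ f) : AnalyticOnNhd ℂ (fun z => f z / E z) closedUpper := fun z hz =>
  (hf.analyticAt z).fun_div (hE.entire.analyticAt z) (hE.ne_zero hr hz)

theorem continuous_div_ofReal (hE : Differentiable ℂ E) (hr : NoRealZeros E)
    (hf : Differentiable ℂ f) : Continuous fun t : ℝ => f t / E t :=
  (hf.continuous.comp continuous_ofReal).div (hE.continuous.comp continuous_ofReal) hr

theorem normSq_star (E f : ℂ → ℂ) : normSq E (star f) = normSq E f := by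
  simp only [normSq, norm_star_div_ofReal]

theorem norm_star_eq (E f : ℂ → ℂ) : norm E (star f) = norm E f := by
  rw [norm, normSq_star, norm]

theorem memLp_star_div (hE : Differentiable ℂ E) (hr : NoRealZeros E) (hf : Differentiable ℂ f)
    (h : MemLp (fun t : ℝ => f t / E t) 2) : MemLp (fun t : ℝ => star f t / E t) 2 :=
  h.of_le (continuous_div_ofReal hE hr (differentiable_star hf)).aestronglyMeasurable
    (Eventually.of_forall fun t => (norm_star_div_ofReal f E t).le)

/-- The entire functions `f` such that `f / E` and `f^* / E` satisfy the pointwise bound of the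
Hardy space `H²` of the upper half-plane. This describes the same space as `MemSpace E`, but unlike
there the conditions are visibly linear and stable under limits in norm. -/
structure MemHardy (E f : ℂ → ℂ) : Prop where
  entire : Differentiable ℂ f
  memLp : MemLp (fun t : ℝ => f t / E t) 2
  bound : ∃ C : ℝ, ∀ z ∈ upper, ‖f z / E z‖ ≤ C / √z.im
  bound_star : ∃ C : ℝ, ∀ z ∈ upper, ‖star f z / E z‖ ≤ C / √z.im

theorem MemHardy.star (hE : Differentiable ℂ E) (hr : NoRealZeros E) (hf : MemHardy E f) :
    MemHardy E (star f) where
  entire := differentiable_star hf.entire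
  memLp := memLp_star_div hE hr hf.entire hf.memLp
  bound := hf.bound_star
  bound_star := by rw [star_star_apply]; exact hf.bound

theorem HermiteBiehler.exists_norm_div_le (hE : HermiteBiehler E) (hr : NoRealZeros E)
    (hf : Differentiable ℂ f) (hbt : BoundedType fun z => f z / E z)
    (hm : meanType (fun z => f z / E z) ≤ 0) (h2 : MemLp (fun t : ℝ => f t / E t) 2) :
    ∃ C : ℝ, ∀ z ∈ upper, ‖f z / E z‖ ≤ C / √z.im := by
  refine ⟨√(∫ t : ℝ, ‖f t / E t‖ ^ 2) / √Real.pi, fun z hz => ?_⟩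
  rw [div_div, ← Real.sqrt_mul Real.pi_pos.le]
  exact norm_le_of_boundedType (hE.analyticOnNhd_div hr hf) hbt hm h2 hz

theorem MemSpace.memHardy (hE : HermiteBiehler E) (hr : NoRealZeros E) (hf : MemSpace E f) :
    MemHardy E f := by
  have hL : MemLp (fun t : ℝ => f t / E t) 2 := (memLp_two_iff_integrable_sq_norm
    (continuous_div_ofReal hE.entire hr hf.entire).aestronglyMeasurable).2 hf.integrable
  exact
    { entire := hf.entire
      memLp := hL
      bound := hE.exists_norm_div_le hr hf.entire hf.boundedType hf.meanType_le hL
      bound_star := hE.exists_norm_div_le hr (differentiable_star hf.entire) hf.boundedType_star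
        hf.meanType_star_le (memLp_star_div hE.entire hr hf.entire hL) }

theorem MemHardy.harnackGrowth (hf : MemHardy E f) {K : ℝ} (hK : 0 < K) :
    HarnackGrowth K (fun z => f z / E z) := by
  obtain ⟨C, hC⟩ := hf.bound
  have hC0 : 0 ≤ C := by
    simpa using (norm_nonneg _).trans (hC I (by simp [upper]))
  refine harnackGrowth_of_norm_le_inv_sqrt hC0 (fun z hz => (hC z hz).trans ?_) hK
  rw [div_eq_mul_one_div]
  exact mul_le_mul_of_nonneg_left (by linarith) hC0

theorem MemHardy.norm_le (hE : HermiteBiehler E) (hr : NoRealZeros E) (hf : MemHardy E f) {z : ℂ}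
    (hz : z ∈ upper) : ‖f z / E z‖ ≤ norm E f / √(Real.pi * z.im) :=
  norm_le_of_forall_harnackGrowth (hE.analyticOnNhd_div hr hf.entire) hz
    (fun _ hK => hf.harnackGrowth hK) hf.memLp

theorem MemHardy.norm_star_le (hE : HermiteBiehler E) (hr : NoRealZeros E) (hf : MemHardy E f)
    {z : ℂ} (hz : z ∈ upper) : ‖DeBranges.star f z / E z‖ ≤ norm E f / √(Real.pi * z.im) := by
  rw [← norm_star_eq]
  exact (hf.star hE.entire hr).norm_le hE hr hz

end HermiteBiehler

/-! ### The Cauchy formula at a real point -/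

section CauchyFactor

/-- A rational function bounded on the closed upper half-plane, square integrable on the real line,
with value `1` at `x`. -/
noncomputable def cauchyFactor (x : ℝ) (z : ℂ) : ℂ := I / (z - x + I)

variable (x : ℝ) {z : ℂ}

theorem one_le_norm_sub_add_I (hz : z ∈ closedUpper) : 1 ≤ ‖z - x + I‖ := by
  have hz' : 0 ≤ z.im := hz
  calc (1 : ℝ) ≤ (z - x + I).im := by simpa using hz'
    _ ≤ |(z - x + I).im| := le_abs_self _
    _ ≤ _ := abs_im_le_norm _

theorem sub_add_I_ne_zero (hz : z ∈ closedUpper) : z - x + I ≠ 0 :=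
  norm_pos_iff.1 (one_pos.trans_le (one_le_norm_sub_add_I x hz))

theorem norm_cauchyFactor_le (hz : z ∈ closedUpper) : ‖cauchyFactor x z‖ ≤ 1 := by
  rw [cauchyFactor, norm_div, norm_I]
  exact div_le_one_of_le₀ (one_le_norm_sub_add_I x hz) (norm_nonneg _)

theorem cauchyFactor_self : cauchyFactor x x = 1 := by simp [cauchyFactor]

theorem analyticOnNhd_cauchyFactor : AnalyticOnNhd ℂ (cauchyFactor x) closedUpper := fun z hz => by
  have := sub_add_I_ne_zero x hz
  unfold cauchyFactor
  fun_prop (disch := assumption)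

theorem sq_norm_cauchyFactor (t : ℝ) : ‖cauchyFactor x t‖ ^ 2 = 1 / ((t - x) ^ 2 + 1) := by
  rw [cauchyFactor, norm_div, norm_I, div_pow, one_pow, ← normSq_eq_norm_sq, normSq_apply]
  simp [pow_two]

theorem poissonUpper_add_I (t : ℝ) :
    poissonUpper (x + I) t = 1 / Real.pi * (1 / ((t - x) ^ 2 + 1)) := by
  rw [poissonUpper, normSq_apply]
  simp only [add_im, ofReal_im, I_im, zero_add, sub_re, ofReal_re, add_re, I_re, add_zero, sub_im]
  rw [one_div_mul_one_div]
  ring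

theorem ofReal_add_I_mem_upper : (x + I : ℂ) ∈ upper := by simp [upper]

theorem integrable_inv_sq_add_one : Integrable fun t : ℝ => 1 / ((t - x) ^ 2 + 1) := by
  refine ((integrable_poissonUpper (ofReal_add_I_mem_upper x)).const_mul Real.pi).congr
    (Eventually.of_forall fun t => ?_)
  simp only [poissonUpper_add_I]
  rw [← mul_assoc, mul_one_div_cancel Real.pi_ne_zero, one_mul]

theorem continuous_cauchyFactor : Continuous fun t : ℝ => cauchyFactor x t := by
  unfold cauchyFactor
  exact continuous_const.div (by fun_prop) fun t => sub_add_I_ne_zero x (ofReal_mem_closedUpper t)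

theorem memLp_cauchyFactor : MemLp (fun t : ℝ => cauchyFactor x t) 2 := by
  rw [memLp_two_iff_integrable_sq_norm (continuous_cauchyFactor x).aestronglyMeasurable]
  simp only [sq_norm_cauchyFactor]
  exact integrable_inv_sq_add_one x

theorem one_le_abs_sub_mul_norm_cauchyFactor {t : ℝ} (ht : 1 ≤ |t - x|) :
    1 ≤ |t - x| * (2 * ‖cauchyFactor x t‖) := by
  have hsq : 1 ≤ (t - x) ^ 2 := by
    rw [← sq_abs]
    exact one_le_pow₀ ht
  refine (one_le_sq_iff₀ (by positivity)).1 ?_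
  rw [mul_pow, mul_pow, sq_norm_cauchyFactor, sq_abs, ← mul_assoc, mul_one_div,
    le_div_iff₀ (by positivity)]
  linarith

end CauchyFactor

theorem integrable_of_norm_le_of_one_le_abs_sub {V : Type*} [NormedAddCommGroup V] {g : ℝ → V}
    {h : ℝ → ℝ} {x : ℝ} (hg : Continuous g) (hh : Integrable h)
    (hgh : ∀ t, 1 ≤ |t - x| → ‖g t‖ ≤ h t) : Integrable g := by
  rw [← integrableOn_univ, ← union_compl_self (Icc (x - 1) (x + 1)), integrableOn_union]
  refine ⟨hg.integrableOn_Icc, hh.integrableOn.mono' hg.aestronglyMeasurable ?_⟩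
  refine ae_restrict_of_forall_mem measurableSet_Icc.compl fun t ht => hgh t ?_
  by_contra! hlt
  rw [abs_lt] at hlt
  exact ht ⟨by linarith, by linarith⟩

section CauchyQuotient

variable {u : ℂ → ℂ}

/-- The difference quotient of `u` at `x`, with the value `u x` multiplied by `cauchyFactor x` in
order to make the quotient integrable on the real line. -/
noncomputable def cauchyQuotient (u : ℂ → ℂ) (x : ℝ) : ℂ → ℂ :=
  dslope (fun z => u z - u x * cauchyFactor x z) x

theorem sub_mul_cauchyQuotient (u : ℂ → ℂ) (x : ℝ) (z : ℂ) :
    (z - x) * cauchyQuotient u x z = u z - u x * cauchyFactor x z := by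
  rw [cauchyQuotient, ← smul_eq_mul, sub_smul_dslope]
  simp [cauchyFactor_self]

theorem analyticOnNhd_sub_cauchyFactor (hu : AnalyticOnNhd ℂ u closedUpper) (x : ℝ) :
    AnalyticOnNhd ℂ (fun z => u z - u x * cauchyFactor x z) closedUpper :=
  hu.sub (analyticOnNhd_const.mul (analyticOnNhd_cauchyFactor x))

theorem differentiableAt_cauchyQuotient (hu : AnalyticOnNhd ℂ u closedUpper) (x : ℝ) {z : ℂ}
    (hz : z ∈ closedUpper) : DifferentiableAt ℂ (cauchyQuotient u x) z :=
  differentiableAt_dslope (analyticOnNhd_sub_cauchyFactor hu x x (ofReal_mem_closedUpper x))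
    (analyticOnNhd_sub_cauchyFactor hu x z hz)

theorem continuous_cauchyQuotient (hu : AnalyticOnNhd ℂ u closedUpper) (x : ℝ) :
    Continuous fun t : ℝ => cauchyQuotient u x t :=
  continuous_iff_continuousAt.2 fun t =>
    (differentiableAt_cauchyQuotient hu x (ofReal_mem_closedUpper t)).continuousAt.comp
      continuous_ofReal.continuousAt

theorem norm_cauchyQuotient_le (u : ℂ → ℂ) {x t : ℝ} (ht : 1 ≤ |t - x|) :
    ‖cauchyQuotient u x t‖ ≤ ‖u t - u x * cauchyFactor x t‖ * (2 * ‖cauchyFactor x t‖) := by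
  have hnorm : ‖(t : ℂ) - x‖ = |t - x| := by rw [← ofReal_sub, norm_real, Real.norm_eq_abs]
  rw [← sub_mul_cauchyQuotient, norm_mul, hnorm, mul_right_comm, mul_comm]
  exact le_mul_of_one_le_right (norm_nonneg _) (one_le_abs_sub_mul_norm_cauchyFactor x ht)

theorem integrable_cauchyQuotient (hu : AnalyticOnNhd ℂ u closedUpper) (x : ℝ)
    (h2 : MemLp (fun t : ℝ => u t) 2) : Integrable fun t : ℝ => cauchyQuotient u x t := by
  have hfar : Integrable fun t : ℝ => ‖u t - u x * cauchyFactor x t‖ * (2 * ‖cauchyFactor x t‖) :=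
    (h2.sub ((memLp_cauchyFactor x).const_mul _)).norm.integrable_mul
      ((memLp_cauchyFactor x).norm.const_mul 2)
  exact integrable_of_norm_le_of_one_le_abs_sub (continuous_cauchyQuotient hu x) hfar fun t ht =>
    norm_cauchyQuotient_le u ht

theorem integral_cauchyQuotient (hu : AnalyticOnNhd ℂ u closedUpper) (x : ℝ)
    (hb : ∀ K > 0, HarnackGrowth K u) (h2 : MemLp (fun t : ℝ => u t) 2) :
    ∫ t : ℝ, cauchyQuotient u x t = 0 := by
  have hd : DifferentiableOn ℂ (cauchyQuotient u x) closedUpper := fun z hz =>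
    (differentiableAt_cauchyQuotient hu x hz).differentiableWithinAt
  have hfactor : ∀ z ∈ upper, ‖u x * cauchyFactor x z‖ ≤ ‖u x‖ := fun z hz => by
    rw [norm_mul]
    exact mul_le_of_le_one_right (norm_nonneg _)
      (norm_cauchyFactor_le x (upper_subset_closedUpper hz))
  exact integral_eq_zero_of_forall_harnackGrowth hd.continuousOn
    (hd.mono upper_subset_closedUpper) (integrable_cauchyQuotient hu x h2) fun K hK =>
    ((hb K hK).sub (harnackGrowth_of_norm_le hK.le hfactor)).dslope hK.le
      (analyticOnNhd_sub_cauchyFactor hu x) (ofReal_mem_closedUpper x)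

end CauchyQuotient

/-! ### The reproducing kernel at real points -/

section Kernel

variable {E F f : ℂ → ℂ}

theorem differentiable_kernelNum (hE : Differentiable ℂ E) (w : ℂ) :
    Differentiable ℂ (kernelNum E w) :=
  (hE.const_mul _).sub ((differentiable_star hE).const_mul _)

theorem kernelNum_ofReal_ofReal (E : ℂ → ℂ) (x t : ℝ) :
    kernelNum E x t = conj (E x) * E t - E x * conj (E t) := by
  rw [kernelNum, conj_ofReal, star_ofReal]

theorem kernelNum_ofReal_self (E : ℂ → ℂ) (x : ℝ) : kernelNum E x x = 0 := by
  rw [kernelNum_ofReal_ofReal, mul_comm, sub_self]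

theorem kernel_ofReal_eq_dslope (E : ℂ → ℂ) (x : ℝ) :
    kernel E x = fun z => -dslope (kernelNum E x) x z / (2 * Real.pi * I) := by
  ext z
  rw [kernel, conj_ofReal]
  split_ifs with h
  · rw [h, dslope_same]
  · rw [dslope_of_ne _ h, slope_def_field, kernelNum_ofReal_self, sub_zero, ← neg_sub (x : ℂ) z,
      div_neg, neg_neg, div_div, mul_comm]

theorem differentiable_kernel_ofReal (hE : Differentiable ℂ E) (x : ℝ) :
    Differentiable ℂ (kernel E x) := by
  have hnum := differentiable_kernelNum hE x
  rw [kernel_ofReal_eq_dslope]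
  exact fun z => (differentiableAt_dslope (hnum.analyticAt _) (hnum.analyticAt z)).neg.div_const _

theorem sub_mul_kernel_ofReal (E : ℂ → ℂ) (x : ℝ) (z : ℂ) :
    (z - x) * kernel E x z = -kernelNum E x z / (2 * Real.pi * I) := by
  have h := sub_smul_dslope (kernelNum E x) x z
  rw [kernelNum_ofReal_self, sub_zero, smul_eq_mul] at h
  rw [kernel_ofReal_eq_dslope, ← h]
  ring

theorem star_kernel_ofReal (hE : Differentiable ℂ E) (x : ℝ) : star (kernel E x) = kernel E x := by
  have hk := differentiable_kernel_ofReal hE x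
  refine (differentiable_star hk).continuous.ext_on (dense_compl_singleton (x : ℂ)) hk.continuous
    fun z hz => mul_left_cancel₀ (sub_ne_zero.2 hz) ?_
  calc (z - x) * star (kernel E x) z = conj ((conj z - x) * kernel E x (conj z)) := by
        simp [star]
    _ = -kernelNum E x z / (2 * Real.pi * I) := by
        rw [sub_mul_kernel_ofReal]
        simp only [kernelNum, star, map_div₀, map_neg, map_sub, map_mul, conj_conj, conj_ofReal,
          conj_I, map_ofNat]
        ring
    _ = _ := (sub_mul_kernel_ofReal E x z).symm

theorem eq_of_forall_ofReal_eq {g : ℂ → ℂ} (hf : Differentiable ℂ f) (hg : Differentiable ℂ g)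
    (h : ∀ t : ℝ, f t = g t) : f = g := by
  have hreal : Tendsto (fun t : ℝ => (t : ℂ)) (𝓝[≠] 0) (𝓝[≠] 0) :=
    continuous_ofReal.continuousAt.continuousWithinAt.tendsto_nhdsWithin
      fun t ht => ofReal_ne_zero.2 ht
  exact AnalyticOnNhd.eq_of_frequently_eq (z₀ := 0) (fun z _ => hf.analyticAt z)
    (fun z _ => hg.analyticAt z) (hreal.frequently (Eventually.of_forall h).frequently)

/-! ### The reproducing property -/

theorem conj_cauchyFactor_ofReal (x t : ℝ) : conj (cauchyFactor x t) = -I / (t - x - I) := by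
  rw [cauchyFactor]
  simp [sub_eq_add_neg]

theorem sub_mul_poissonUpper_add_I (x t : ℝ) :
    ((t : ℂ) - x) * poissonUpper (x + I) t =
      (conj (cauchyFactor x t) - cauchyFactor x t) * (I / (2 * Real.pi)) := by
  have hp : (t : ℂ) - x + I ≠ 0 := sub_add_I_ne_zero x (ofReal_mem_closedUpper t)
  have hq : (t : ℂ) - x - I ≠ 0 := fun h => hp (by simpa using congrArg conj h)
  have hmul : ((t : ℂ) - x) ^ 2 + 1 = (t - x + I) * (t - x - I) := by linear_combination I_sq
  have hpi : (Real.pi : ℂ) ≠ 0 := ofReal_ne_zero.2 Real.pi_ne_zero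
  rw [conj_cauchyFactor_ofReal, cauchyFactor, poissonUpper_add_I]
  push_cast
  rw [hmul]
  field_simp
  ring_nf
  simp only [I_sq]
  ring

-- Both sides are regular at `x`, and multiplied by `t - x` they can be compared using the
-- definitions. The conjugate `conj (f^* / E) = f / conj E` accounts for the second term of the
-- kernel, and the Poisson kernel for the two corrections by `cauchyFactor`.
theorem conj_kernel_div_mul_div (hr : NoRealZeros E) (f : ℂ → ℂ) {x t : ℝ} (htx : t ≠ x) :
    conj (kernel E x t / E t) * (f t / E t) =
      E x / (2 * Real.pi * I) * cauchyQuotient (fun z => f z / E z) x t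
        - conj (E x) / (2 * Real.pi * I) * conj (cauchyQuotient (fun z => star f z / E z) x t)
        + f x * poissonUpper (x + I) t := by
  have hsub : (t : ℂ) - x ≠ 0 := by
    rw [← ofReal_sub]
    exact ofReal_ne_zero.2 (sub_ne_zero.2 htx)
  have hEt := hr t
  have hEt' : conj (E t) ≠ 0 := (map_ne_zero _).2 hEt
  have hEx := hr x
  have hEx' : conj (E x) ≠ 0 := (map_ne_zero _).2 hEx
  have hk : (t - x) * conj (kernel E x t) =
      (E x * conj (E t) - conj (E x) * E t) / (2 * Real.pi * I) := by
    have := congrArg conj (sub_mul_kernel_ofReal E x t)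
    simp only [kernelNum_ofReal_ofReal, map_mul, map_sub, conj_conj, conj_ofReal, map_div₀,
      map_neg, conj_I, map_ofNat] at this
    rw [this]
    ring
  have hu := sub_mul_cauchyQuotient (fun z => f z / E z) x t
  have hv : (t - x) * conj (cauchyQuotient (fun z => star f z / E z) x t) =
      f t / conj (E t) - f x / conj (E x) * conj (cauchyFactor x t) := by
    have := congrArg conj (sub_mul_cauchyQuotient (fun z => star f z / E z) x t)
    simpa only [star_ofReal, map_mul, map_sub, conj_conj, conj_ofReal, map_div₀] using this
  refine mul_left_cancel₀ hsub ?_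
  calc _ = (t - x) * conj (kernel E x t) / conj (E t) * (f t / E t) := by
        rw [map_div₀]
        ring
    _ = E x / (2 * Real.pi * I) * (f t / E t - f x / E x * cauchyFactor x t)
        - conj (E x) / (2 * Real.pi * I) *
          (f t / conj (E t) - f x / conj (E x) * conj (cauchyFactor x t))
        + f x * ((conj (cauchyFactor x t) - cauchyFactor x t) * (I / (2 * Real.pi))) := by
        rw [hk]
        have hpi : (Real.pi : ℂ) ≠ 0 := ofReal_ne_zero.2 Real.pi_ne_zero
        field_simp
        ring_nf
        simp only [I_sq]
        ring
    _ = _ := by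
        rw [← hu, ← hv, ← sub_mul_poissonUpper_add_I]
        ring

theorem MemHardy.integral_conj_kernel_mul (hE : HermiteBiehler E) (hr : NoRealZeros E)
    (hf : MemHardy E f) (x : ℝ) : ∫ t : ℝ, conj (kernel E x t / E t) * (f t / E t) = f x := by
  have hs := hf.star hE.entire hr
  have hua := hE.analyticOnNhd_div hr hf.entire
  have hva := hE.analyticOnNhd_div hr hs.entire
  have hu := integrable_cauchyQuotient hua x hf.memLp
  have hv : Integrable fun t : ℝ => conj (cauchyQuotient (fun z => DeBranges.star f z / E z) x t) :=
    (LinearIsometryEquiv.integrable_comp_iff conjLIE).2 (integrable_cauchyQuotient hva x hs.memLp)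
  have hw := ofReal_add_I_mem_upper x
  have hae := (Measure.ae_ne volume x).mono fun t ht => conj_kernel_div_mul_div hr f ht
  rw [integral_congr_ae hae, integral_add, integral_sub, integral_const_mul, integral_const_mul,
    integral_const_mul, integral_conj,
    integral_cauchyQuotient hua x (fun _ hK => hf.harnackGrowth hK) hf.memLp,
    integral_cauchyQuotient hva x (fun _ hK => hs.harnackGrowth hK) hs.memLp,
    integral_complex_ofReal, integral_poissonUpper hw]
  · simp
  · exact hu.const_mul _
  · exact hv.const_mul _
  · exact (hu.const_mul _).sub (hv.const_mul _)
  · exact (integrable_ofReal_poissonUpper hw).const_mul _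

/-! ### The kernel belongs to the space -/

theorem HermiteBiehler.norm_kernelNum_div_le (hE : HermiteBiehler E) (hr : NoRealZeros E) (x : ℝ)
    {z : ℂ} (hz : z ∈ closedUpper) : ‖kernelNum E x z / E z‖ ≤ 2 * ‖E x‖ := by
  have hsplit : kernelNum E x z / E z = conj (E x) - E x * (star E z / E z) := by
    have := hE.ne_zero hr hz
    rw [kernelNum, conj_ofReal]
    field_simp
  calc _ ≤ ‖E x‖ + ‖E x‖ * ‖star E z / E z‖ := by
        rw [hsplit, ← norm_mul, ← RCLike.norm_conj (E x)]
        exact norm_sub_le _ _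
    _ ≤ ‖E x‖ + ‖E x‖ * 1 := by
        gcongr
        exact hE.norm_star_div_le hz
    _ = _ := by ring

theorem HermiteBiehler.norm_sub_mul_kernel_div_le (hE : HermiteBiehler E) (hr : NoRealZeros E)
    (x : ℝ) {z : ℂ} (hz : z ∈ closedUpper) : ‖z - x‖ * ‖kernel E x z / E z‖ ≤ ‖E x‖ := by
  have hnorm : ‖(2 * Real.pi * I : ℂ)‖ = 2 * Real.pi := by simp [abs_of_pos Real.pi_pos]
  have hnum := hE.norm_kernelNum_div_le hr x hz
  calc _ = ‖kernelNum E x z / E z‖ / (2 * Real.pi) := by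
        rw [← norm_mul, ← mul_div_assoc, sub_mul_kernel_ofReal, div_right_comm, norm_div, hnorm,
          neg_div, norm_neg]
    _ ≤ ‖E x‖ := by
        rw [div_le_iff₀ Real.two_pi_pos]
        nlinarith [norm_nonneg (E x), Real.pi_gt_three]

theorem norm_sub_div_sub_add_I_le_one (x : ℝ) {z : ℂ} (hz : z ∈ closedUpper) :
    ‖(z - x) / (z - x + I)‖ ≤ 1 := by
  have hz' : 0 ≤ z.im := hz
  rw [norm_div]
  refine div_le_one_of_le₀ (abs_le_of_sq_le_sq' ?_ (norm_nonneg _)).2 (norm_nonneg _)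
  rw [← normSq_eq_norm_sq, ← normSq_eq_norm_sq, normSq_apply, normSq_apply]
  simp only [sub_re, ofReal_re, sub_im, ofReal_im, add_re, add_im, I_re, I_im]
  nlinarith

theorem HermiteBiehler.boundedType_kernel_div (hE : HermiteBiehler E) (hr : NoRealZeros E)
    (x : ℝ) : BoundedType fun z => kernel E x z / E z := by
  have hd : DifferentiableOn ℂ (fun z => kernel E x z / E z) upper :=
    (hE.analyticOnNhd_div hr (differentiable_kernel_ofReal hE.entire x)).differentiableOn.mono
      upper_subset_closedUpper
  have hh : DifferentiableOn ℂ (fun z : ℂ => (z - x) / (z - x + I)) upper := fun z hz => by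
    have := sub_add_I_ne_zero x (upper_subset_closedUpper hz)
    exact DifferentiableAt.differentiableWithinAt (by fun_prop (disch := assumption))
  refine ⟨hd, fun z => kernel E x z / E z * ((z - x) / (z - x + I)), fun z => (z - x) / (z - x + I),
    hd.mul hh, hh, ⟨‖E x‖, fun z hz => ?_⟩,
    ⟨1, fun z hz => norm_sub_div_sub_add_I_le_one x (upper_subset_closedUpper hz)⟩,
    ⟨x + I, ofReal_add_I_mem_upper x, by simp⟩, fun z _ => rfl⟩
  have hz' := upper_subset_closedUpper hz
  rw [norm_mul, norm_div (z - x), mul_div_assoc', mul_comm]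
  exact (div_le_self (by positivity) (one_le_norm_sub_add_I x hz')).trans
    (hE.norm_sub_mul_kernel_div_le hr x hz')

theorem HermiteBiehler.meanType_kernel_div_le (hE : HermiteBiehler E) (hr : NoRealZeros E)
    (x : ℝ) : meanType (fun z => kernel E x z / E z) ≤ 0 := by
  refine limsup_le_of_le (by isBoundedDefault) ?_
  filter_upwards [eventually_gt_atTop 0, eventually_ge_atTop ‖E x‖] with y hy hyE
  refine EReal.div_nonpos_of_nonpos_of_nonneg ?_ (EReal.coe_nonneg.2 hy.le)
  rw [ENNReal.log_le_zero_iff, ← ofReal_norm, ENNReal.ofReal_le_one]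
  have hmem : (y : ℂ) * I ∈ closedUpper := by simpa [closedUpper] using hy.le
  have hdist : y ≤ ‖(y : ℂ) * I - x‖ := by
    calc y = ((y : ℂ) * I - x).im := by simp
      _ ≤ _ := (le_abs_self _).trans (abs_im_le_norm _)
  refine le_of_mul_le_mul_left ?_ hy
  calc _ ≤ ‖(y : ℂ) * I - x‖ * ‖kernel E x (y * I) / E (y * I)‖ := by gcongr
    _ ≤ ‖E x‖ := hE.norm_sub_mul_kernel_div_le hr x hmem
    _ ≤ y * 1 := by rwa [mul_one]

theorem HermiteBiehler.integrable_kernel_div (hE : HermiteBiehler E) (hr : NoRealZeros E)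
    (x : ℝ) : Integrable fun t : ℝ => ‖kernel E x t / E t‖ ^ 2 := by
  have hc := continuous_div_ofReal hE.entire hr (differentiable_kernel_ofReal hE.entire x)
  refine integrable_of_norm_le_of_one_le_abs_sub (x := x) (hc.norm.pow 2)
    ((integrable_inv_sq_add_one x).const_mul (2 * ‖E x‖ ^ 2)) fun t ht => ?_
  rw [Real.norm_of_nonneg (by positivity), mul_one_div, le_div_iff₀ (by positivity)]
  have hsq : 1 ≤ (t - x) ^ 2 := by
    rw [← sq_abs]
    exact one_le_pow₀ ht
  have hk := hE.norm_sub_mul_kernel_div_le hr x (ofReal_mem_closedUpper t)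
  rw [← ofReal_sub, norm_real, Real.norm_eq_abs] at hk
  calc ‖kernel E x t / E t‖ ^ 2 * ((t - x) ^ 2 + 1)
      ≤ ‖kernel E x t / E t‖ ^ 2 * ((t - x) ^ 2 + (t - x) ^ 2) := by gcongr
    _ = 2 * (|t - x| * ‖kernel E x t / E t‖) ^ 2 := by
        rw [mul_pow, sq_abs]
        ring
    _ ≤ _ := by gcongr

theorem HermiteBiehler.memSpace_kernel (hE : HermiteBiehler E) (hr : NoRealZeros E) (x : ℝ) :
    MemSpace E (kernel E x) where
  entire := differentiable_kernel_ofReal hE.entire x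
  integrable := hE.integrable_kernel_div hr x
  boundedType := hE.boundedType_kernel_div hr x
  boundedType_star := by
    rw [star_kernel_ofReal hE.entire]
    exact hE.boundedType_kernel_div hr x
  meanType_le := hE.meanType_kernel_div_le hr x
  meanType_star_le := by
    rw [star_kernel_ofReal hE.entire]
    exact hE.meanType_kernel_div_le hr x

theorem HermiteBiehler.kernel_self (hE : HermiteBiehler E) (hr : NoRealZeros E) (x : ℝ) :
    kernel E x x = (normSq E (kernel E x) : ℂ) := by
  rw [← ((hE.memSpace_kernel hr x).memHardy hE hr).integral_conj_kernel_mul hE hr x, normSq,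
    ← integral_complex_ofReal]
  congr 1 with t
  rw [← normSq_eq_conj_mul_self, normSq_eq_norm_sq]

theorem HermiteBiehler.kernel_self_re (hE : HermiteBiehler E) (hr : NoRealZeros E) (x : ℝ) :
    (kernel E x x).re = normSq E (kernel E x) := by
  rw [hE.kernel_self hr, ofReal_re]

theorem eq_zero_of_normSq_eq_zero (hE : Differentiable ℂ E) (hr : NoRealZeros E)
    (hf : Differentiable ℂ f) (hi : Integrable fun t : ℝ => ‖f t / E t‖ ^ 2)
    (h : normSq E f = 0) : f = 0 := by
  refine eq_of_forall_ofReal_eq hf (differentiable_const 0) fun t => ?_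
  rw [normSq, integral_eq_zero_iff_of_nonneg (fun t => by positivity) hi] at h
  have hquot := congrFun ((((continuous_div_ofReal hE hr hf).norm.pow 2).ae_eq_iff_eq volume
    (continuous_const (y := (0 : ℝ)))).1 h) t
  exact (div_eq_zero_iff.1 (by simpa using hquot)).resolve_right (hr t)

theorem HermiteBiehler.kernelNum_ne_zero (hE : HermiteBiehler E) (hr : NoRealZeros E) (x : ℝ)
    {z : ℂ} (hz : z ∈ upper) : kernelNum E x z ≠ 0 := by
  intro h
  rw [kernelNum, sub_eq_zero, conj_ofReal] at h
  have hnorm := congrArg (‖·‖) h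
  simp only [norm_mul, RCLike.norm_conj, norm_star] at hnorm
  exact (hE.lt z hz).ne' (mul_left_cancel₀ (norm_ne_zero_iff.2 (hr x)) hnorm)

theorem HermiteBiehler.kernel_self_re_pos (hE : HermiteBiehler E) (hr : NoRealZeros E) (x : ℝ) :
    0 < (kernel E x x).re := by
  rw [hE.kernel_self_re hr]
  refine lt_of_le_of_ne (integral_nonneg fun t => by positivity) fun h => ?_
  have hzero := eq_zero_of_normSq_eq_zero hE.entire hr (differentiable_kernel_ofReal hE.entire x)
    (hE.integrable_kernel_div hr x) h.symm
  have hI := sub_mul_kernel_ofReal E x I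
  rw [hzero, Pi.zero_apply, mul_zero, eq_comm, div_eq_zero_iff, neg_eq_zero] at hI
  exact hE.kernelNum_ne_zero hr x (by simp [upper]) (hI.resolve_right two_pi_I_ne_zero)

/-! ### Products -/

theorem HermiteBiehler.mul (hE : HermiteBiehler E) (hF : HermiteBiehler F) :
    HermiteBiehler fun z => E z * F z where
  entire := hE.entire.mul hF.entire
  lt z hz := by
    rw [norm_mul, norm_mul]
    exact mul_lt_mul'' (hE.lt z hz) (hF.lt z hz) (norm_nonneg _) (norm_nonneg _)

theorem NoRealZeros.mul (hE : NoRealZeros E) (hF : NoRealZeros F) :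
    NoRealZeros fun z => E z * F z := fun x => mul_ne_zero (hE x) (hF x)

theorem star_mul (E F : ℂ → ℂ) (z : ℂ) : star (fun z => E z * F z) z = star E z * star F z := by
  simp [star]

theorem kernel_mul (hE : Differentiable ℂ E) (hF : Differentiable ℂ F) (x : ℝ) :
    kernel (fun z => E z * F z) x =
      fun z => conj (F x) * F z * kernel E x z + E x * star E z * kernel F x z := by
  have hEF : Differentiable ℂ fun z => E z * F z := hE.mul hF
  refine (differentiable_kernel_ofReal hEF x).continuous.ext_on
    (dense_compl_singleton (x : ℂ)) ?_ fun z hz => mul_left_cancel₀ (sub_ne_zero.2 hz) ?_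
  · have := (differentiable_kernel_ofReal hE x).continuous
    have := (differentiable_kernel_ofReal hF x).continuous
    have := (differentiable_star hE).continuous
    have := hF.continuous
    fun_prop
  · rw [mul_add, mul_left_comm, mul_left_comm (z - x) (E x * star E z), sub_mul_kernel_ofReal,
      sub_mul_kernel_ofReal, sub_mul_kernel_ofReal]
    simp only [kernelNum, star_mul, conj_ofReal, map_mul]
    ring

theorem kernel_mul_self_re (hE : Differentiable ℂ E) (hF : Differentiable ℂ F) (x : ℝ) :
    (kernel (fun z => E z * F z) x x).re =
      ‖F x‖ ^ 2 * (kernel E x x).re + ‖E x‖ ^ 2 * (kernel F x x).re := by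
  rw [kernel_mul hE hF]
  beta_reduce
  rw [star_ofReal, ← normSq_eq_conj_mul_self, mul_conj, normSq_eq_norm_sq, normSq_eq_norm_sq,
    add_re, re_ofReal_mul, re_ofReal_mul]

end Kernel

/-! ### The phase function -/

section Phase

variable {E : ℂ → ℂ} {φ : ℝ → ℝ}

theorem IsPhase.conj_eq (hφ : IsPhase E φ) (x : ℝ) : conj (E x) = ‖E x‖ * exp (I * φ x) := by
  conv_lhs => rw [hφ.eq x]
  rw [map_mul, conj_ofReal, ← exp_conj]
  simp

theorem IsPhase.kernelNum_eq (hφ : IsPhase E φ) (x t : ℝ) :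
    kernelNum E x t = -(2 * I) * (‖E x‖ * ‖E t‖) * Real.sin (φ t - φ x) := by
  have hadd : exp (I * φ x) * exp (-(I * φ t)) = exp (-(φ t - φ x) * I) := by
    rw [← exp_add]
    ring_nf
  have hsub : exp (-(I * φ x)) * exp (I * φ t) = exp ((φ t - φ x) * I) := by
    rw [← exp_add]
    ring_nf
  rw [kernelNum_ofReal_ofReal, hφ.conj_eq x, hφ.conj_eq t, ofReal_sin, ofReal_sub, sin, ← hadd,
    ← hsub]
  linear_combination ‖E x‖ * exp (I * φ x) * hφ.eq t - ‖E t‖ * exp (I * φ t) * hφ.eq x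
    + ‖E x‖ * ‖E t‖ * (exp (I * φ x) * exp (-(I * φ t)) - exp (-(I * φ x)) * exp (I * φ t)) * I_sq

theorem IsPhase.sin_sub_eq (hr : NoRealZeros E) (hφ : IsPhase E φ) (x t : ℝ) :
    Real.sin (φ t - φ x) = (t - x) * (Real.pi * (kernel E x t).re / (‖E x‖ * ‖E t‖)) := by
  have hx : ‖E x‖ ≠ 0 := norm_ne_zero_iff.2 (hr x)
  have ht : ‖E t‖ ≠ 0 := norm_ne_zero_iff.2 (hr t)
  have hpi := Real.pi_ne_zero
  have hk : ((t - x : ℝ) : ℂ) * kernel E x t =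
      ((‖E x‖ * ‖E t‖ * Real.sin (φ t - φ x) / Real.pi : ℝ) : ℂ) := by
    have hpi' : (Real.pi : ℂ) ≠ 0 := ofReal_ne_zero.2 hpi
    rw [ofReal_sub, sub_mul_kernel_ofReal, hφ.kernelNum_eq]
    push_cast
    field_simp
  have hre := congrArg Complex.re hk
  rw [re_ofReal_mul, ofReal_re] at hre
  rw [mul_div_assoc', mul_left_comm, hre]
  field_simp

theorem IsPhase.hasDerivAt_sin_sub (hE : Differentiable ℂ E) (hr : NoRealZeros E)
    (hφ : IsPhase E φ) (x : ℝ) :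
    HasDerivAt (fun t => Real.sin (φ t - φ x)) (Real.pi * (kernel E x x).re / ‖E x‖ ^ 2) x := by
  have hc : ContinuousAt (fun t : ℝ => Real.pi * (kernel E x t).re / (‖E x‖ * ‖E t‖)) x := by
    have := (differentiable_kernel_ofReal hE x).continuous
    have := hE.continuous
    have := norm_ne_zero_iff.2 (hr x)
    fun_prop (disch := positivity)
  rw [hasDerivAt_iff_tendsto_slope, pow_two]
  refine (hc.tendsto.mono_left nhdsWithin_le_nhds).congr' ?_
  filter_upwards [self_mem_nhdsWithin] with t ht
  rw [slope_def_field, hφ.sin_sub_eq hr, sub_self, Real.sin_zero, sub_zero,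
    mul_div_cancel_left₀ _ (sub_ne_zero.2 ht)]

theorem IsPhase.hasDerivAt (hE : Differentiable ℂ E) (hr : NoRealZeros E) (hφ : IsPhase E φ)
    (x : ℝ) : HasDerivAt φ (Real.pi * (kernel E x x).re / ‖E x‖ ^ 2) x := by
  have harcsin : HasDerivAt Real.arcsin 1 (Real.sin (φ x - φ x)) := by
    simpa using Real.hasDerivAt_arcsin (x := 0) (by norm_num) (by norm_num)
  have hnear : ∀ᶠ t in 𝓝 x, φ t - φ x ∈ Ioo (-(Real.pi / 2)) (Real.pi / 2) :=
    (hφ.continuous.sub continuous_const).continuousAt.eventually_mem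
      (Ioo_mem_nhds (by simp [Real.pi_pos]) (by simp [Real.pi_pos]))
  have h := (harcsin.comp x (hφ.hasDerivAt_sin_sub hE hr x)).add_const (φ x)
  rw [one_mul] at h
  refine h.congr_of_eventuallyEq (hnear.mono fun t ht => ?_)
  simp only [Function.comp_apply]
  rw [Real.arcsin_sin ht.1.le ht.2.le, sub_add_cancel]

end Phase

/-! ### Growth estimates up to the real line -/

section Growth

variable {f : ℂ → ℂ} {m : ℕ}

theorem norm_sq_sub_sq_eq {z : ℂ} {ρ : ℝ} (hz : ‖z‖ = ρ) :
    ‖z ^ 2 - (ρ : ℂ) ^ 2‖ = 2 * ρ * |z.im| := by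
  have hconj : (ρ : ℂ) ^ 2 = z * conj z := by rw [mul_conj, normSq_eq_norm_sq, hz, ofReal_pow]
  rw [hconj, pow_two, ← mul_sub, sub_conj, norm_mul, hz, norm_mul, norm_real, norm_I, mul_one,
    Real.norm_eq_abs, abs_mul, abs_two]
  ring

theorem norm_mul_abs_im_pow_le {D : ℝ} {z : ℂ} (hz : z.im ≠ 0)
    (hf : z ∈ upper → ‖f z‖ * z.im ^ m ≤ D)
    (hfs : conj z ∈ upper → ‖star f (conj z)‖ * (conj z).im ^ m ≤ D) :
    ‖f z‖ * |z.im| ^ m ≤ D := by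
  rcases lt_or_gt_of_ne hz with hneg | hpos
  · rw [norm_star, conj_conj, conj_im] at hfs
    rw [abs_of_neg hneg]
    exact hfs (by simpa [upper] using hneg)
  · rw [abs_of_pos hpos]
    exact hf hpos

-- The factor `(z ^ 2 - ρ ^ 2) ^ m` has modulus `(2 * ρ * |im z|) ^ m` on the circle, where it
-- cancels the singularity of the bound at the real points.
theorem norm_le_of_norm_mul_im_pow_le (hf : Differentiable ℂ f) {ρ D : ℝ} (hρ : 0 < ρ)
    (hm : m ≠ 0) (hb : ∀ z ∈ upper, ‖z‖ = ρ → ‖f z‖ * z.im ^ m ≤ D)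
    (hbs : ∀ z ∈ upper, ‖z‖ = ρ → ‖star f z‖ * z.im ^ m ≤ D) {z : ℂ} (hz : ‖z‖ ≤ ρ / 2) :
    ‖f z‖ ≤ D * (8 / (3 * ρ)) ^ m := by
  have hD : 0 ≤ D := by
    have hmem : (ρ * I : ℂ) ∈ upper := by simpa [upper] using hρ
    refine le_trans ?_ (hb _ hmem (by simp [abs_of_pos hρ]))
    have := (show 0 < (ρ * I : ℂ).im from hmem).le
    positivity
  have hcircle : ∀ w : ℂ, ‖w‖ = ρ → ‖f w * (w ^ 2 - (ρ : ℂ) ^ 2) ^ m‖ ≤ D * (2 * ρ) ^ m := by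
    intro w hw
    rw [norm_mul, norm_pow, norm_sq_sub_sq_eq hw, mul_pow, mul_left_comm, mul_comm]
    gcongr
    by_cases him : w.im = 0
    · rwa [him, abs_zero, zero_pow hm, mul_zero]
    · exact norm_mul_abs_im_pow_le him (fun h => hb w h hw)
        fun h => hbs _ h (by rw [RCLike.norm_conj, hw])
  have hmax : ‖f z * (z ^ 2 - (ρ : ℂ) ^ 2) ^ m‖ ≤ D * (2 * ρ) ^ m := by
    have hd : Differentiable ℂ fun z => f z * (z ^ 2 - (ρ : ℂ) ^ 2) ^ m := by fun_prop
    refine Complex.norm_le_of_forall_mem_frontier_norm_le (U := Metric.ball 0 ρ)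
      Metric.isBounded_ball hd.diffContOnCl (fun w hw => hcircle w ?_)
      (subset_closure (by simpa using hz.trans_lt (half_lt_self hρ)))
    simpa [frontier_ball _ hρ.ne'] using hw
  have hlow : 3 * ρ ^ 2 / 4 ≤ ‖z ^ 2 - (ρ : ℂ) ^ 2‖ := by
    have := norm_sub_norm_le ((ρ : ℂ) ^ 2) (z ^ 2)
    rw [norm_pow, norm_pow, norm_real, Real.norm_of_nonneg hρ.le, norm_sub_rev] at this
    nlinarith [norm_nonneg z]
  calc ‖f z‖ ≤ D * (2 * ρ) ^ m / (3 * ρ ^ 2 / 4) ^ m := by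
        rw [le_div_iff₀ (by positivity)]
        refine le_trans ?_ hmax
        rw [norm_mul, norm_pow]
        gcongr
    _ = D * (8 / (3 * ρ)) ^ m := by
        rw [mul_div_assoc, ← div_pow]
        congr 2
        field_simp
        norm_num

theorem eq_const_of_norm_le_sqrt (hf : Differentiable ℂ f) {A : ℝ}
    (hb : ∀ R : ℝ, 1 ≤ R → ∀ z : ℂ, ‖z‖ ≤ R → ‖f z‖ ≤ A * √R) (z w : ℂ) : f z = f w := by
  refine is_const_of_deriv_eq_zero hf (fun w => ?_) z w
  have hle : ∀ R : ℝ, 1 ≤ R → ‖w‖ ≤ R → ‖deriv f w‖ ≤ A * √2 * (√R)⁻¹ := by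
    intro R hR hwR
    have hR0 : 0 < R := one_pos.trans_le hR
    refine (Complex.norm_deriv_le_of_forall_mem_sphere_norm_le hR0 hf.diffContOnCl
      fun ζ hζ => hb (2 * R) (by linarith) ζ ?_).trans_eq ?_
    · have := norm_add_le w (ζ - w)
      rw [add_sub_cancel, mem_sphere_iff_norm.1 hζ] at this
      linarith
    · rw [Real.sqrt_mul zero_le_two, ← mul_assoc, mul_div_assoc, Real.sqrt_div_self]
  have hlim : Tendsto (fun R : ℝ => A * √2 * (√R)⁻¹) atTop (𝓝 0) := by
    simpa using (tendsto_inv_atTop_zero.comp Real.tendsto_sqrt_atTop).const_mul (A * √2)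
  refine norm_le_zero_iff.1 (ge_of_tendsto hlim ?_)
  filter_upwards [eventually_ge_atTop 1, eventually_ge_atTop ‖w‖] with R hR hwR using hle R hR hwR

theorem eq_const_of_norm_mul_im_pow_le (hf : Differentiable ℂ f) (hm : m ≠ 0) {A : ℝ}
    (hb : ∀ z ∈ upper, 1 ≤ ‖z‖ → ‖f z‖ * z.im ^ m ≤ A * (‖z‖ ^ m * √‖z‖))
    (hbs : ∀ z ∈ upper, 1 ≤ ‖z‖ → ‖star f z‖ * z.im ^ m ≤ A * (‖z‖ ^ m * √‖z‖)) (z w : ℂ) :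
    f z = f w := by
  refine eq_const_of_norm_le_sqrt hf (A := A * (8 / 3) ^ m * √2) (fun R hR z hz => ?_) z w
  have hR0 : 0 < R := one_pos.trans_le hR
  have hone : ∀ w : ℂ, ‖w‖ = 2 * R → 1 ≤ ‖w‖ := fun w hw => by linarith
  refine (norm_le_of_norm_mul_im_pow_le hf (ρ := 2 * R) (mul_pos two_pos hR0) hm
    (fun w hw hwR => hwR ▸ hb w hw (hone w hwR)) (fun w hw hwR => hwR ▸ hbs w hw (hone w hwR))
    (by linarith)).trans_eq ?_
  have hcancel : (2 * R) ^ m * (8 / (3 * (2 * R))) ^ m = (8 / 3) ^ m := by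
    rw [← mul_pow]
    congr 1
    field_simp
  rw [← hcancel, Real.sqrt_mul zero_le_two]
  ring

end Growth

/-! ### The space as a closed subspace of `L²(ℝ)` -/

section Space

variable {E f g : ℂ → ℂ}

theorem star_add (f g : ℂ → ℂ) (z : ℂ) : star (f + g) z = star f z + star g z := by simp [star]

theorem star_smul (c : ℂ) (f : ℂ → ℂ) (z : ℂ) : star (c • f) z = conj c * star f z := by
  simp [star]

theorem MemHardy.add (hf : MemHardy E f) (hg : MemHardy E g) : MemHardy E (f + g) where
  entire := hf.entire.add hg.entire
  memLp := by
    simp only [Pi.add_apply, add_div]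
    exact hf.memLp.add hg.memLp
  bound := by
    obtain ⟨C, hC⟩ := hf.bound
    obtain ⟨D, hD⟩ := hg.bound
    refine ⟨C + D, fun z hz => ?_⟩
    rw [Pi.add_apply, add_div, add_div]
    exact (norm_add_le _ _).trans (add_le_add (hC z hz) (hD z hz))
  bound_star := by
    obtain ⟨C, hC⟩ := hf.bound_star
    obtain ⟨D, hD⟩ := hg.bound_star
    refine ⟨C + D, fun z hz => ?_⟩
    rw [star_add, add_div, add_div]
    exact (norm_add_le _ _).trans (add_le_add (hC z hz) (hD z hz))

theorem MemHardy.smul (hf : MemHardy E f) (c : ℂ) : MemHardy E (c • f) where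
  entire := hf.entire.const_smul c
  memLp := by
    simp only [Pi.smul_apply, smul_eq_mul, mul_div_assoc]
    exact hf.memLp.const_mul c
  bound := by
    obtain ⟨C, hC⟩ := hf.bound
    refine ⟨‖c‖ * C, fun z hz => ?_⟩
    rw [Pi.smul_apply, smul_eq_mul, mul_div_assoc, norm_mul, mul_div_assoc]
    exact mul_le_mul_of_nonneg_left (hC z hz) (norm_nonneg _)
  bound_star := by
    obtain ⟨C, hC⟩ := hf.bound_star
    refine ⟨‖c‖ * C, fun z hz => ?_⟩
    rw [star_smul, mul_div_assoc, norm_mul, mul_div_assoc, RCLike.norm_conj]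
    exact mul_le_mul_of_nonneg_left (hC z hz) (norm_nonneg _)

theorem memHardy_zero : MemHardy E 0 where
  entire := differentiable_const 0
  memLp := by simp
  bound := ⟨0, by simp⟩
  bound_star := ⟨0, by simp [star]⟩

/-- The vector space of all functions satisfying `MemHardy E`; it contains `H(E)`. -/
def hardySpace (E : ℂ → ℂ) : Submodule ℂ (ℂ → ℂ) where
  carrier := {f | MemHardy E f}
  add_mem' := MemHardy.add
  zero_mem' := memHardy_zero
  smul_mem' c _ hf := hf.smul c

/-- The embedding `f ↦ f / E` of the space into `L²(ℝ)`. -/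
noncomputable def toL2 (E : ℂ → ℂ) : hardySpace E →ₗ[ℂ] Lp ℂ 2 (volume : Measure ℝ) where
  toFun f := f.2.memLp.toLp
  map_add' f g := by
    rw [← MemLp.toLp_add]
    exact MemLp.toLp_congr _ _ (ae_of_all _ fun t => add_div _ _ _)
  map_smul' c f := by
    rw [RingHom.id_apply, ← MemLp.toLp_const_smul]
    exact MemLp.toLp_congr _ _ (ae_of_all _ fun t => mul_div_assoc _ _ _)

theorem coeFn_toL2 (f : hardySpace E) : toL2 E f =ᵐ[volume] fun t : ℝ => f.1 t / E t :=
  f.2.memLp.coeFn_toLp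

theorem inner_toL2 (f g : hardySpace E) :
    inner ℂ (toL2 E f) (toL2 E g) = ∫ t : ℝ, conj (f.1 t / E t) * (g.1 t / E t) := by
  rw [L2.inner_def]
  refine integral_congr_ae ?_
  filter_upwards [coeFn_toL2 f, coeFn_toL2 g] with t hft hgt
  rw [hft, hgt, RCLike.inner_apply, mul_comm]

theorem norm_toL2 (f : hardySpace E) : ‖toL2 E f‖ = norm E f := by
  have hsq : ‖toL2 E f‖ ^ 2 = normSq E f := by
    rw [← inner_self_eq_norm_sq (𝕜 := ℂ), inner_toL2, normSq, RCLike.re_eq_complex_re,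
      ← ofReal_re (∫ t : ℝ, ‖f.1 t / E t‖ ^ 2), ← integral_complex_ofReal]
    congr 2 with t
    rw [← normSq_eq_conj_mul_self, normSq_eq_norm_sq]
  rw [norm, ← hsq, Real.sqrt_sq (norm_nonneg _)]

theorem sq_norm (E f : ℂ → ℂ) : norm E f ^ 2 = normSq E f :=
  Real.sq_sqrt (integral_nonneg fun t => by positivity)

theorem MemHardy.norm_mul_sqrt_im_le (hE : HermiteBiehler E) (hr : NoRealZeros E)
    (hf : MemHardy E f) {z : ℂ} (hz : z ∈ upper) : ‖f z‖ * √z.im ≤ norm E f * ‖E z‖ := by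
  have hEz : 0 < ‖E z‖ := norm_pos_iff.2 (hE.ne_zero hr (upper_subset_closedUpper hz))
  have hy : 0 < z.im := hz
  have hbound := hf.norm_le hE hr hz
  rw [norm_div, div_le_div_iff₀ hEz (by positivity)] at hbound
  refine le_trans ?_ hbound
  gcongr
  exact le_mul_of_one_le_left hy.le (one_le_two.trans Real.two_le_pi)

theorem MemHardy.norm_star_mul_sqrt_im_le (hE : HermiteBiehler E) (hr : NoRealZeros E)
    (hf : MemHardy E f) {z : ℂ} (hz : z ∈ upper) :
    ‖DeBranges.star f z‖ * √z.im ≤ norm E f * ‖E z‖ := by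
  rw [← norm_star_eq]
  exact (hf.star hE.entire hr).norm_mul_sqrt_im_le hE hr hz

theorem norm_nonneg' (E f : ℂ → ℂ) : 0 ≤ norm E f := Real.sqrt_nonneg _

theorem exists_norm_le_mul_norm (hE : HermiteBiehler E) (hr : NoRealZeros E) {R : ℝ}
    (hR : 0 < R) : ∃ C : ℝ, ∀ f, MemHardy E f → ∀ z : ℂ, ‖z‖ ≤ R → ‖f z‖ ≤ C * norm E f := by
  obtain ⟨B, hB⟩ := (isCompact_closedBall (0 : ℂ) (2 * R)).exists_bound_of_continuousOn
    hE.entire.continuous.continuousOn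
  have hmul_im : ∀ {g : ℂ → ℂ} {N : ℝ} {z : ℂ}, z ∈ upper → ‖z‖ = 2 * R → 0 ≤ N →
      ‖g z‖ * √z.im ≤ N * ‖E z‖ → ‖g z‖ * z.im ^ 1 ≤ N * B * √(2 * R) := by
    intro g N z hz hzR hN hg
    have hBz : ‖E z‖ ≤ B := hB z (by simpa using hzR.le)
    have hsqrt : √z.im ≤ √(2 * R) :=
      Real.sqrt_le_sqrt (hzR ▸ (le_abs_self _).trans (abs_im_le_norm z))
    calc ‖g z‖ * z.im ^ 1 = ‖g z‖ * √z.im * √z.im := by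
          rw [pow_one, mul_assoc, Real.mul_self_sqrt (le_of_lt hz)]
      _ ≤ N * ‖E z‖ * √z.im := by gcongr
      _ ≤ N * B * √(2 * R) := by
          have := (norm_nonneg _).trans hBz
          gcongr
  refine ⟨B * √(2 * R) * (8 / (3 * (2 * R))) ^ 1, fun f hf z hz => ?_⟩
  refine (norm_le_of_norm_mul_im_pow_le hf.entire (mul_pos two_pos hR) one_ne_zero
    (fun w hw hwR => hmul_im hw hwR (norm_nonneg' E f) (hf.norm_mul_sqrt_im_le hE hr hw))
    (fun w hw hwR => hmul_im hw hwR (norm_nonneg' E f) (hf.norm_star_mul_sqrt_im_le hE hr hw))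
    (by linarith)).trans_eq ?_
  ring

theorem uniformCauchySeqOn_of_cauchySeq_toL2 (hE : HermiteBiehler E) (hr : NoRealZeros E)
    {F : ℕ → hardySpace E} (hF : CauchySeq fun n => toL2 E (F n)) {R : ℝ} (hR : 0 < R) :
    UniformCauchySeqOn (fun n => (F n).1) atTop (Metric.ball 0 R) := by
  obtain ⟨C, hC⟩ := exists_norm_le_mul_norm hE hr hR
  rw [Metric.uniformCauchySeqOn_iff]
  intro ε hε
  obtain ⟨N, hN⟩ := Metric.cauchySeq_iff.1 hF (ε / (|C| + 1)) (by positivity)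
  refine ⟨N, fun m hm n hn z hz => ?_⟩
  have hdist := hN m hm n hn
  rw [lt_div_iff₀ (by positivity), dist_eq_norm, ← map_sub, norm_toL2] at hdist
  calc dist ((F m).1 z) ((F n).1 z) = ‖(F m - F n).1 z‖ := dist_eq_norm _ _
    _ ≤ C * norm E (F m - F n).1 := hC _ (F m - F n).2 z (mem_ball_zero_iff.1 hz).le
    _ ≤ norm E (F m - F n).1 * (|C| + 1) := by
        nlinarith [le_abs_self C, norm_nonneg' E (F m - F n).1]
    _ < ε := hdist

theorem exists_entire_tendsto_of_cauchySeq_toL2 (hE : HermiteBiehler E) (hr : NoRealZeros E)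
    {F : ℕ → hardySpace E} (hF : CauchySeq fun n => toL2 E (F n)) :
    ∃ f : ℂ → ℂ, Differentiable ℂ f ∧ ∀ z, Tendsto (fun n => (F n).1 z) atTop (𝓝 (f z)) := by
  have hunif (z : ℂ) := uniformCauchySeqOn_of_cauchySeq_toL2 hE hr hF (R := ‖z‖ + 1) (by positivity)
  have hmem (z : ℂ) : z ∈ Metric.ball 0 (‖z‖ + 1) := by simp
  choose f hf using fun z => cauchySeq_tendsto_of_complete ((hunif z).cauchySeq (hmem z))
  refine ⟨f, fun z => ?_, hf⟩
  have hd := ((hunif z).tendstoUniformlyOn_of_tendsto fun w _ =>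
    hf w).tendstoLocallyUniformlyOn.differentiableOn
      (Eventually.of_forall fun n => (F n).2.entire.differentiableOn) Metric.isOpen_ball
  exact hd.differentiableAt (Metric.isOpen_ball.mem_nhds (hmem z))

theorem ae_eq_div_of_tendsto_toL2 {F : ℕ → hardySpace E} {G : Lp ℂ 2 (volume : Measure ℝ)}
    (hF : Tendsto (fun n => toL2 E (F n)) atTop (𝓝 G))
    (hf : ∀ t : ℝ, Tendsto (fun n => (F n).1 t) atTop (𝓝 (f t))) :
    G =ᵐ[volume] fun t : ℝ => f t / E t := by
  obtain ⟨ns, hns, hlim⟩ := (tendstoInMeasure_of_tendsto_Lp hF).exists_seq_tendsto_ae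
  filter_upwards [hlim, ae_all_iff.2 fun n => coeFn_toL2 (F n)] with t htlim htF
  simp only [htF] at htlim
  exact tendsto_nhds_unique htlim (((hf t).div_const _).comp hns.tendsto_atTop)

theorem memHardy_of_tendsto_toL2 (hE : HermiteBiehler E) (hr : NoRealZeros E)
    {F : ℕ → hardySpace E} {G : Lp ℂ 2 (volume : Measure ℝ)}
    (hF : Tendsto (fun n => toL2 E (F n)) atTop (𝓝 G)) (hd : Differentiable ℂ f)
    (hf : ∀ z, Tendsto (fun n => (F n).1 z) atTop (𝓝 (f z))) : MemHardy E f := by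
  have hnorm : Tendsto (fun n => norm E (F n)) atTop (𝓝 ‖G‖) := by
    simpa only [norm_toL2] using hF.norm
  have hstar (z : ℂ) : Tendsto (fun n => star (F n).1 z) atTop (𝓝 (star f z)) :=
    (continuous_conj.tendsto _).comp (hf (conj z))
  refine ⟨hd, (memLp_congr_ae (ae_eq_div_of_tendsto_toL2 hF fun t => hf t)).1 (Lp.memLp G),
    ⟨‖G‖ / √Real.pi, fun z hz => ?_⟩, ⟨‖G‖ / √Real.pi, fun z hz => ?_⟩⟩
  · rw [div_div, ← Real.sqrt_mul Real.pi_pos.le]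
    exact le_of_tendsto_of_tendsto' ((hf z).div_const _).norm (hnorm.div_const _)
      fun n => (F n).2.norm_le hE hr hz
  · rw [div_div, ← Real.sqrt_mul Real.pi_pos.le]
    exact le_of_tendsto_of_tendsto' ((hstar z).div_const _).norm (hnorm.div_const _)
      fun n => (F n).2.norm_star_le hE hr hz

theorem isClosed_range_toL2 (hE : HermiteBiehler E) (hr : NoRealZeros E) :
    IsClosed ((toL2 E).range : Set (Lp ℂ 2 (volume : Measure ℝ))) := by
  refine isClosed_of_closure_subset fun G hG => ?_
  obtain ⟨g, hg, hlim⟩ := mem_closure_iff_seq_limit.1 hG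
  choose F hF using hg
  obtain rfl : (fun n => toL2 E (F n)) = g := funext hF
  obtain ⟨f, hd, hf⟩ := exists_entire_tendsto_of_cauchySeq_toL2 hE hr hlim.cauchySeq
  let f' : hardySpace E := ⟨f, memHardy_of_tendsto_toL2 hE hr hlim hd hf⟩
  exact ⟨f', Lp.ext ((coeFn_toL2 f').trans (ae_eq_div_of_tendsto_toL2 hlim fun t => hf t).symm)⟩

end Space

/-! ### Companion functions -/

theorem exists_entire_mul_eq {f g : ℂ → ℂ} (hf : Differentiable ℂ f) (hg : Differentiable ℂ g)
    (hsimple : ∀ z, g z = 0 → deriv g z ≠ 0) (hfg : ∀ z, g z = 0 → f z = 0) :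
    ∃ h : ℂ → ℂ, Differentiable ℂ h ∧ ∀ z, f z = h z * g z := by
  classical
  refine ⟨fun z => if g z = 0 then deriv f z / deriv g z else f z / g z, fun x => ?_, fun z => ?_⟩
  · by_cases hx : g x = 0
    · have hdf := differentiableAt_dslope (hf.analyticAt x) (hf.analyticAt x)
      have hdg := differentiableAt_dslope (hg.analyticAt x) (hg.analyticAt x)
      have hne : dslope g x x ≠ 0 := by rw [dslope_same]; exact hsimple x hx
      refine (hdf.div hdg hne).congr_of_eventuallyEq ?_
      filter_upwards [hdg.continuousAt.eventually_ne hne] with z hz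
      rcases eq_or_ne z x with rfl | hzx
      · simp [hx]
      · have hslope_g := sub_smul_dslope g x z
        have hslope_f := sub_smul_dslope f x z
        rw [hx, sub_zero, smul_eq_mul] at hslope_g
        rw [hfg x hx, sub_zero, smul_eq_mul] at hslope_f
        have hsub := sub_ne_zero.2 hzx
        rw [if_neg (hslope_g ▸ mul_ne_zero hsub hz), ← hslope_g, ← hslope_f,
          mul_div_mul_left _ _ hsub, Pi.div_apply]
    · refine ((hf x).div (hg x) hx).congr_of_eventuallyEq ?_
      filter_upwards [(hg x).continuousAt.eventually_ne hx] with z hz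
      rw [if_neg hz, Pi.div_apply]
  · by_cases hz : g z = 0
    · simp [hz, hfg z hz]
    · simp [hz]

/-- The companion function `S_α = e^{iα} E - e^{-iα} E^*` of `E`. Its zeros are the real points at
which a phase function of `E` equals `α` modulo `π`. -/
noncomputable def companion (E : ℂ → ℂ) (α : ℝ) (z : ℂ) : ℂ :=
  exp (α * I) * E z - exp (-(α * I)) * star E z

section Companion

variable {E : ℂ → ℂ} {α : ℝ}

theorem conj_exp_mul_I (α : ℝ) : conj (exp (α * I)) = exp (-(α * I)) := by
  rw [← exp_conj]; simp

theorem norm_exp_neg_mul_I (α : ℝ) : ‖exp (-(α * I))‖ = 1 := by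
  rw [← conj_exp_mul_I, RCLike.norm_conj, norm_exp_ofReal_mul_I]

theorem two_mul_I_mul_sin_sub (α β : ℝ) :
    2 * I * Real.sin (α - β) = exp (α * I) * exp (-(β * I)) - exp (-(α * I)) * exp (β * I) := by
  have hsin := two_sin (α - β)
  have hneg : -((α : ℂ) - β) * I = -(α * I) + β * I := by ring
  have hpos : ((α : ℂ) - β) * I = α * I + -(β * I) := by ring
  rw [hneg, hpos, exp_add, exp_add] at hsin
  push_cast
  rw [mul_right_comm, hsin, mul_assoc, I_mul_I]
  ring

theorem differentiable_companion (hE : Differentiable ℂ E) (α : ℝ) :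
    Differentiable ℂ (companion E α) :=
  (hE.const_mul _).sub ((differentiable_star hE).const_mul _)

theorem star_companion (E : ℂ → ℂ) (α : ℝ) (z : ℂ) :
    star (companion E α) z = -companion E α z := by
  simp only [star, companion, map_sub, map_mul, conj_conj, ← conj_exp_mul_I]
  ring

theorem companion_ofReal {φ : ℝ → ℝ} (hφ : IsPhase E φ) (α x : ℝ) :
    companion E α x = 2 * I * Real.sin (α - φ x) * ‖E x‖ := by
  rw [companion, star_ofReal, hφ.conj_eq, two_mul_I_mul_sin_sub, mul_comm (φ x : ℂ)]
  nth_rw 1 [hφ.eq x]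
  ring

theorem companion_ofReal_eq_zero_iff {φ : ℝ → ℝ} (hr : NoRealZeros E) (hφ : IsPhase E φ)
    (α x : ℝ) : companion E α x = 0 ↔ ∃ n : ℤ, φ x = n * Real.pi + α := by
  have hx : (‖E x‖ : ℂ) ≠ 0 := ofReal_ne_zero.2 (norm_ne_zero_iff.2 (hr x))
  simp only [companion_ofReal hφ, mul_eq_zero, OfNat.ofNat_ne_zero, I_ne_zero, hx, or_self,
    false_or, or_false, ofReal_eq_zero]
  rw [← neg_eq_zero, ← Real.sin_neg, neg_sub, Real.sin_eq_zero_iff]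
  exact exists_congr fun n => eq_comm.trans sub_eq_iff_eq_add

theorem companion_ne_zero (hE : HermiteBiehler E) (α : ℝ) {z : ℂ} (hz : z.im ≠ 0) :
    companion E α z ≠ 0 := by
  intro hzero
  have hnorm := congrArg (‖·‖) (sub_eq_zero.1 hzero)
  simp only [norm_mul, norm_exp_ofReal_mul_I, norm_exp_neg_mul_I, one_mul, norm_star] at hnorm
  rcases lt_or_gt_of_ne hz with hneg | hpos
  · have hlt := hE.lt (conj z) (by simpa [upper] using hneg)
    rw [conj_conj] at hlt
    exact hlt.ne hnorm
  · exact (hE.lt z hpos).ne' hnorm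

theorem im_eq_zero_of_companion_eq_zero (hE : HermiteBiehler E) {z : ℂ}
    (hz : companion E α z = 0) : z.im = 0 :=
  not_imp_not.1 (companion_ne_zero hE α) hz

theorem exists_companion_eq_mul_kernel (hr : NoRealZeros E) {x : ℝ}
    (hx : companion E α x = 0) :
    ∃ c : ℂ, c ≠ 0 ∧ ∀ z, companion E α z = c * ((z - x) * kernel E x z) := by
  have hEx := hr x
  have hexp := exp_ne_zero (α * I)
  refine ⟨-(2 * Real.pi * I) / (exp (α * I) * E x),
    div_ne_zero (neg_ne_zero.2 two_pi_I_ne_zero) (mul_ne_zero hexp hEx), fun z => ?_⟩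
  rw [companion, star_ofReal, sub_eq_zero, exp_neg] at hx
  have hconj : conj (E x) = exp (α * I) * exp (α * I) * E x := by
    rw [mul_assoc, hx, mul_inv_cancel_left₀ hexp]
  rw [sub_mul_kernel_ofReal, kernelNum, conj_ofReal, companion, exp_neg, hconj]
  field_simp

theorem deriv_companion_ne_zero (hE : HermiteBiehler E) (hr : NoRealZeros E) {z : ℂ}
    (hz : companion E α z = 0) : deriv (companion E α) z ≠ 0 := by
  obtain ⟨x, rfl⟩ : ∃ x : ℝ, z = x :=
    ⟨z.re, Complex.ext rfl (im_eq_zero_of_companion_eq_zero hE hz)⟩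
  obtain ⟨c, hc, hck⟩ := exists_companion_eq_mul_kernel hr hz
  have hderiv : HasDerivAt (companion E α) (c * kernel E x x) x := by
    have hk := (differentiable_kernel_ofReal hE.entire x x).hasDerivAt
    rw [funext hck]
    simpa using (((hasDerivAt_id (x : ℂ)).sub_const (x : ℂ)).mul hk).const_mul c
  rw [hderiv.deriv]
  refine mul_ne_zero hc fun hzero => (hE.kernel_self_re_pos hr x).ne' ?_
  rw [hzero, zero_re]

theorem kernel_eq_zero_of_companion_eq_zero (hr : NoRealZeros E) {x y : ℝ} (hxy : y ≠ x)
    (hx : companion E α x = 0) (hy : companion E α y = 0) : kernel E x y = 0 := by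
  obtain ⟨c, hc, hck⟩ := exists_companion_eq_mul_kernel hr hx
  rw [hck y] at hy
  exact (mul_eq_zero.1 ((mul_eq_zero.1 hy).resolve_left hc)).resolve_left
    (sub_ne_zero.2 (ofReal_injective.ne hxy))

theorem re_add_div_sub_nonneg {a b : ℂ} (h : ‖b‖ ≤ ‖a‖) : 0 ≤ ((a + b) / (a - b)).re := by
  have hsq : Complex.normSq b ≤ Complex.normSq a := by
    rw [normSq_eq_norm_sq, normSq_eq_norm_sq]
    gcongr
  rw [div_re, ← add_div]
  refine div_nonneg ?_ (normSq_nonneg _)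
  rw [normSq_apply, normSq_apply] at hsq
  simp only [add_re, sub_re, add_im, sub_im]
  nlinarith

theorem exists_norm_le_mul_norm_companion (hE : HermiteBiehler E) (α : ℝ) :
    ∃ C, 0 ≤ C ∧ ∀ z ∈ upper, ‖E z‖ ≤ C * harnackWeight z * ‖companion E α z‖ := by
  set a : ℂ → ℂ := fun z => exp (α * I) * E z
  set b : ℂ → ℂ := fun z => exp (-(α * I)) * star E z
  have hnorm_a (z : ℂ) : ‖a z‖ = ‖E z‖ := by
    rw [norm_mul, norm_exp_ofReal_mul_I, one_mul]
  have hda : Differentiable ℂ a := hE.entire.const_mul _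
  have hdb : Differentiable ℂ b := (differentiable_star hE.entire).const_mul _
  have hS : ∀ z ∈ upper, companion E α z ≠ 0 := fun z hz => companion_ne_zero hE α (ne_of_gt hz)
  obtain ⟨C, hC⟩ := exists_norm_le_harnackWeight_of_re_nonneg
    (W := fun z => (a z + b z) / companion E α z)
    ((hda.add hdb).differentiableOn.div (differentiable_companion hE.entire α).differentiableOn hS)
    fun z hz => re_add_div_sub_nonneg <| by
      rw [hnorm_a, norm_mul, norm_exp_neg_mul_I, one_mul, norm_star]
      exact (hE.lt z hz).le
  refine ⟨1 + |C|, by positivity, fun z hz => ?_⟩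
  have hsum : ‖a z + b z‖ ≤ |C| * harnackWeight z * ‖companion E α z‖ := by
    have hCz := hC z hz
    rw [norm_div, div_le_iff₀ (norm_pos_iff.2 (hS z hz))] at hCz
    refine hCz.trans ?_
    have := harnackWeight_nonneg hz
    gcongr
    exact le_abs_self C
  have hone : ‖companion E α z‖ ≤ harnackWeight z * ‖companion E α z‖ :=
    le_mul_of_one_le_left (norm_nonneg _) (one_le_harnackWeight hz)
  have htwo : a z + b z + companion E α z = 2 * a z := by rw [companion]; ring
  calc ‖E z‖ = ‖a z‖ := (hnorm_a z).symm
    _ = ‖a z + b z + companion E α z‖ / 2 := by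
        rw [htwo, norm_mul 2, norm_ofNat, mul_div_cancel_left₀ _ two_ne_zero]
    _ ≤ (‖a z + b z‖ + ‖companion E α z‖) / 2 := by gcongr; exact norm_add_le _ _
    _ ≤ ‖a z + b z‖ + ‖companion E α z‖ := half_le_self (by positivity)
    _ ≤ (1 + |C|) * harnackWeight z * ‖companion E α z‖ := by linarith

theorem exists_norm_mul_im_sq_le (hE : HermiteBiehler E) (hr : NoRealZeros E) (α : ℝ) :
    ∃ D, ∀ f, MemHardy E f → ∀ z ∈ upper, 1 ≤ ‖z‖ → ∀ q : ℂ,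
      ‖f z‖ = ‖q‖ * ‖companion E α z‖ → ‖q‖ * z.im ^ 2 ≤ D * norm E f * (‖z‖ ^ 2 * √‖z‖) := by
  obtain ⟨C, hC0, hC⟩ := exists_norm_le_mul_norm_companion hE α
  refine ⟨2 * C, fun f hf z hz hz1 q hq => ?_⟩
  have hy : 0 < z.im := hz
  have hN := norm_nonneg' E f
  have hS : 0 < ‖companion E α z‖ := norm_pos_iff.2 (companion_ne_zero hE α hy.ne')
  have hq_le : ‖q‖ * √z.im ≤ norm E f * (C * harnackWeight z) := by
    refine le_of_mul_le_mul_right ?_ hS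
    calc ‖q‖ * √z.im * ‖companion E α z‖ = ‖f z‖ * √z.im := by rw [hq]; ring
      _ ≤ norm E f * ‖E z‖ := hf.norm_mul_sqrt_im_le hE hr hz
      _ ≤ norm E f * (C * harnackWeight z * ‖companion E α z‖) := by gcongr; exact hC z hz
      _ = _ := by ring
  have him : z.im ≤ ‖z‖ := (le_abs_self _).trans (abs_im_le_norm z)
  calc ‖q‖ * z.im ^ 2 = ‖q‖ * √z.im * (√z.im * z.im) := by
        rw [mul_assoc, ← mul_assoc √z.im, Real.mul_self_sqrt hy.le, pow_two]
    _ ≤ norm E f * (C * harnackWeight z) * (√z.im * z.im) := by gcongr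
    _ = C * norm E f * ((1 + ‖z‖ ^ 2) * √z.im) := by rw [harnackWeight]; field_simp
    _ ≤ C * norm E f * ((2 * ‖z‖ ^ 2) * √‖z‖) := by gcongr; nlinarith
    _ = _ := by ring

/-- The quotient of `f` by the companion function is entire and grows at most like `√‖z‖`. -/
theorem MemHardy.exists_eq_smul_companion (hE : HermiteBiehler E) (hr : NoRealZeros E)
    {f : ℂ → ℂ} (hf : MemHardy E f) (hzero : ∀ x : ℝ, companion E α x = 0 → f x = 0) :
    ∃ c : ℂ, f = c • companion E α := by
  obtain ⟨h, hh, hfh⟩ := exists_entire_mul_eq hf.entire (differentiable_companion hE.entire α)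
    (fun z hz => deriv_companion_ne_zero hE hr hz) fun z hz => by
      obtain ⟨x, rfl⟩ : ∃ x : ℝ, z = x :=
        ⟨z.re, Complex.ext rfl (im_eq_zero_of_companion_eq_zero hE hz)⟩
      exact hzero x hz
  obtain ⟨D, hD⟩ := exists_norm_mul_im_sq_le hE hr α
  refine ⟨h 0, funext fun z => ?_⟩
  rw [hfh z, Pi.smul_apply, smul_eq_mul]
  congr 1
  refine eq_const_of_norm_mul_im_pow_le hh two_ne_zero (A := D * norm E f)
    (fun z hz hz1 => hD f hf z hz hz1 (h z) (by rw [hfh, norm_mul])) (fun z hz hz1 => ?_) z 0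
  rw [← norm_star_eq]
  refine hD _ (hf.star hE.entire hr) z hz hz1 _ ?_
  rw [← norm_neg (companion E α z), ← star_companion, ← norm_mul]
  simp only [DeBranges.star, hfh, map_mul]

theorem exp_mul_companion_sub (E : ℂ → ℂ) (α β : ℝ) (z : ℂ) :
    exp (-(β * I)) * companion E α z - exp (-(α * I)) * companion E β z =
      2 * I * Real.sin (α - β) * E z := by
  rw [two_mul_I_mul_sin_sub, companion, companion]
  ring

theorem companion_eq_smul_of_sin_sub_eq_zero (E : ℂ → ℂ) {β : ℝ} (h : Real.sin (α - β) = 0) :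
    companion E β = (exp (α * I) * exp (-(β * I))) • companion E α := by
  funext z
  have hsub := exp_mul_companion_sub E α β z
  rw [h, ofReal_zero, mul_zero, zero_mul, sub_eq_zero] at hsub
  rw [Pi.smul_apply, smul_eq_mul, mul_assoc, hsub, exp_neg, mul_inv_cancel_left₀ (exp_ne_zero _)]

theorem sin_sub_eq_zero_of_memHardy_companion (hr : NoRealZeros E) {β : ℝ}
    (hα : MemHardy E (companion E α)) (hβ : MemHardy E (companion E β)) :
    Real.sin (α - β) = 0 := by
  have hmem := (hα.memLp.const_mul (exp (-(β * I)))).sub (hβ.memLp.const_mul (exp (-(α * I))))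
  have hconst : ((fun t : ℝ => exp (-(β * I)) * (companion E α t / E t)) -
      fun t : ℝ => exp (-(α * I)) * (companion E β t / E t)) =
      fun _ : ℝ => 2 * I * Real.sin (α - β) := by
    funext t
    rw [Pi.sub_apply, ← mul_div_assoc, ← mul_div_assoc, ← sub_div, exp_mul_companion_sub,
      mul_div_cancel_right₀ _ (hr t)]
  rw [hconst, memLp_const_iff (by simp) (by simp)] at hmem
  simpa [-ofReal_sin] using hmem

theorem exists_forall_smul_companion_mem_span (hr : NoRealZeros E) :
    ∃ s ∈ hardySpace E, (s = 0 ∨ ∃ α, s = companion E α) ∧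
      ∀ (α : ℝ) (c : ℂ), MemHardy E (c • companion E α) → c • companion E α ∈ ℂ ∙ s := by
  have hcompanion {α : ℝ} {c : ℂ} (hc : c ≠ 0) (h : MemHardy E (c • companion E α)) :
      MemHardy E (companion E α) := by
    simpa only [inv_smul_smul₀ hc] using h.smul c⁻¹
  by_cases hex : ∃ α, MemHardy E (companion E α)
  · obtain ⟨α, hα⟩ := hex
    refine ⟨companion E α, hα, Or.inr ⟨α, rfl⟩, fun β c hβ => ?_⟩
    rcases eq_or_ne c 0 with rfl | hc
    · rw [zero_smul]; exact Submodule.zero_mem _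
    rw [companion_eq_smul_of_sin_sub_eq_zero E
      (sin_sub_eq_zero_of_memHardy_companion hr hα (hcompanion hc hβ))]
    exact Submodule.smul_mem _ _ (Submodule.smul_mem _ _ (Submodule.mem_span_singleton_self _))
  · refine ⟨0, Submodule.zero_mem _, Or.inl rfl, fun α c h => ?_⟩
    rcases eq_or_ne c 0 with rfl | hc
    · rw [zero_smul]; exact Submodule.zero_mem _
    · exact absurd ⟨α, hcompanion hc h⟩ hex

end Companion

section Product

variable {E F f : ℂ → ℂ} {α : ℝ}

theorem MemHardy.mul_right (hF : HermiteBiehler F) (hFr : NoRealZeros F)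
    (hf : MemHardy E f) : MemHardy (fun z => E z * F z) (fun z => f z * F z) where
  entire := hf.entire.mul hF.entire
  memLp := by
    simp only [mul_div_mul_right _ _ (hFr _)]
    exact hf.memLp
  bound := by
    obtain ⟨C, hC⟩ := hf.bound
    refine ⟨C, fun z hz => ?_⟩
    rw [mul_div_mul_right _ _ (hF.ne_zero hFr (upper_subset_closedUpper hz))]
    exact hC z hz
  bound_star := by
    obtain ⟨C, hC⟩ := hf.bound_star
    refine ⟨C, fun z hz => ?_⟩
    rw [star_mul, mul_div_mul_comm, norm_mul]
    exact (mul_le_of_le_one_right (norm_nonneg _)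
      (hF.norm_star_div_le (upper_subset_closedUpper hz))).trans (hC z hz)

theorem toL2_mul_right (hF : HermiteBiehler F) (hFr : NoRealZeros F) (f : hardySpace E) :
    toL2 (fun z => E z * F z) ⟨fun z => f.1 z * F z, f.2.mul_right hF hFr⟩ = toL2 E f := by
  refine Lp.ext ?_
  filter_upwards [coeFn_toL2 f, coeFn_toL2 ⟨_, f.2.mul_right hF hFr⟩] with t ht htF
  rw [ht, htF, mul_div_mul_right _ _ (hFr t)]

theorem toL2_injective (hE : HermiteBiehler E) (hr : NoRealZeros E) :
    Function.Injective (toL2 E) := by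
  refine (injective_iff_map_eq_zero _).2 fun f hf => Subtype.ext ?_
  refine eq_zero_of_normSq_eq_zero hE.entire hr f.2.entire
    ((memLp_two_iff_integrable_sq_norm f.2.memLp.1).1 f.2.memLp) ?_
  rw [← sq_norm, ← norm_toL2, hf, norm_zero, zero_pow two_ne_zero]

/-- If `S_α = g F`, dividing the identity `-S_α = g^* F^*` by `E F^*` expresses `F / F^*` through
the bounded functions `E^* / E` and `g^* / E`. -/
theorem norm_div_star_le_of_companion_eq_mul (hE : HermiteBiehler E) (hEr : NoRealZeros E)
    {g : ℂ → ℂ} (hg : companion (fun z => E z * F z) α = fun z => g z * F z) {z : ℂ}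
    (hz : z ∈ upper) (hFz : star F z ≠ 0) :
    ‖F z / star F z‖ ≤ ‖star g z / E z‖ + 1 := by
  have hEz := hE.ne_zero hEr (upper_subset_closedUpper hz)
  have hstar : star g z * star F z = -companion (fun z => E z * F z) α z := by
    rw [← star_companion, hg, star_mul]
  rw [companion, star_mul] at hstar
  have hquot : exp (α * I) * (F z / star F z) =
      exp (-(α * I)) * (star E z / E z) - star g z / E z := by
    field_simp
    linear_combination hstar
  calc ‖F z / star F z‖ = ‖exp (-(α * I)) * (star E z / E z) - star g z / E z‖ := by
        rw [← hquot, norm_mul, norm_exp_ofReal_mul_I, one_mul]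
    _ ≤ ‖exp (-(α * I)) * (star E z / E z)‖ + ‖star g z / E z‖ := norm_sub_le _ _
    _ ≤ 1 + ‖star g z / E z‖ := by
        rw [norm_mul, norm_exp_neg_mul_I, one_mul]
        gcongr
        exact hE.norm_star_div_le (upper_subset_closedUpper hz)
    _ = _ := add_comm _ _

theorem exists_star_eq_zero_of_norm_div_star_le (hF : HermiteBiehler F) {C : ℝ}
    (hC : ∀ z ∈ upper, ‖F z / star F z‖ ≤ C / √z.im + 1) : ∃ z, star F z = 0 := by
  by_contra! hF0
  set W : ℂ → ℂ := fun z => F z / star F z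
  have hW : Differentiable ℂ W := hF.entire.div (differentiable_star hF.entire) hF0
  have hstarW (z : ℂ) : star W z = star F z / F z := by simp [W, star]
  have hgrowth {z : ℂ} (hz1 : 1 ≤ ‖z‖) : ‖z‖ ≤ ‖z‖ * √‖z‖ ∧ √‖z‖ ≤ ‖z‖ * √‖z‖ :=
    ⟨le_mul_of_one_le_right (norm_nonneg _) (Real.one_le_sqrt.2 hz1),
      le_mul_of_one_le_left (Real.sqrt_nonneg _) hz1⟩
  have him (z : ℂ) : z.im ≤ ‖z‖ := (le_abs_self _).trans (abs_im_le_norm z)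
  have hconst := eq_const_of_norm_mul_im_pow_le hW one_ne_zero (A := |C| + 1)
    (fun z hz hz1 => ?_) (fun z hz hz1 => ?_) 0 I
  · have hlt := hF.norm_star_div_lt (z := I) (by simp [upper])
    have hinv : ‖W I‖ = ‖star F I / F I‖⁻¹ := by rw [← norm_inv, inv_div]
    have hW0 : ‖W 0‖ = 1 := by
      have h0 : ‖star F 0‖ = ‖F 0‖ := by rw [norm_star, map_zero]
      rw [norm_div, h0, div_self (h0 ▸ norm_ne_zero_iff.2 (hF0 0))]
    rw [hconst, hinv, inv_eq_one] at hW0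
    exact hlt.ne hW0
  · have hy : 0 < z.im := hz
    rw [pow_one, pow_one]
    calc ‖W z‖ * z.im ≤ (|C| / √z.im + 1) * z.im := by
          gcongr; exact (hC z hz).trans (by gcongr; exact le_abs_self C)
      _ = |C| * √z.im + z.im := by rw [add_mul, one_mul, div_mul_eq_mul_div, mul_div_assoc,
          Real.div_sqrt]
      _ ≤ |C| * √‖z‖ + ‖z‖ := by gcongr <;> exact him z
      _ ≤ |C| * (‖z‖ * √‖z‖) + ‖z‖ * √‖z‖ := by
          gcongr; exacts [(hgrowth hz1).2, (hgrowth hz1).1]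
      _ = _ := by ring
  · have hy : 0 < z.im := hz
    rw [pow_one, pow_one, hstarW]
    calc ‖star F z / F z‖ * z.im ≤ 1 * z.im := by
          gcongr; exact (hF.norm_star_div_lt hz).le
      _ ≤ 1 * (‖z‖ * √‖z‖) := by gcongr; exact (him z).trans (hgrowth hz1).1
      _ ≤ (|C| + 1) * (‖z‖ * √‖z‖) := by gcongr; linarith [abs_nonneg C]

theorem companion_mul_ne_mul (hE : HermiteBiehler E) (hF : HermiteBiehler F)
    (hEr : NoRealZeros E) (hFr : NoRealZeros F) {g : ℂ → ℂ} (hg : MemHardy E g) :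
    companion (fun z => E z * F z) α ≠ fun z => g z * F z := by
  intro hSg
  have hF0 (z : ℂ) : F z ≠ 0 := fun hz => by
    have hS : companion (fun z => E z * F z) α z = 0 := by rw [hSg]; simp [hz]
    obtain ⟨x, rfl⟩ : ∃ x : ℝ, z = x :=
      ⟨z.re, Complex.ext rfl (im_eq_zero_of_companion_eq_zero (hE.mul hF) hS)⟩
    exact hFr x hz
  have hstarF (z : ℂ) : star F z ≠ 0 := fun hz => hF0 (conj z) (by simpa [star] using hz)
  obtain ⟨C, hC⟩ := hg.bound_star
  obtain ⟨z, hz⟩ := exists_star_eq_zero_of_norm_div_star_le hF (C := C) fun z hz =>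
    (norm_div_star_le_of_companion_eq_mul hE hEr hSg hz (hstarF z)).trans (by gcongr; exact hC z hz)
  exact hstarF z hz

theorem toL2_companion_mul_notMem_range (hE : HermiteBiehler E) (hF : HermiteBiehler F)
    (hEr : NoRealZeros E) (hFr : NoRealZeros F)
    (hS : MemHardy (fun z => E z * F z) (companion (fun z => E z * F z) α)) :
    toL2 (fun z => E z * F z) ⟨_, hS⟩ ∉ (toL2 E).range := by
  rintro ⟨g, hg⟩
  rw [← toL2_mul_right hF hFr] at hg
  exact companion_mul_ne_mul hE hF hEr hFr g.2
    (congrArg Subtype.val (toL2_injective (hE.mul hF) (hEr.mul hFr) hg)).symm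

end Product

/-! ### Orthonormal expansions in a Hilbert space -/

section Hilbert

variable {𝕜 H ι : Type*} [RCLike 𝕜] [NormedAddCommGroup H] [InnerProductSpace 𝕜 H]

theorem tsum_norm_sq_inner_eq_norm_sq_starProjection [CompleteSpace H] {e : ι → H}
    (he : Orthonormal 𝕜 e) (v : H) :
    ∑' i, ‖inner 𝕜 (e i) v‖ ^ 2 =
      ‖(Submodule.span 𝕜 (range e)).topologicalClosure.starProjection v‖ ^ 2 := by
  set U := (Submodule.span 𝕜 (range e)).topologicalClosure
  have heU (i : ι) : e i ∈ U :=
    Submodule.le_topologicalClosure _ (Submodule.subset_span (mem_range_self i))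
  have hdense : (Submodule.span 𝕜 (range fun i => (⟨e i, heU i⟩ : U)))ᗮ = ⊥ := by
    refine (Submodule.eq_bot_iff _).2 fun u hu => ?_
    have hspan : Submodule.span 𝕜 (range e) ≤ (𝕜 ∙ (u : H))ᗮ := by
      rw [Submodule.span_le]
      rintro _ ⟨i, rfl⟩
      exact Submodule.mem_orthogonal_singleton_iff_inner_left.2
        (hu ⟨e i, heU i⟩ (Submodule.subset_span (mem_range_self i)))
    have huu := Submodule.topologicalClosure_minimal _ hspan (Submodule.isClosed_orthogonal _) u.2
    exact Subtype.ext
      (inner_self_eq_zero.1 (Submodule.mem_orthogonal_singleton_iff_inner_left.1 huu))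
  let b : HilbertBasis ι 𝕜 U := .mkOfOrthogonalEqBot (he.codRestrict U heU) hdense
  have hb (i : ι) : inner 𝕜 (b i) (U.orthogonalProjectionOnto v) = inner 𝕜 (e i) v := by
    rw [U.inner_orthogonalProjectionOnto_eq_of_mem_left,
      HilbertBasis.coe_mkOfOrthogonalEqBot (he.codRestrict U heU) hdense, val_codRestrict_apply]
  have hparseval := b.hasSum_inner_mul_inner (U.orthogonalProjectionOnto v)
    (U.orthogonalProjectionOnto v)
  simp only [← inner_conj_symm (U.orthogonalProjectionOnto v) (b _), RCLike.conj_mul, hb,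
    inner_self_eq_norm_sq_to_K] at hparseval
  exact (RCLike.hasSum_ofReal 𝕜 |>.1 (mod_cast hparseval)).tsum_eq

theorem exists_mul_norm_sq_le_norm_sq_starProjection {W : Submodule 𝕜 H}
    [W.HasOrthogonalProjection] {s : H} (hs : s ∈ W → s = 0) :
    ∃ δ : ℝ, 0 < δ ∧ ∀ (U : Submodule 𝕜 H) [U.HasOrthogonalProjection], ∀ v ∈ W,
      v - U.starProjection v ∈ 𝕜 ∙ s → δ * ‖v‖ ^ 2 ≤ ‖U.starProjection v‖ ^ 2 := by
  set θ := ‖W.starProjection s‖ / ‖s‖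
  have hθ0 : 0 ≤ θ := by positivity
  obtain ⟨hθ1, hθs⟩ : θ < 1 ∧ ‖W.starProjection s‖ = θ * ‖s‖ := by
    rcases eq_or_ne s 0 with rfl | hs0
    · simp [θ]
    · have hpos := norm_pos_iff.2 hs0
      refine ⟨(div_lt_one hpos).2 ?_, (div_mul_cancel₀ _ hpos.ne').symm⟩
      exact (W.norm_starProjection_apply_le s).lt_of_ne fun h =>
        hs0 (hs (W.mem_iff_norm_starProjection s |>.2 h))
  refine ⟨1 - θ ^ 2, by nlinarith, fun U _ v hv hspan => ?_⟩
  obtain ⟨c, hc⟩ := Submodule.mem_span_singleton.1 hspan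
  set r := v - U.starProjection v
  have hrv : inner 𝕜 r v = inner 𝕜 r r := by
    rw [inner_sub_right, Submodule.inner_left_of_mem_orthogonal (U.starProjection_apply_mem v)
      (U.sub_starProjection_mem_orthogonal v), sub_zero]
  have hr : ‖r‖ * ‖r‖ ≤ ‖r‖ * (θ * ‖v‖) :=
    calc ‖r‖ * ‖r‖ = ‖inner 𝕜 r v‖ := by
          rw [hrv, inner_self_eq_norm_sq_to_K, norm_pow, norm_algebraMap', norm_norm, pow_two]
      _ = ‖inner 𝕜 (W.starProjection r) v‖ := by
          rw [W.inner_starProjection_left_eq_right, W.starProjection_eq_self_iff.2 hv]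
      _ ≤ ‖W.starProjection r‖ * ‖v‖ := norm_inner_le_norm _ _
      _ = ‖r‖ * (θ * ‖v‖) := by rw [← hc, map_smul, norm_smul, norm_smul, hθs]; ring
  have hr' : ‖r‖ ≤ θ * ‖v‖ := by
    rcases (norm_nonneg r).eq_or_lt with h | h
    · rw [← h]; positivity
    · exact le_of_mul_le_mul_left hr h
  have hpyth : ‖v‖ ^ 2 = ‖U.starProjection v‖ ^ 2 + ‖r‖ ^ 2 := by
    rw [U.norm_sq_eq_add_norm_sq_starProjection v, U.starProjection_orthogonal_val]
  have := pow_le_pow_left₀ (norm_nonneg r) hr' 2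
  linarith

end Hilbert

/-! ### Sampling at the zeros of a companion function -/

section Sampling

variable {E F : ℂ → ℂ} {α : ℝ} {ι : Type*} {lam : ι → ℝ}

theorem HermiteBiehler.memHardy_kernel (hE : HermiteBiehler E) (hr : NoRealZeros E) (x : ℝ) :
    MemHardy E (kernel E x) :=
  (hE.memSpace_kernel hr x).memHardy hE hr

theorem inner_toL2_kernel (hE : HermiteBiehler E) (hr : NoRealZeros E) (x : ℝ)
    (f : hardySpace E) :
    inner ℂ (toL2 E ⟨kernel E x, hE.memHardy_kernel hr x⟩) (toL2 E f) = f.1 x := by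
  rw [inner_toL2, f.2.integral_conj_kernel_mul hE hr]

theorem HermiteBiehler.norm_kernel_pos (hE : HermiteBiehler E) (hr : NoRealZeros E) (x : ℝ) :
    0 < norm E (kernel E x) := by
  rw [norm, ← hE.kernel_self_re hr]
  exact Real.sqrt_pos.2 (hE.kernel_self_re_pos hr x)

/-- The reproducing kernel at the real point `x`, normalized to have norm one and viewed in
`L²(ℝ)`. -/
noncomputable def unitKernel (hE : HermiteBiehler E) (hr : NoRealZeros E) (x : ℝ) :
    Lp ℂ 2 (volume : Measure ℝ) :=
  (norm E (kernel E x) : ℂ)⁻¹ • toL2 E ⟨kernel E x, hE.memHardy_kernel hr x⟩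

theorem unitKernel_mem_range (hE : HermiteBiehler E) (hr : NoRealZeros E) (x : ℝ) :
    unitKernel hE hr x ∈ (toL2 E).range :=
  Submodule.smul_mem _ _ (LinearMap.mem_range_self _ _)

theorem inner_unitKernel (hE : HermiteBiehler E) (hr : NoRealZeros E) (x : ℝ)
    (f : hardySpace E) :
    inner ℂ (unitKernel hE hr x) (toL2 E f) = (norm E (kernel E x) : ℂ)⁻¹ * f.1 x := by
  rw [unitKernel, inner_smul_left, inner_toL2_kernel hE hr, map_inv₀, conj_ofReal]

theorem norm_inner_unitKernel_sq (hE : HermiteBiehler E) (hr : NoRealZeros E) (x : ℝ)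
    (f : hardySpace E) :
    ‖inner ℂ (unitKernel hE hr x) (toL2 E f)‖ ^ 2 = ‖f.1 x‖ ^ 2 / (kernel E x x).re := by
  rw [inner_unitKernel, norm_mul, norm_inv, norm_real, mul_pow, inv_pow, Real.norm_eq_abs, sq_abs,
    sq_norm, hE.kernel_self_re hr, div_eq_inv_mul]

theorem norm_unitKernel (hE : HermiteBiehler E) (hr : NoRealZeros E) (x : ℝ) :
    ‖unitKernel hE hr x‖ = 1 := by
  have hpos := hE.norm_kernel_pos hr x
  rw [unitKernel, norm_smul, norm_toL2, norm_inv, norm_real, Real.norm_of_nonneg hpos.le,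
    inv_mul_cancel₀ hpos.ne']

theorem orthonormal_unitKernel (hE : HermiteBiehler E) (hr : NoRealZeros E)
    (hinj : Function.Injective lam) (hlam : ∀ i, companion E α (lam i) = 0) :
    Orthonormal ℂ fun i => unitKernel hE hr (lam i) := by
  refine ⟨fun i => norm_unitKernel hE hr _, fun i j hij => ?_⟩
  have hzero := kernel_eq_zero_of_companion_eq_zero hr (hinj.ne hij) (hlam j) (hlam i)
  simp only [unitKernel, inner_smul_left, inner_smul_right, inner_toL2_kernel hE hr, hzero,
    mul_zero]

theorem exists_sub_starProjection_eq_smul_companion (hE : HermiteBiehler E) (hr : NoRealZeros E)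
    (hlam : ∀ x : ℝ, companion E α x = 0 → x ∈ range lam) (f : hardySpace E) :
    ∃ (c : ℂ) (h : MemHardy E (c • companion E α)), toL2 E f -
      (Submodule.span ℂ (range fun i => unitKernel hE hr (lam i))).topologicalClosure.starProjection
        (toL2 E f) = toL2 E ⟨_, h⟩ := by
  set U := (Submodule.span ℂ (range fun i => unitKernel hE hr (lam i))).topologicalClosure
  have hspan : Submodule.span ℂ (range fun i => unitKernel hE hr (lam i)) ≤ (toL2 E).range := by
    rw [Submodule.span_le]
    rintro _ ⟨i, rfl⟩
    exact unitKernel_mem_range hE hr _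
  have hU : U ≤ (toL2 E).range :=
    Submodule.topologicalClosure_minimal _ hspan (isClosed_range_toL2 hE hr)
  obtain ⟨g, hg⟩ : toL2 E f - U.starProjection (toL2 E f) ∈ (toL2 E).range :=
    Submodule.sub_mem _ (LinearMap.mem_range_self _ f) (hU (U.starProjection_apply_mem _))
  obtain ⟨c, hc⟩ := g.2.exists_eq_smul_companion hE hr (α := α) fun x hx => by
    obtain ⟨i, rfl⟩ := hlam x hx
    have horth : inner ℂ (unitKernel hE hr (lam i)) (toL2 E g) = 0 := by
      rw [hg]
      exact U.sub_starProjection_mem_orthogonal _ _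
        (Submodule.le_topologicalClosure _ (Submodule.subset_span (mem_range_self i)))
    rw [inner_unitKernel] at horth
    exact (mul_eq_zero.1 horth).resolve_left
      (inv_ne_zero (ofReal_ne_zero.2 (hE.norm_kernel_pos hr _).ne'))
  exact ⟨c, hc ▸ g.2, by rw [← hg]; congr 1; exact Subtype.ext hc⟩

theorem exists_mul_norm_sq_le_tsum_mul (hE : HermiteBiehler E) (hF : HermiteBiehler F)
    (hEr : NoRealZeros E) (hFr : NoRealZeros F) :
    ∃ δ : ℝ, 0 < δ ∧ ∀ {ι : Type*} {α : ℝ} {lam : ι → ℝ}, Function.Injective lam →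
      (∀ x : ℝ, companion (fun z => E z * F z) α x = 0 ↔ x ∈ range lam) →
      ∀ f, MemHardy E f → δ * norm E f ^ 2 ≤ ∑' n, ‖f (lam n) * F (lam n)‖ ^ 2 /
        (kernel (fun z => E z * F z) (lam n) (lam n)).re := by
  have hP := hE.mul hF
  have hPr := hEr.mul hFr
  obtain ⟨s, hs, hs_eq, hspan⟩ := exists_forall_smul_companion_mem_span hPr
  have : CompleteSpace (toL2 E).range := (isClosed_range_toL2 hE hEr).completeSpace_coe
  obtain ⟨δ, hδ0, hδ⟩ := exists_mul_norm_sq_le_norm_sq_starProjection (W := (toL2 E).range)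
    (s := toL2 (fun z => E z * F z) ⟨s, hs⟩) fun hmem => by
      obtain rfl | ⟨α, rfl⟩ := hs_eq
      · exact map_zero (toL2 _)
      · exact absurd hmem (toL2_companion_mul_notMem_range hE hF hEr hFr hs)
  refine ⟨δ, hδ0, fun {ι α lam} hinj hlam f hf => ?_⟩
  have hfF := toL2_mul_right hF hFr ⟨f, hf⟩
  have horth := orthonormal_unitKernel hP hPr hinj fun i => (hlam _).2 (mem_range_self i)
  obtain ⟨c, hc, hres⟩ := exists_sub_starProjection_eq_smul_companion hP hPr
    (fun x => (hlam x).1) ⟨_, hf.mul_right hF hFr⟩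
  have hbound := hδ _ (toL2 E ⟨f, hf⟩) (LinearMap.mem_range_self _ _) <| by
    rw [← hfF, hres]
    obtain ⟨d, hd⟩ := Submodule.mem_span_singleton.1 (hspan α c hc)
    exact Submodule.mem_span_singleton.2 ⟨d, by rw [← map_smul]; congr 1; exact Subtype.ext hd⟩
  rw [← tsum_norm_sq_inner_eq_norm_sq_starProjection horth, norm_toL2, ← hfF] at hbound
  simpa only [norm_inner_unitKernel_sq] using hbound

theorem norm_mul_right (E f : ℂ → ℂ) (hFr : NoRealZeros F) :
    norm (fun z => E z * F z) (fun z => f z * F z) = norm E f := by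
  simp only [norm, normSq, mul_div_mul_right _ _ (hFr _)]

theorem summable_and_tsum_le_norm_sq (hE : HermiteBiehler E) (hr : NoRealZeros E)
    (hinj : Function.Injective lam) (hlam : ∀ i, companion E α (lam i) = 0) {f : ℂ → ℂ}
    (hf : MemHardy E f) :
    Summable (fun n => ‖f (lam n)‖ ^ 2 / (kernel E (lam n) (lam n)).re) ∧
      ∑' n, ‖f (lam n)‖ ^ 2 / (kernel E (lam n) (lam n)).re ≤ norm E f ^ 2 := by
  have horth := orthonormal_unitKernel hE hr hinj hlam
  have hsum := horth.inner_products_summable (toL2 E ⟨f, hf⟩)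
  have hle := horth.tsum_inner_products_le (toL2 E ⟨f, hf⟩)
  simp only [norm_inner_unitKernel_sq, norm_toL2] at hsum hle
  exact ⟨hsum, hle⟩

theorem injective_of_phase_eq {φ : ℝ → ℝ} {α : ℝ}
    {lam : {n : ℤ // ∃ x : ℝ, φ x = n * Real.pi + α} → ℝ}
    (hlam : ∀ n, φ (lam n) = (n : ℤ) * Real.pi + α) : Function.Injective lam := fun n m hnm => by
  have hphase := hlam n
  rw [hnm, hlam m, add_left_inj] at hphase
  exact Subtype.ext (by exact_mod_cast (mul_right_cancel₀ Real.pi_ne_zero hphase).symm)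

theorem IsPhase.companion_eq_zero_iff_mem_range {φ : ℝ → ℝ} {α : ℝ} (hEr : NoRealZeros E)
    (hφ : IsPhase E φ) {lam : {n : ℤ // ∃ x : ℝ, φ x = n * Real.pi + α} → ℝ}
    (hlam : ∀ n, φ (lam n) = (n : ℤ) * Real.pi + α) (x : ℝ) :
    companion E α x = 0 ↔ x ∈ range lam := by
  rw [companion_ofReal_eq_zero_iff hEr hφ]
  constructor
  · rintro ⟨n, hn⟩
    exact ⟨⟨n, x, hn⟩, hφ.strictMono.injective (by rw [hlam, hn])⟩
  · rintro ⟨n, rfl⟩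
    exact ⟨n, hlam n⟩

end Sampling

/-! ### Comparison of the weights -/

section Comparison

variable {E₀ E F : ℂ → ℂ}

theorem kernel_self_re_le (hE₀ : HermiteBiehler E₀) (hE₀r : NoRealZeros E₀)
    (hE : HermiteBiehler E) (hEr : NoRealZeros E) (hsub : space E₀ ⊆ space E) {C : ℝ}
    (hle : ∀ f ∈ space E₀, norm E f ≤ C * norm E₀ f) (x : ℝ) :
    (kernel E₀ x x).re ≤ C ^ 2 * (kernel E x x).re := by
  have hk : kernel E₀ x ∈ space E₀ := hE₀.memSpace_kernel hE₀r x
  have hkE : MemHardy E (kernel E₀ x) := (hsub hk).memHardy hE hEr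
  have hpos := hE₀.norm_kernel_pos hE₀r x
  have hcauchy : norm E₀ (kernel E₀ x) * norm E₀ (kernel E₀ x) ≤
      C * norm E (kernel E x) * norm E₀ (kernel E₀ x) :=
    calc norm E₀ (kernel E₀ x) * norm E₀ (kernel E₀ x) = (kernel E₀ x x).re := by
          rw [← pow_two, sq_norm, hE₀.kernel_self_re hE₀r]
      _ ≤ ‖kernel E₀ x x‖ := re_le_norm _
      _ ≤ norm E (kernel E x) * norm E (kernel E₀ x) := by
          have hinner := norm_inner_le_norm (𝕜 := ℂ)
            (toL2 E ⟨kernel E x, hE.memHardy_kernel hEr x⟩) (toL2 E ⟨_, hkE⟩)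
          rwa [inner_toL2_kernel hE hEr, norm_toL2, norm_toL2] at hinner
      _ ≤ norm E (kernel E x) * (C * norm E₀ (kernel E₀ x)) :=
          mul_le_mul_of_nonneg_left (hle _ hk) (norm_nonneg' _ _)
      _ = _ := by ring
  rw [hE₀.kernel_self_re hE₀r, hE.kernel_self_re hEr, ← sq_norm, ← sq_norm, ← mul_pow]
  exact pow_le_pow_left₀ hpos.le (le_of_mul_le_mul_right hcauchy hpos) 2

theorem le_kernel_mul_self_re (hE : Differentiable ℂ E) (hF : HermiteBiehler F)
    (hFr : NoRealZeros F) (x : ℝ) :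
    ‖F x‖ ^ 2 * (kernel E x x).re ≤ (kernel (fun z => E z * F z) x x).re := by
  rw [kernel_mul_self_re hE hF.entire]
  have := hF.kernel_self_re_pos hFr x
  exact le_add_of_nonneg_right (by positivity)

theorem norm_sq_mul_kernel_self_re_le (hE : Differentiable ℂ E) (hF : Differentiable ℂ F)
    (hEr : NoRealZeros E) (hFr : NoRealZeros F) {φE φF : ℝ → ℝ} (hφE : IsPhase E φE)
    (hφF : IsPhase F φF) {M x : ℝ} (hM : deriv φF x ≤ M * deriv φE x) :
    ‖E x‖ ^ 2 * (kernel F x x).re ≤ M * (‖F x‖ ^ 2 * (kernel E x x).re) := by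
  have hEx : 0 < ‖E x‖ := norm_pos_iff.2 (hEr x)
  have hFx : 0 < ‖F x‖ := norm_pos_iff.2 (hFr x)
  rw [(hφE.hasDerivAt hE hEr x).deriv, (hφF.hasDerivAt hF hFr x).deriv, ← mul_div_assoc,
    div_le_div_iff₀ (by positivity) (by positivity)] at hM
  refine le_of_mul_le_mul_left (a := Real.pi) ?_ Real.pi_pos
  linarith

theorem exists_kernel_mul_self_re_bounds (hE₀ : HermiteBiehler E₀) (hE : HermiteBiehler E)
    (hF : HermiteBiehler F) (hE₀r : NoRealZeros E₀) (hEr : NoRealZeros E) (hFr : NoRealZeros F)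
    (hsame : SameSpace E₀ E) {φE φF : ℝ → ℝ} (hφE : IsPhase E φE) (hφF : IsPhase F φF) {M : ℝ}
    (hM : ∀ x, deriv φF x ≤ M * deriv φE x) :
    ∃ a b : ℝ, 0 < a ∧ 0 < b ∧ ∀ x : ℝ,
      a * (‖F x‖ ^ 2 * (kernel E₀ x x).re) ≤ (kernel (fun z => E z * F z) x x).re ∧
      (kernel (fun z => E z * F z) x x).re ≤ b * (‖F x‖ ^ 2 * (kernel E₀ x x).re) := by
  obtain ⟨hspace, c, C, hc, hC, hcC⟩ := hsame
  have hK₀ := kernel_self_re_le hE₀ hE₀r hE hEr hspace.le fun f hf => (hcC f hf).2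
  have hK := kernel_self_re_le hE hEr hE₀ hE₀r hspace.ge fun f hf =>
    (le_inv_mul_iff₀ hc).2 (hcC f (hspace ▸ hf)).1
  refine ⟨(C ^ 2)⁻¹, (1 + |M|) * c⁻¹ ^ 2, by positivity, by positivity, fun x => ⟨?_, ?_⟩⟩
  · rw [inv_mul_le_iff₀ (by positivity)]
    calc ‖F x‖ ^ 2 * (kernel E₀ x x).re ≤ ‖F x‖ ^ 2 * (C ^ 2 * (kernel E x x).re) := by
          gcongr; exact hK₀ x
      _ = C ^ 2 * (‖F x‖ ^ 2 * (kernel E x x).re) := by ring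
      _ ≤ C ^ 2 * (kernel (fun z => E z * F z) x x).re := by
          gcongr; exact le_kernel_mul_self_re hE.entire hF hFr x
  · have hpos := hE.kernel_self_re_pos hEr x
    rw [kernel_mul_self_re hE.entire hF.entire]
    calc ‖F x‖ ^ 2 * (kernel E x x).re + ‖E x‖ ^ 2 * (kernel F x x).re
        ≤ ‖F x‖ ^ 2 * (kernel E x x).re + M * (‖F x‖ ^ 2 * (kernel E x x).re) := by
          gcongr _ + ?_
          exact norm_sq_mul_kernel_self_re_le hE.entire hF.entire hEr hFr hφE hφF (hM x)
      _ ≤ ‖F x‖ ^ 2 * (kernel E x x).re + |M| * (‖F x‖ ^ 2 * (kernel E x x).re) := by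
          gcongr; exact le_abs_self M
      _ = (1 + |M|) * (‖F x‖ ^ 2 * (kernel E x x).re) := by ring
      _ ≤ (1 + |M|) * (‖F x‖ ^ 2 * (c⁻¹ ^ 2 * (kernel E₀ x x).re)) := by gcongr; exact hK x
      _ = _ := by ring

theorem summable_and_tsum_bounds_of_le_mul {ι : Type*} {t u : ι → ℝ} {a b : ℝ} (ht : Summable t)
    (hu : ∀ i, 0 ≤ u i) (hle : ∀ i, a * t i ≤ u i) (hge : ∀ i, u i ≤ b * t i) :
    Summable u ∧ a * ∑' i, t i ≤ ∑' i, u i ∧ ∑' i, u i ≤ b * ∑' i, t i := by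
  have hsum := Summable.of_nonneg_of_le hu hge (ht.mul_left b)
  rw [← tsum_mul_left, ← tsum_mul_left]
  exact ⟨hsum, (ht.mul_left a).tsum_le_tsum hle hsum, hsum.tsum_le_tsum hge (ht.mul_left b)⟩

theorem weighted_norm_sq_bounds {k p a b : ℝ} (v : ℂ) {w : ℂ} (hw : w ≠ 0) (hk : 0 < k)
    (ha : 0 < a) (hle : a * (‖w‖ ^ 2 * k) ≤ p) (hge : p ≤ b * (‖w‖ ^ 2 * k)) :
    a * (‖v * w‖ ^ 2 / p) ≤ ‖v‖ ^ 2 / k ∧ ‖v‖ ^ 2 / k ≤ b * (‖v * w‖ ^ 2 / p) := by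
  have : 0 < ‖w‖ := norm_pos_iff.2 hw
  have hp : 0 < p := lt_of_lt_of_le (by positivity) hle
  have hquot : ‖v‖ ^ 2 / k = ‖v * w‖ ^ 2 / (‖w‖ ^ 2 * k) := by
    rw [norm_mul, mul_pow, mul_comm (‖v‖ ^ 2), mul_div_mul_left _ _ (by positivity)]
  rw [hquot, ← mul_div_assoc, ← mul_div_assoc, div_le_div_iff₀ hp (by positivity),
    div_le_div_iff₀ (by positivity) hp]
  have hsq : 0 ≤ ‖v * w‖ ^ 2 := by positivity
  constructor
  · linarith [mul_le_mul_of_nonneg_left hle hsq]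
  · linarith [mul_le_mul_of_nonneg_left hge hsq]

theorem normalizedSamplingWith_of_comparable {P : ℂ → ℂ} {ι : Type} {lam : ι → ℝ}
    {a b c C δ : ℝ} (ha : 0 < a) (hb : 0 < b) (hc : 0 < c) (hC : 0 < C) (hδ : 0 < δ)
    (hE₀ : HermiteBiehler E₀) (hE₀r : NoRealZeros E₀) (hFr : NoRealZeros F)
    (hkernel : ∀ x : ℝ, a * (‖F x‖ ^ 2 * (kernel E₀ x x).re) ≤ (kernel P x x).re ∧
      (kernel P x x).re ≤ b * (‖F x‖ ^ 2 * (kernel E₀ x x).re))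
    (hnorm : ∀ f ∈ space E₀, c * norm E₀ f ≤ norm E f ∧ norm E f ≤ C * norm E₀ f)
    (hsampling : ∀ f ∈ space E₀,
      Summable (fun n => ‖f (lam n) * F (lam n)‖ ^ 2 / (kernel P (lam n) (lam n)).re) ∧
      δ * norm E f ^ 2 ≤ ∑' n, ‖f (lam n) * F (lam n)‖ ^ 2 / (kernel P (lam n) (lam n)).re ∧
      ∑' n, ‖f (lam n) * F (lam n)‖ ^ 2 / (kernel P (lam n) (lam n)).re ≤ norm E f ^ 2) :
    NormalizedSamplingWith E₀ lam (a * (δ * c ^ 2)) (b * C ^ 2) := by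
  refine ⟨by positivity, by positivity, fun f hf => ?_⟩
  have hpos (n : ι) := hE₀.kernel_self_re_pos hE₀r (lam n)
  have hterm (n : ι) := weighted_norm_sq_bounds (f (lam n)) (hFr (lam n)) (hpos n) ha
    (hkernel (lam n)).1 (hkernel (lam n)).2
  obtain ⟨hsum, hlow, hupp⟩ := hsampling f hf
  obtain ⟨hsum₀, hlow₀, hupp₀⟩ := summable_and_tsum_bounds_of_le_mul hsum
    (fun n => div_nonneg (sq_nonneg _) (hpos n).le) (fun n => (hterm n).1) fun n => (hterm n).2
  have hN₀ := norm_nonneg' E₀ f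
  have hN := norm_nonneg' E f
  refine ⟨hsum₀, le_trans ?_ hlow₀, hupp₀.trans ?_⟩
  · calc a * (δ * c ^ 2) * norm E₀ f ^ 2 = a * (δ * (c * norm E₀ f) ^ 2) := by ring
      _ ≤ a * (δ * norm E f ^ 2) := by gcongr; exact (hnorm f hf).1
      _ ≤ _ := by gcongr
  · calc b * _ ≤ b * norm E f ^ 2 := by gcongr
      _ ≤ b * (C * norm E₀ f) ^ 2 := by gcongr; exact (hnorm f hf).2
      _ = _ := by ring

end Comparison

end DeBranges

theorem mainTheorem2
    (E₀ E F : ℂ → ℂ)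
    (hE₀ : DeBranges.HermiteBiehler E₀) (hE : DeBranges.HermiteBiehler E)
    (hF : DeBranges.HermiteBiehler F)
    (hE₀r : DeBranges.NoRealZeros E₀) (hEr : DeBranges.NoRealZeros E)
    (hFr : DeBranges.NoRealZeros F)
    (hsame : DeBranges.SameSpace E₀ E)
    (φE φF φEF : ℝ → ℝ)
    (hφE : DeBranges.IsPhase E φE) (hφF : DeBranges.IsPhase F φF)
    (hφEF : DeBranges.IsPhase (fun z => E z * F z) φEF)
    (hφ : ∃ C : ℝ, ∀ x : ℝ, deriv φF x ≤ C * deriv φE x) :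
    ∃ A B : ℝ, ∀ α ∈ Set.Ico (0 : ℝ) Real.pi,
      ∀ lam : {n : ℤ // ∃ x : ℝ, φEF x = n * Real.pi + α} → ℝ,
        (∀ n, φEF (lam n) = (n : ℤ) * Real.pi + α) →
          DeBranges.NormalizedSamplingWith E₀ lam A B := by
  open DeBranges in
  obtain ⟨M, hM⟩ := hφ
  obtain ⟨a, b, ha, hb, hkernel⟩ :=
    exists_kernel_mul_self_re_bounds hE₀ hE hF hE₀r hEr hFr hsame hφE hφF hM
  obtain ⟨hspace, c, C, hc, hC, hnorm⟩ := hsame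
  obtain ⟨δ, hδ, hlower⟩ := exists_mul_norm_sq_le_tsum_mul hE hF hEr hFr
  refine ⟨a * (δ * c ^ 2), b * C ^ 2, fun α _ lam hlam => ?_⟩
  have hinj := injective_of_phase_eq hlam
  have hzeros := hφEF.companion_eq_zero_iff_mem_range (hEr.mul hFr) hlam
  refine normalizedSamplingWith_of_comparable ha hb hc hC hδ hE₀ hE₀r hFr hkernel hnorm
    fun f hf => ?_
  have hfE : MemHardy E f := MemSpace.memHardy hE hEr (hspace ▸ hf : f ∈ space E)
  obtain ⟨hsum, hupper⟩ := summable_and_tsum_le_norm_sq (hE.mul hF) (hEr.mul hFr) hinj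
    (fun n => (hzeros _).2 (Set.mem_range_self n)) (hfE.mul_right hF hFr)
  rw [norm_mul_right E f hFr] at hupper
  exact ⟨hsum, hlower hinj hzeros f hfE, hupper⟩
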